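/- Let $\mathcal L_M$ be a finite geometric lattice of rank $r+1\ge 1$, with minimum $\hat 0$ and maximum $\hat 1$, and let $d(x,y)$ denote the rank of an interval $[x,y]$ of $\mathcal L_M$. Let $\mathcal G\subseteq \mathcal L_M\setminus\{\hat 0\}$ be a building set with $\hat 1\in\mathcal G$ (for each $x\ne\hat 0$, if $\max\mathcal G_{\le x}=\{x_1,\dots,x_k\}$, there is a poset isomorphism $\prod_j[\hat 0,x_j]\cong[\hat 0,x]$ sending $(\hat 0,\dots,x_j,\dots,\hat 0)$ to $x_j$ for each $j$). Let $\mathcal H\subseteq\mathcal G$ be a partial building set: $\mathcal H$ contains all atoms of $\mathcal L_M$, and the set $\mathcal H^\circ$ of non-atoms in $\mathcal H$ is an order filter of $\mathcal G$. Assume $\hat 1\in\mathcal H$. For an element $p>\hat 0$ of a finite meet-semilattice $\mathcal L$, the combinatorial blowup $\mathrm{Bl}_p(\mathcal L)$ consists of the $x\in\mathcal L$ with $x\not\ge p$ and the pairs $(p,x)$ with $x\not\ge p$ for which $p\vee x$ exists; the relations $x\le y$, $(p,x)\le(p,y)$ and $x\le(p,y)$ hold exactly when $x\le y$ in $\mathcal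 L$, and $(p,x)\le y$ never holds. The blow-down map $\mathrm{Bl}_p(\mathcal L)\to\mathcal L$ sends $x\mapsto x$ and $(p,x)\mapsto p\vee x$. Let $\mathcal L(\mathcal L_M,\mathcal H)$ be obtained from $\mathcal L_M$ by successively blowing up the elements $p_1,\dots,p_m$ of $\mathcal H^\circ$, in any order in which larger elements come first, and let $\pi:\mathcal L(\mathcal L_M,\mathcal H)\to\mathcal L_M$ be the composite blow-down map. The set $\mathcal G$ is viewed as a subset of $\mathcal L(\mathcal L_M,\mathcal H)$: an element $g\in\mathcal H^\circ$ is identified with the new atom $(g,\hat 0)$, and the other elements of $\mathcal G$ survive all the blowups. For $y\in\mathcal L(\mathcal L_M,\mathcal H)$ let $\operatorname{rank}(y)$ be its rank in $\mathcal L(\mathcal L_M,\mathcal H)$, let $\operatorname{supp}(y)$ be the set of $h\in\mathcal H$ with $h\le y$, let $F^+(y)=\max(\mathcal G_{\le y})\cup\{\hat 1\}$, with order and maximality taken in $\mathcal L(\mathcal L_M,\mathcal H)$, and for $g\in F^+(y)$ let $z_y(g)=\bigvee\{f\in F^+(y): f<g\}$, taken in $\mathcal L_M$. A set $S\subseteq\mathcal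 H$ is $\mathcal H$-nested if no antichain in $S$ with at least two elements has its join in $\mathcal L_M$ in $\mathcal H$. For $y\in \mathcal L(\mathcal L_M,\mathcal H)$ let $D_y(\mathcal L_M,\mathcal H)$ be the quotient of $\mathbb Q[x_g:g\in\mathcal H]$ by the ideal generated by the monomials $x_T=\prod_{g\in T}x_g$ for $T\subseteq\mathcal H$ with $\operatorname{supp}(y)\cup T$ not $\mathcal H$-nested, and by $\sum_{h\in\mathcal H,\,h\ge a}x_h$ for each atom $a$ of $\mathcal L_M$; it is graded with $\deg x_g=2$. Let $D=D_{\hat 0}(\mathcal L_M,\mathcal H)$; each $D_y(\mathcal L_M,\mathcal H)$ is a quotient algebra of $D$, hence a graded $D$-module. Put $$\mu_y=\prod_{g\in F^+(y)\cap\mathcal H}(-x_g)^{d(z_y(g),g)-1}\in D_y(\mathcal L_M,\mathcal H).$$ **Proposition.** Let $y\in\mathcal L(\mathcal L_M,\mathcal H)$ with $\pi(y)\ne\hat 1$, and put $s=2r-2\operatorname{rank}(y)$. Then $\mu_y$ lies in the degree-$s$ part of $D_y(\mathcal L_M,\mathcal H)$, and for every $w\in D_y(\mathcal L_M,\mathcal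 H)$ there is a unique $c\in\mathbb Q$ such that the degree-$s$ component of $w$ is $c\,\mu_y$ (the coefficient of $\mu_y$ in $w$). With $\langle u,v\rangle_y$ denoting the coefficient of $\mu_y$ in $uv$, the map $v\mapsto\langle -,v\rangle_y$ is bijective from $D_y(\mathcal L_M,\mathcal H)$ onto its dual, and its inverse is an isomorphism of graded $D$-modules $$D_y(\mathcal L_M,\mathcal H)^\vee\;\cong\;D_y(\mathcal L_M,\mathcal H)[2r-2\operatorname{rank}(y)].$$ Here $M[s]^i=M^{i+s}$, $D_y(\mathcal L_M,\mathcal H)^\vee=\operatorname{Hom}_{\mathbb Q}(D_y(\mathcal L_M,\mathcal H),\mathbb Q)$ with $D$ acting by $(a\varphi)(u)=\varphi(au)$, and its degree-$i$ part consists of the functionals that vanish on all homogeneous parts of degree different from $-i$. -/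

import Mathlib

universe u

/-! ## Building sets, partial building sets and nested sets -/

section Building

variable {L : Type u} [Lattice L] [BoundedOrder L]

open scoped Classical in
/-- The set `max G_{≤ x}` of maximal elements of `G` below `x` (the factors of `x`). -/
noncomputable def latticeFactors (G : Finset L) (x : L) : Finset L :=
  {g ∈ G | g ≤ x ∧ ∀ g' ∈ G, g' ≤ x → g ≤ g' → g' = g}

open scoped Classical in
/-- `G` is a combinatorial building set: `G ⊆ L \ {⊥}` and, for every `x ≠ ⊥`, with
`max G_{≤ x} = {x₁, …, x_k}` there is an isomorphism of posets `∏ j, [⊥, x_j] ≃ [⊥, x]` that sends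
`(⊥, …, x_j, …, ⊥)` to `x_j` for each `j`. -/
def IsBuildingSet (G : Finset L) : Prop :=
  ⊥ ∉ G ∧ ∀ x : L, x ≠ ⊥ →
    ∃ φ : (∀ j : latticeFactors G x, Set.Iic (j : L)) ≃o Set.Iic x,
      ∀ j : latticeFactors G x,
        ((φ (Function.update (fun i => (⊥ : Set.Iic (i : L))) j ⊤) : Set.Iic x) : L) = j

/-- `H` is a partial building set inside `G`: it contains all atoms of `L`, and its set of
non-atoms is an order filter of `G`. -/
structure IsPartialBuildingSet (G H : Finset L) : Prop where
  subset : H ⊆ G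
  atoms_mem : ∀ a : L, IsAtom a → a ∈ H
  filter : ∀ p ∈ H, ¬ IsAtom p → ∀ q ∈ G, p ≤ q → q ∈ H ∧ ¬ IsAtom q

/-- `S` is `H`-nested: `S ⊆ H`, and no antichain in `S` with at least two elements has its join
(taken in `L`) in `H`. -/
def IsNested (H S : Finset L) : Prop :=
  S ⊆ H ∧ ∀ A : Finset L, A ⊆ S → IsAntichain (· ≤ ·) (A : Set L) → 2 ≤ A.card → A.sup id ∉ H

lemma IsNested.mono {H S T : Finset L} (h : IsNested H T) (hST : S ⊆ T) : IsNested H S :=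
  ⟨hST.trans h.1, fun A hA => h.2 A (hA.trans hST)⟩

/-- The rank of an element of the ranked lattice `L`. -/
noncomputable def latticeRank (x : L) : ℕ := (Order.height x).toNat

/-- `d(x, y)`, the rank of the interval `[x, y]` for `x ≤ y`. -/
noncomputable def intervalRank (x y : L) : ℕ := latticeRank y - latticeRank x

end Building

/-! ## Combinatorial blowups -/

/-- The combinatorial blowup `Bl_p(P)`: its elements are the `x ∈ P` with `x ≱ p`, and the pairs
`(p, x)` with `x ≱ p` such that the join `p ∨ x` exists in `P`. -/
inductive Blowup {P : Type u} [PartialOrder P] (p : P) : Type u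
  | old (x : P) (hx : ¬ p ≤ x) : Blowup p
  | exc (x : P) (hx : ¬ p ≤ x) (hj : ∃ s, IsLUB {p, x} s) : Blowup p

namespace Blowup

variable {P : Type u} [PartialOrder P] {p : P}

/-- The order: `x ≤ y`, `(p, x) ≤ (p, y)` and `x ≤ (p, y)` hold exactly when `x ≤ y` in `P`, and
`(p, x) ≤ y` never holds. -/
protected def le : Blowup p → Blowup p → Prop
  | old x _, old y _ => x ≤ y
  | old x _, exc y _ _ => x ≤ y
  | exc x _ _, exc y _ _ => x ≤ y
  | exc _ _ _, old _ _ => False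

instance : PartialOrder (Blowup p) where
  le := Blowup.le
  le_refl a := by cases a <;> exact le_refl _
  le_trans a b c hab hbc := by
    cases a <;> cases b <;> cases c <;>
      first
        | exact le_trans (α := P) hab hbc
        | exact hab.elim
        | exact hbc.elim
  le_antisymm a b hab hba := by
    cases a <;> cases b
    · have h := le_antisymm (α := P) hab hba
      subst h; rfl
    · exact hba.elim
    · exact hab.elim
    · have h := le_antisymm (α := P) hab hba
      subst h; rfl

/-- The blow-down map `Bl_p(P) → P`: `x ↦ x` and `(p, x) ↦ p ∨ x`. -/
noncomputable def down : Blowup p → P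
  | old x _ => x
  | exc _ _ hj => hj.choose

variable (p)

open scoped Classical in
/-- The element `x` of `Bl_p(P)`, when it survives, that is when `x ≱ p`. -/
noncomputable def old? (x : P) : Option (Blowup p) :=
  if hx : ¬ p ≤ x then some (old x hx) else none

open scoped Classical in
/-- The element `(p, x)` of `Bl_p(P)`, when there is one. -/
noncomputable def exc? (x : P) : Option (Blowup p) :=
  if hx : ¬ p ≤ x ∧ ∃ s, IsLUB {p, x} s then some (exc x hx.1 hx.2) else none

end Blowup

section PartialBlowup

variable {L : Type u} [Lattice L] [BoundedOrder L]

variable (L) in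
/-- A stage in a sequence of blowups of `L`: the current poset, the elements of it that are denoted
by elements of `L`, and the composite blow-down map to `L`. -/
structure BlowupStage where
  carrier : Type u
  [po : PartialOrder carrier]
  /-- The element of the current poset denoted by `x`: the new atom `(x, ⊥)` if `x` has been
  blown up, the element `x` itself if it has survived all the blowups, and `none` otherwise. -/
  elt : L → Option carrier
  /-- The blow-down map. -/
  proj : carrier → L

attribute [instance] BlowupStage.po

variable (L) in
/-- The lattice `L` itself, before any blowup. -/
def BlowupStage.init : BlowupStage L where
  carrier := L
  elt := some
  proj := id

open scoped Classical in
/-- The next stage: blow up the current poset at the element denoted by `q`. -/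
noncomputable def BlowupStage.blowupAt (X : BlowupStage L) (q : L) : BlowupStage L :=
  match X.elt q with
  | none => X
  | some p =>
    { carrier := Blowup p
      elt := fun x =>
        if x = q then (X.elt ⊥).bind (Blowup.exc? p) else (X.elt x).bind (Blowup.old? p)
      proj := fun z => X.proj z.down }

/-- `Bl_{p_m} ∘ ⋯ ∘ Bl_{p_1} (L)` for `l = [p_1, …, p_m]`. -/
noncomputable def iteratedBlowup (l : List L) : BlowupStage L :=
  l.foldl BlowupStage.blowupAt (BlowupStage.init L)

/-- `l` lists the non-atoms of `H` without repetition along a reverse linear extension: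
larger elements come first. -/
def IsBlowupOrder (H : Finset L) (l : List L) : Prop :=
  (∀ x : L, x ∈ l ↔ x ∈ H ∧ ¬ IsAtom x) ∧ l.Pairwise (fun p q => ¬ p ≤ q)

namespace BlowupStage

variable (X : BlowupStage L)

/-- The rank of `y` in the current poset. -/
noncomputable def rank (y : X.carrier) : ℕ := (Order.height y).toNat

/-- The element denoted by `x : L` exists in the current poset and lies below `y`. -/
def EltLE (x : L) (y : X.carrier) : Prop := ∃ a, X.elt x = some a ∧ a ≤ y

open scoped Classical in
/-- The support of `y`: the set of elements of `H`, viewed as elements of the current poset (in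
`L(L, H)` these are its atoms), that lie below `y`. -/
noncomputable def supp (H : Finset L) (y : X.carrier) : Finset L :=
  {h ∈ H | X.EltLE h y}

open scoped Classical in
/-- The factors `F(y) = max G_{≤ y}`, where `G` is viewed as a subset of the current poset, and
order and maximality are those of the current poset. -/
noncomputable def factors (G : Finset L) (y : X.carrier) : Finset L :=
  {g ∈ G | ∃ a, X.elt g = some a ∧ a ≤ y ∧
    ∀ g' ∈ G, ∀ a', X.elt g' = some a' → a' ≤ y → a ≤ a' → a' = a}

open scoped Classical in
/-- `F⁺(y) = F(y) ∪ {⊤}`. -/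
noncomputable def factorsPlus (G : Finset L) (y : X.carrier) : Finset L :=
  insert ⊤ (X.factors G y)

open scoped Classical in
/-- `z_y(g)`, the join in `L` of all `f ∈ F⁺(y)` with `f < g`. -/
noncomputable def zElt (G : Finset L) (y : X.carrier) (g : L) : L :=
  {f ∈ X.factorsPlus G y | f < g}.sup id

end BlowupStage

end PartialBlowup

/-- For a ring homomorphism `f : A → B` and a `ℚ`-algebra `B`, the dual `B^∨` as an `A`-module:
`(a • φ) u = φ (f a * u)`. -/
@[reducible] noncomputable def dualModule {A B : Type u} [CommRing A] [CommRing B] [Algebra ℚ B]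
    (f : A →+* B) : Module A (Module.Dual ℚ B) where
  smul a φ := φ.comp (LinearMap.mulLeft ℚ (f a))
  one_smul φ := by
    ext1 u
    change φ (f 1 * u) = φ u
    rw [map_one, one_mul]
  mul_smul a b φ := by
    ext1 u
    change φ (f (a * b) * u) = φ (f b * (f a * u))
    rw [map_mul f, ← mul_assoc, mul_comm (f b)]
  smul_zero a := by
    ext1 u
    rfl
  smul_add a φ ψ := by
    ext1 u
    rfl
  add_smul a b φ := by
    ext1 u
    change φ (f (a + b) * u) = φ (f a * u) + φ (f b * u)
    rw [map_add, add_mul, map_add]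
  zero_smul φ := by
    ext1 u
    change φ (f 0 * u) = 0
    rw [map_zero, zero_mul, map_zero]

/-! ## De Concini–Procesi algebras -/

section DeConciniProcesi

open MvPolynomial

variable {L : Type u} [Lattice L] [BoundedOrder L] (H S : Finset L)

open scoped Classical in
/-- `c_g = ∑ x_h`, summed over all `h ∈ H` with `g ≤ h`. -/
noncomputable def cElt (g : L) : MvPolynomial H ℚ :=
  ∑ h : H, if g ≤ (h : L) then X h else 0

open scoped Classical in
/-- The ideal generated by the monomials `x_T` for which `S ∪ T` is not `H`-nested, and by the
elements `c_a` for the atoms `a` of `L`. -/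
noncomputable def dpIdeal : Ideal (MvPolynomial H ℚ) :=
  Ideal.span
    ({f | ∃ T : Finset H, ¬ IsNested H (S ∪ T.map (Function.Embedding.subtype _)) ∧
        f = ∏ t ∈ T, X t} ∪
      {f | ∃ a : L, IsAtom a ∧ f = cElt H a})

/-- The algebra attached to a nested set `S`. For `S = ∅` this is the De Concini–Procesi algebra
`D(L, H)`, and for `S` the support of `y` it is the local algebra `D_y(L, H)`. -/
abbrev DPAlg : Type u := MvPolynomial H ℚ ⧸ dpIdeal H S

lemma dpIdeal_empty_le : dpIdeal H ∅ ≤ dpIdeal H S := by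
  classical
  refine Ideal.span_mono (Set.union_subset_union_left _ ?_)
  rintro f ⟨T, hT, rfl⟩
  refine ⟨T, fun h => hT (h.mono ?_), rfl⟩
  exact Finset.union_subset_union (Finset.empty_subset _) (le_refl _)

/-- The restriction map `D(L, H) → D_y(L, H)`, `x_h ↦ x_h`. -/
noncomputable def dpRestrict : DPAlg H ∅ →+* DPAlg H S :=
  Ideal.Quotient.factor (dpIdeal_empty_le H S)

/-- `D_y(L, H)` as a module over `D(L, H)`. -/
noncomputable instance dpModule : Module (DPAlg H ∅) (DPAlg H S) :=
  Module.compHom (DPAlg H S) (dpRestrict H S)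

/-- The `ℚ`-dual of `D_y(L, H)`. -/
abbrev DPDual : Type u := Module.Dual ℚ (DPAlg H S)

/-- `D_y(L, H)^∨` as a module over `D(L, H)`: `(a • φ) u = φ (a • u)`. -/
noncomputable instance dpDualModule : Module (DPAlg H ∅) (DPDual H S) :=
  dualModule (dpRestrict H S)

/-- The homogeneous part of degree `i` of `D_y(L, H)`, where each `x_g` has degree `2`. -/
noncomputable def dpPart (i : ℤ) : Submodule ℚ (DPAlg H S) :=
  (weightedHomogeneousSubmodule ℚ (fun _ : H => (2 : ℤ)) i).map
    (Ideal.Quotient.mkₐ ℚ (dpIdeal H S)).toLinearMap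

/-- The homogeneous part of degree `i` of the dual: functionals that vanish on all homogeneous
parts of degree different from `-i`. -/
def dpDualPart (i : ℤ) : Submodule ℚ (DPDual H S) where
  carrier := {φ | ∀ j : ℤ, j ≠ -i → ∀ w ∈ dpPart H S j, φ w = 0}
  zero_mem' := fun _ _ _ _ => rfl
  add_mem' := fun {φ ψ} hφ hψ j hj w hw => by
    rw [LinearMap.add_apply, hφ j hj w hw, hψ j hj w hw, add_zero]
  smul_mem' := fun c φ hφ j hj w hw => by
    rw [LinearMap.smul_apply, hφ j hj w hw, smul_zero]

/-- The grading of the shifted module `M[s]`: `M[s]^i = M^{i+s}`. -/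
def shiftGrading {M : Type u} [AddCommGroup M] [Module ℚ M] (𝒜 : ℤ → Submodule ℚ M) (s : ℤ) :
    ℤ → Submodule ℚ M :=
  fun i => 𝒜 (i + s)

end DeConciniProcesi

/-! ## The pairing -/

section Pairing

open MvPolynomial

variable {L : Type u} [Lattice L] [BoundedOrder L] (X : BlowupStage L) (G H : Finset L)
  (y : X.carrier)

open scoped Classical in
/-- `μ_y`, the product of `(-x_g)^(d(z_y(g), g) - 1)` over `g ∈ F⁺(y) ∩ H`, in `D_y(L, H)`. -/
noncomputable def muElt : DPAlg H (X.supp H y) :=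
  Ideal.Quotient.mk _ (∏ g : H, if (g : L) ∈ X.factorsPlus G y then
    (-MvPolynomial.X g) ^ (intervalRank (X.zElt G y g) g - 1) else 1)

/-- `c` is the coefficient of `μ_y` in `w`: the component of `w` in degree `n`
(the degree of `μ_y`) is `c μ_y`. -/
def IsMuCoeff (n : ℤ) (w : DPAlg H (X.supp H y)) (c : ℚ) : Prop :=
  w - c • muElt X G H y ∈ ⨆ j : {j : ℤ // j ≠ n}, dpPart H (X.supp H y) j

open scoped Classical in
/-- The coefficient of `μ_y` in the product `u v`, where `n` is the degree of `μ_y`. -/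
noncomputable def muPairing (n : ℤ) (u v : DPAlg H (X.supp H y)) : ℚ :=
  if h : ∃ c : ℚ, IsMuCoeff X G H y n (u * v) c then h.choose else 0

end Pairing

/-! For a linear functional `φ` on a polynomial ring, let `annIdeal φ` be the largest ideal in its
kernel. If `φ` is homogeneous of degree `n`, the quotient by `annIdeal φ` has a perfect pairing `(u,
v) ↦ φ (u v)`, and its top part is detected by `φ` (Macaulay's inverse systems). The theorem
therefore amounts to exhibiting a homogeneous functional that has the defining ideal of `D_y` as its
annihilator and does not vanish on `μ_y`. Such a functional is an `IsDualizing` one, and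
`exists_isDualizing` provides it.

The elements `y` are encoded by pairs `(S, x)`: `S` is the set of blown-up elements below `y`, and
`x : L` lies above no non-atom of `H`. Then `rank y = |S| + rank x`, the support of `y` consists of
`S` and the atoms below `x`, and `μ_y` becomes `topMonomial S x`. `StageModel` sets up this
dictionary by induction along the sequence of blowups.

The functional is built by induction on the number of non-atoms of `H`. Let `p ≠ ⊤` be a minimal
non-atom of `H`, let `A` be a set of atoms that is a basis of `p` over `x ⊓ p`, and let `P = ∏ (t -
x_a)` over `a ∈ A`. The substitution `x_p ↦ t`, `x_a ↦ x_a - t` for the atoms `a ≤ p` compares the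
algebras for `H` and for `H.erase p`; the centre of the blowup is the algebra of `(S, p ⊔ x)`. There
are three cases. If `p` belongs to the first component `insert p S`, the algebra is that of the
centre with `t` adjoined modulo `P`, as for a projective bundle (`annIdeal_bundleFunctional`). If `p
∉ S` and `p` is compatible with `(S, x)`, the algebra arises from the one of `(S, x)` by adjoining
`t` modulo `P` and modulo `t` times the relations of the centre, as for a blowup
(`annIdeal_blowupFunctional`). If `p` is incompatible with `(S, x)`, nothing changes
(`nestedIdeal_erase_eq`). When the only non-atom of `H` can be `⊤`, the algebra is `ℚ[t] / t ^ (n +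
1)`.

The blowup case needs the functional of the centre to be `φ` multiplied by the constant term of `P`.
This holds up to a scalar by uniqueness of homogeneous functionals, and the scalar is nonzero
because the product of the `x_a` is not a relation. The nonvanishing of such products is the field
`prod_notMem`, carried through the induction for this purpose.

All ideals live in the polynomial ring on all of `L`, with the variables outside `H` set to zero, so
that the induction can change `H` without changing the ring. -/

/-! ## Rank functions of finite semimodular lattices -/

section Rank

/-- There is a chain `a < ⋯ < b` of length `n`. -/
def HasChain {α : Type u} [LT α] : ℕ → α → α → Prop
  | 0, a, b => a = b
  | n + 1, a, b => ∃ c, a < c ∧ HasChain n c b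

/-- There is a saturated chain `a ⋖ ⋯ ⋖ b` of length `n`. -/
def HasSatChain {α : Type u} [LT α] : ℕ → α → α → Prop
  | 0, a, b => a = b
  | n + 1, a, b => ∃ c, a ⋖ c ∧ HasSatChain n c b

lemma HasChain.le {α : Type u} [PartialOrder α] {n : ℕ} {a b : α} (h : HasChain n a b) :
    a ≤ b := by
  induction n generalizing a with
  | zero => exact le_of_eq h
  | succ n ih => obtain ⟨c, hc, h⟩ := h; exact hc.le.trans (ih h)

lemma HasSatChain.hasChain {α : Type u} [PartialOrder α] {n : ℕ} {a b : α}
    (h : HasSatChain n a b) : HasChain n a b := by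
  induction n generalizing a with
  | zero => exact h
  | succ n ih => obtain ⟨c, hc, h⟩ := h; exact ⟨c, hc.lt, ih h⟩

lemma HasSatChain.append {α : Type u} [PartialOrder α] {m n : ℕ} {a b c : α}
    (h : HasSatChain m a b) (h' : HasSatChain n b c) : HasSatChain (m + n) a c := by
  induction m generalizing a with
  | zero => obtain rfl : a = b := h; simpa using h'
  | succ m ih =>
    obtain ⟨d, hd, h⟩ := h
    rw [Nat.succ_add]
    exact ⟨d, hd, ih h⟩

lemma exists_hasSatChain {α : Type u} [PartialOrder α] [Finite α] {a b : α} (h : a ≤ b) :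
    ∃ n, HasSatChain n a b := by
  induction a using WellFoundedGT.induction with
  | ind a ih =>
    rcases h.eq_or_lt with rfl | hlt
    · exact ⟨0, rfl⟩
    · obtain ⟨c, hc, hcb⟩ := exists_covBy_le_of_lt hlt
      obtain ⟨n, hn⟩ := ih c hc.lt hcb
      exact ⟨n + 1, c, hc, hn⟩

/-- Join the chain with `a'`. By semimodularity the cover `a ⋖ a'` is carried up to a cover `v ⋖ a'
⊔ v` until the chain absorbs `a'`, which costs a single step. -/
lemma HasChain.of_covBy {L : Type u} [Lattice L] [IsUpperModularLattice L] {m : ℕ}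
    {a a' b : L} (h : HasChain m a b) (ha : a ⋖ a') (hb : a' ≤ b) :
    ∃ m', HasChain m' a' b ∧ m ≤ m' + 1 := by
  induction m generalizing a a' with
  | zero =>
    obtain rfl : a = b := h
    exact absurd hb ha.lt.not_ge
  | succ m ih =>
    obtain ⟨v, hv, h⟩ := h
    by_cases hle : a' ≤ v
    · rcases hle.eq_or_lt with rfl | hlt
      · exact ⟨m, h, le_rfl⟩
      · exact ⟨m + 1, ⟨v, hlt, h⟩, by omega⟩
    · have hinf : a' ⊓ v = a := by
        rcases ha.eq_or_eq (le_inf ha.le hv.le) inf_le_left with h1 | h1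
        · exact h1
        · exact absurd (inf_eq_left.1 h1) hle
      have hcov : v ⋖ a' ⊔ v :=
        covBy_sup_of_inf_covBy_left (hinf.symm ▸ ha)
      obtain ⟨m', hm', hle'⟩ := ih h hcov (sup_le hb h.le)
      refine ⟨m' + 1, ⟨a' ⊔ v, ?_, hm'⟩, by omega⟩
      refine lt_of_le_of_ne le_sup_left fun he => ?_
      have : v ≤ a' := he ▸ le_sup_right
      rcases ha.eq_or_eq hv.le this with h1 | h1
      · exact hv.ne' h1
      · exact hle h1.ge

/-- The Jordan–Dedekind property: walking up the saturated chain, each cover shortens the other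
chain by at most one. -/
lemma HasChain.le_of_hasSatChain {L : Type u} [Lattice L] [IsUpperModularLattice L] {n m : ℕ}
    {a b : L} (hs : HasSatChain n a b) (h : HasChain m a b) : m ≤ n := by
  induction n generalizing a m with
  | zero =>
    obtain rfl : a = b := hs
    cases m with
    | zero => exact le_rfl
    | succ m => obtain ⟨c, hc, h⟩ := h; exact absurd h.le hc.not_ge
  | succ n ih =>
    obtain ⟨c, hc, hs⟩ := hs
    obtain ⟨m', hm', hle⟩ := h.of_covBy hc hs.hasChain.le
    have := ih hs hm'
    omega

/-- Strict monotonicity bounds the height above by `f`, and descent in unit steps bounds it below.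
This serves both for `L` and for the iterated blowup. -/
lemma height_eq_of_strictMono_of_exists {α : Type u} [PartialOrder α] (f : α → ℕ)
    (hf : StrictMono f) (h : ∀ a, f a ≠ 0 → ∃ b, b < a ∧ f b + 1 = f a) (a : α) :
    Order.height a = f a := by
  generalize hn : f a = n
  induction n using Nat.strong_induction_on generalizing a with
  | _ n ih =>
    subst hn
    refine le_antisymm (Order.height_le_coe_iff.2 fun y hy => ?_) ?_
    · rw [ih _ (hf hy) y rfl]
      exact_mod_cast hf hy
    · by_cases h0 : f a = 0
      · simp [h0]
      · obtain ⟨b, hb, hfb⟩ := h a h0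
        have := Order.height_add_one_le hb
        rw [ih _ (hf hb) b rfl] at this
        rw [← hfb]
        exact_mod_cast this

lemma latticeRank_bot {L : Type u} [Lattice L] [BoundedOrder L] :
    latticeRank (⊥ : L) = 0 := by simp [latticeRank]

variable {L : Type u} [Lattice L] [BoundedOrder L] [Finite L] [IsUpperModularLattice L]

lemma height_eq_latticeRank_and_covBy :
    (∀ x : L, Order.height x = latticeRank x) ∧
      ∀ x y : L, x ⋖ y → latticeRank y = latticeRank x + 1 := by
  choose f hf using fun x : L => exists_hasSatChain (bot_le : ⊥ ≤ x)
  have huniq : ∀ (x : L) n, HasSatChain n ⊥ x → n = f x := fun x n hn =>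
    le_antisymm (hn.hasChain.le_of_hasSatChain (hf x)) ((hf x).hasChain.le_of_hasSatChain hn)
  have hcov : ∀ x y : L, x ⋖ y → f y = f x + 1 := fun x y hxy =>
    (huniq _ _ ((hf x).append (n := 1) ⟨y, hxy, rfl⟩)).symm
  have hmono : StrictMono f := by
    intro x y hxy
    obtain ⟨c, hc, hcy⟩ := exists_covBy_le_of_lt hxy
    obtain ⟨n, hn⟩ := exists_hasSatChain hcy
    have := huniq _ _ ((hf x).append (n := n + 1) ⟨c, hc, hn⟩)
    omega
  have hh : ∀ x : L, Order.height x = f x := by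
    refine height_eq_of_strictMono_of_exists f hmono fun a ha => ?_
    have hne : a ≠ ⊥ := by
      rintro rfl
      exact ha (huniq ⊥ 0 rfl).symm
    obtain ⟨b, -, hb⟩ := exists_le_covBy_of_lt (bot_lt_iff_ne_bot.2 hne)
    exact ⟨b, hb.lt, (hcov _ _ hb).symm⟩
  have hr : ∀ x : L, latticeRank x = f x := fun x => by simp [latticeRank, hh]
  exact ⟨fun x => by rw [hr, hh], fun x y hxy => by rw [hr, hr, hcov _ _ hxy]⟩

lemma height_eq_latticeRank (x : L) : Order.height x = latticeRank x :=
  height_eq_latticeRank_and_covBy.1 x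

lemma latticeRank_covBy {x y : L} (h : x ⋖ y) : latticeRank y = latticeRank x + 1 :=
  height_eq_latticeRank_and_covBy.2 x y h

lemma latticeRank_strictMono : StrictMono (latticeRank : L → ℕ) := by
  intro x y hxy
  have := Order.height_add_one_le hxy
  rw [height_eq_latticeRank, height_eq_latticeRank] at this
  exact_mod_cast this

lemma latticeRank_mono {x y : L} (h : x ≤ y) : latticeRank x ≤ latticeRank y :=
  latticeRank_strictMono.monotone h

lemma eq_of_le_of_latticeRank_le {x y : L} (h : x ≤ y) (hr : latticeRank y ≤ latticeRank x) :
    x = y := by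
  by_contra hne
  exact (latticeRank_strictMono (lt_of_le_of_ne h hne)).not_ge hr

lemma latticeRank_atom {a : L} (h : IsAtom a) : latticeRank a = 1 := by
  rw [latticeRank_covBy h.bot_covBy, latticeRank_bot]

/-- Joining with `b` cannot widen the gap from `u` to `v`, since each cover becomes a cover or an
equality. With `u = a ⊓ b` and `v = a` this is submodularity of the rank. -/
lemma latticeRank_sup_add_le {u v : L} (h : u ≤ v) (b : L) :
    latticeRank (v ⊔ b) + latticeRank u ≤ latticeRank (u ⊔ b) + latticeRank v := by
  induction v using WellFoundedLT.induction with
  | ind v ih =>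
    rcases h.eq_or_lt with rfl | hlt
    · exact le_rfl
    · obtain ⟨w, huw, hw⟩ := exists_le_covBy_of_lt hlt
      have h1 := ih w hw.lt huw
      have h2 := latticeRank_covBy hw
      have h3 : latticeRank (v ⊔ b) ≤ latticeRank (w ⊔ b) + 1 := by
        by_cases hle : v ≤ w ⊔ b
        · exact (latticeRank_mono (sup_le hle le_sup_right)).trans (Nat.le_succ _)
        · have hinf : v ⊓ (w ⊔ b) = w := by
            rcases hw.eq_or_eq (le_inf hw.le le_sup_left) inf_le_left with h1 | h1
            · exact h1
            · exact absurd (inf_eq_left.1 h1) hle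
          have hc : w ⊔ b ⋖ v ⊔ (w ⊔ b) := covBy_sup_of_inf_covBy_left (hinf.symm ▸ hw)
          rw [← sup_assoc, sup_eq_left.2 hw.le] at hc
          exact (latticeRank_covBy hc).le
      omega

lemma latticeRank_sup_add_inf_le (a b : L) :
    latticeRank (a ⊔ b) + latticeRank (a ⊓ b) ≤ latticeRank a + latticeRank b := by
  have := latticeRank_sup_add_le (inf_le_left : a ⊓ b ≤ a) b
  rw [sup_eq_right.2 (inf_le_right : a ⊓ b ≤ b)] at this
  omega

lemma latticeRank_sup_atom_le (x : L) {a : L} (ha : IsAtom a) :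
    latticeRank (x ⊔ a) ≤ latticeRank x + 1 := by
  have := latticeRank_sup_add_inf_le x a
  rw [latticeRank_atom ha] at this
  omega

lemma latticeRank_sup_atom {x a : L} (ha : IsAtom a) (h : ¬ a ≤ x) :
    latticeRank (x ⊔ a) = latticeRank x + 1 :=
  le_antisymm (latticeRank_sup_atom_le x ha)
    (latticeRank_strictMono (lt_of_le_of_ne le_sup_left fun he => h (he ▸ le_sup_right)))

lemma latticeRank_sup_finset_le (x : L) {B : Finset L} (hB : ∀ b ∈ B, IsAtom b) :
    latticeRank (x ⊔ B.sup id) ≤ latticeRank x + B.card := by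
  classical
  induction B using Finset.induction_on with
  | empty => simp
  | insert b B hb ih =>
    rw [Finset.sup_insert, Finset.card_insert_of_notMem hb, id, sup_comm b, ← sup_assoc]
    have h1 := latticeRank_sup_atom_le (x ⊔ B.sup id) (hB b (Finset.mem_insert_self _ _))
    have h2 := ih fun c hc => hB c (Finset.mem_insert_of_mem hc)
    omega

/-- A set of atoms that is independent over `x` stays so after shrinking both. -/
lemma latticeRank_sup_of_subset {x u : L} (hu : u ≤ x) {B C : Finset L}
    (hB : ∀ b ∈ B, IsAtom b) (hCB : C ⊆ B)
    (h : latticeRank (x ⊔ B.sup id) = latticeRank x + B.card) :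
    latticeRank (u ⊔ C.sup id) = latticeRank u + C.card := by
  classical
  refine le_antisymm (latticeRank_sup_finset_le u fun c hc => hB c (hCB hc)) ?_
  have h1 := latticeRank_sup_finset_le (x ⊔ C.sup id) (B := B \ C)
    fun b hb => hB b (Finset.mem_sdiff.1 hb).1
  rw [sup_assoc, ← Finset.sup_union, Finset.union_sdiff_of_subset hCB, h,
    Finset.card_sdiff_of_subset hCB] at h1
  have h2 := latticeRank_sup_add_le hu (C.sup id)
  have h3 := Finset.card_le_card hCB
  omega

/-- Every spanning set of atoms contains a basis. -/
lemma exists_basis_subset {x p : L} (hxp : x ≤ p) {B : Finset L} (hB : ∀ b ∈ B, IsAtom b)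
    (h : x ⊔ B.sup id = p) :
    ∃ C ⊆ B, x ⊔ C.sup id = p ∧ latticeRank p = latticeRank x + C.card := by
  classical
  induction B using Finset.induction_on generalizing p with
  | empty => exact ⟨∅, le_rfl, h, by simp at h; simp [h]⟩
  | insert b B hb ih =>
    obtain ⟨C, hC, hCs, hCr⟩ := ih (p := x ⊔ B.sup id) le_sup_left
      (fun c hc => hB c (Finset.mem_insert_of_mem hc)) rfl
    rw [Finset.sup_insert, id, sup_comm b, ← sup_assoc] at h
    by_cases hle : b ≤ x ⊔ B.sup id
    · rw [sup_eq_left.2 hle] at h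
      exact ⟨C, hC.trans (Finset.subset_insert _ _), hCs.trans h, h ▸ hCr⟩
    · refine ⟨insert b C, Finset.insert_subset_insert _ hC, ?_, ?_⟩
      · rw [Finset.sup_insert, id, sup_comm b, ← sup_assoc, hCs, h]
      · rw [Finset.card_insert_of_notMem fun hc => hb (hC hc), ← h,
          latticeRank_sup_atom (hB b (Finset.mem_insert_self _ _)) hle, hCr]
        rfl

open scoped Classical in
/-- A function on bases that is invariant under exchanging one element is constant. -/
lemma eq_of_exchange {β : Type*} {x p : L} (f : Finset L → β)
    (hf : ∀ (C : Finset L) (a b : L), a ∉ C → b ∉ C → (∀ c ∈ C, IsAtom c) → IsAtom a → IsAtom b →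
      x ⊔ C.sup id ⊔ a = p → x ⊔ C.sup id ⊔ b = p →
      f (insert a C) = f (insert b C))
    {A B : Finset L} (hA : ∀ a ∈ A, IsAtom a) (hB : ∀ b ∈ B, IsAtom b)
    (hAp : x ⊔ A.sup id = p) (hBp : x ⊔ B.sup id = p)
    (hAr : latticeRank p = latticeRank x + A.card) (hBr : latticeRank p = latticeRank x + B.card) :
    f A = f B := by
  generalize hn : (A \ B).card = n
  induction n generalizing B with
  | zero =>
    have : A ⊆ B := Finset.sdiff_eq_empty_iff_subset.1 (Finset.card_eq_zero.1 hn)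
    rw [Finset.eq_of_subset_of_card_le this (by omega)]
  | succ n ih =>
    have hc : (B \ A).card = n + 1 := by
      have h1 := Finset.card_sdiff_add_card_inter A B
      have h2 := Finset.card_sdiff_add_card_inter B A
      rw [Finset.inter_comm] at h2
      omega
    obtain ⟨b, hb⟩ : (B \ A).Nonempty := Finset.card_pos.1 (by omega)
    obtain ⟨hbB, hbA⟩ := Finset.mem_sdiff.1 hb
    have hCr := latticeRank_sup_finset_le x (B := B.erase b) fun c hc =>
      hB c (Finset.mem_of_mem_erase hc)
    rw [Finset.card_erase_of_mem hbB] at hCr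
    have hpos : 0 < B.card := Finset.card_pos.2 ⟨b, hbB⟩
    -- `A` spans `p`, while `x ⊔ (B.erase b).sup id` has too small a rank, so some `a ∈ A` is not
    -- below it. Exchanging `b` for `a` brings `B` one element closer to `A`.
    obtain ⟨a, haA, ha⟩ : ∃ a ∈ A, ¬ a ≤ x ⊔ (B.erase b).sup id := by
      by_contra! hcon
      have : p ≤ x ⊔ (B.erase b).sup id :=
        hAp ▸ sup_le le_sup_left (Finset.sup_le hcon)
      have := latticeRank_mono this
      omega
    have haC : a ∉ B.erase b := fun h =>
      ha ((Finset.le_sup (f := id) h).trans le_sup_right)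
    have hsub : x ⊔ (B.erase b).sup id ≤ p :=
      hBp ▸ sup_le_sup_left (Finset.sup_mono (Finset.erase_subset _ _)) _
    have hab : a ≠ b := fun h => hbA (h ▸ haA)
    have hbp : x ⊔ (B.erase b).sup id ⊔ b = p := by
      rw [← hBp]
      conv_rhs => rw [← Finset.insert_erase hbB, Finset.sup_insert, id, sup_comm b, ← sup_assoc]
    have hap : x ⊔ (B.erase b).sup id ⊔ a = p := by
      refine eq_of_le_of_latticeRank_le
        (sup_le hsub (hAp ▸ (Finset.le_sup (f := id) haA).trans le_sup_right)) ?_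
      have h2 := latticeRank_sup_atom_le (x ⊔ (B.erase b).sup id) (hB b hbB)
      rw [hbp] at h2
      rw [latticeRank_sup_atom (hA a haA) ha]
      exact h2
    have key := hf (B.erase b) a b haC (Finset.notMem_erase b B)
      (fun c hc => hB c (Finset.mem_of_mem_erase hc)) (hA a haA) (hB b hbB) hap hbp
    rw [Finset.insert_erase hbB] at key
    rw [← key]
    refine ih ?_ ?_ ?_ ?_
    · intro c hc
      rcases Finset.mem_insert.1 hc with rfl | hc
      · exact hA _ haA
      · exact hB c (Finset.mem_of_mem_erase hc)
    · rw [Finset.sup_insert, id, sup_comm a, ← sup_assoc, hap]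
    · rw [Finset.card_insert_of_notMem haC, Finset.card_erase_of_mem hbB]
      omega
    · have : A \ insert a (B.erase b) = (A \ B).erase a := by
        ext c
        simp only [Finset.mem_sdiff, Finset.mem_insert, Finset.mem_erase]
        constructor
        · rintro ⟨h1, h2⟩
          refine ⟨fun h => h2 (Or.inl h), h1, fun h3 => h2 (Or.inr ⟨?_, h3⟩)⟩
          rintro rfl
          exact hbA h1
        · rintro ⟨h1, h2, h3⟩
          exact ⟨h2, fun h => h.elim h1 fun h => h3 h.2⟩
      rw [this, Finset.card_erase_of_mem, hn]
      · rfl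
      · refine Finset.mem_sdiff.2 ⟨haA, fun h => haC (Finset.mem_erase.2 ⟨hab, h⟩)⟩

end Rank

/-! ## Functionals and their annihilators -/

section Functional

open Polynomial

/-- The largest ideal contained in the kernel of `φ`. -/
def annIdeal {R : Type*} [CommRing R] [Algebra ℚ R] (φ : R →ₗ[ℚ] ℚ) : Ideal R where
  carrier := {f | ∀ g, φ (f * g) = 0}
  zero_mem' g := by simp
  add_mem' {a b} ha hb g := by rw [add_mul, map_add, ha g, hb g, add_zero]
  smul_mem' c f hf g := by rw [smul_eq_mul, mul_comm c f, mul_assoc]; exact hf _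

lemma mem_annIdeal {R : Type*} [CommRing R] [Algebra ℚ R] {φ : R →ₗ[ℚ] ℚ} {f : R} :
    f ∈ annIdeal φ ↔ ∀ g, φ (f * g) = 0 := Iff.rfl

lemma apply_eq_zero_of_mem_annIdeal {R : Type*} [CommRing R] [Algebra ℚ R] {φ : R →ₗ[ℚ] ℚ}
    {f : R} (h : f ∈ annIdeal φ) : φ f = 0 := by simpa using h 1

/-- `θ` and `η` induce inverse isomorphisms between `R / I` and `R' / annIdeal φ`, so the pullback
of `φ` along `θ` is nondegenerate on `R / I`. Presentations of an algebra are compared through this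
lemma. -/
lemma annIdeal_comp {R R' : Type*} [CommRing R] [Algebra ℚ R] [CommRing R'] [Algebra ℚ R']
    (θ : R →ₐ[ℚ] R') (η : R' →+* R) (φ : R' →ₗ[ℚ] ℚ) (I : Ideal R)
    (hθ : I ≤ (annIdeal φ).comap θ) (hη : annIdeal φ ≤ I.comap η)
    (h : ∀ f, η (θ f) - f ∈ I) (h' : ∀ g, θ (η g) - g ∈ annIdeal φ) :
    annIdeal (φ.comp θ.toLinearMap) = I := by
  refine le_antisymm (fun f hf => ?_) fun f hf g => ?_
  · have h1 : θ f ∈ annIdeal φ := fun g => by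
      have h2 := hf (η g)
      have h3 := h' g (θ f)
      simp only [LinearMap.comp_apply, AlgHom.toLinearMap_apply, map_mul] at h2
      rw [sub_mul, map_sub, mul_comm _ (θ f), h2, zero_sub, neg_eq_zero] at h3
      rwa [mul_comm]
    have h2 : η (θ f) ∈ I := hη h1
    have := I.sub_mem h2 (h f)
    rwa [sub_sub_cancel] at this
  · have h1 : θ f ∈ annIdeal φ := hθ hf
    simpa using h1 (θ g)

variable {A : Type*} [CommRing A]

/-- The coefficient of degree `deg P - 1` of the remainder modulo `P`. -/
noncomputable def topCoeff (P : A[X]) : A[X] →ₗ[A] A :=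
  (lcoeff A (P.natDegree - 1)).comp (modByMonicHom P)

lemma topCoeff_apply (P F : A[X]) : topCoeff P F = (F %ₘ P).coeff (P.natDegree - 1) := rfl

variable {P : A[X]} (hP : P.Monic)
include hP

lemma topCoeff_of_natDegree_lt {F : A[X]} (h : F.natDegree < P.natDegree) :
    topCoeff P F = F.coeff (P.natDegree - 1) := by
  nontriviality A
  rw [topCoeff_apply, (modByMonic_eq_self_iff hP).2 (degree_lt_degree h)]

lemma topCoeff_mul_self (F : A[X]) : topCoeff P (P * F) = 0 := by
  have : (P * F) %ₘ P = 0 := (modByMonic_eq_zero_iff_dvd hP).2 (dvd_mul_right _ _)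
  rw [topCoeff_apply, this, coeff_zero]

lemma topCoeff_modByMonic (F G : A[X]) : topCoeff P ((F %ₘ P) * G) = topCoeff P (F * G) := by
  conv_rhs => rw [← modByMonic_add_div F P, add_mul, map_add, mul_assoc,
    topCoeff_mul_self hP, add_zero]

omit hP in
lemma topCoeff_mem {J : Ideal A} {F : A[X]} (h : F ∈ J.map C) : topCoeff P F ∈ J := by
  rw [Ideal.mem_map_C_iff] at h
  rw [F.as_sum_range_C_mul_X_pow, map_sum]
  refine Ideal.sum_mem _ fun i _ => ?_
  rw [← smul_eq_C_mul, map_smul]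
  exact J.mul_mem_right _ (h i)

/-- Multiplication by `X ^ (deg P - 1 - i)` moves the coefficient `i` to the top position. Lower
coefficients do not reach it; higher ones wrap around modulo `P`, but lie in `J` by descending
induction. -/
lemma coeff_mem_of_topCoeff_mem {J : Ideal A} {F : A[X]} (hF : F.natDegree < P.natDegree)
    (h : ∀ k, topCoeff P (F * X ^ k) ∈ J) (i : ℕ) : F.coeff i ∈ J := by
  by_cases hi : P.natDegree ≤ i
  · rw [coeff_eq_zero_of_natDegree_lt (hF.trans_le hi)]
    exact J.zero_mem
  generalize hm : P.natDegree - i = m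
  induction m using Nat.strong_induction_on generalizing i with
  | _ m ih =>
    have h1 : ∀ j, i < j → F.coeff j ∈ J := fun j hj => by
      by_cases hj' : P.natDegree ≤ j
      · rw [coeff_eq_zero_of_natDegree_lt (hF.trans_le hj')]
        exact J.zero_mem
      · exact ih (P.natDegree - j) (by omega) j hj' rfl
    have h2 := h (P.natDegree - 1 - i)
    rw [F.as_sum_range_C_mul_X_pow' hF, Finset.sum_mul, map_sum] at h2
    have h3 : ∀ j ∈ Finset.range P.natDegree, j ≠ i →
        topCoeff P (C (F.coeff j) * X ^ j * X ^ (P.natDegree - 1 - i)) ∈ J := by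
      intro j hj hji
      rw [mul_assoc, ← pow_add, ← smul_eq_C_mul, map_smul]
      rcases lt_or_gt_of_ne hji with hlt | hgt
      · rw [topCoeff_of_natDegree_lt hP, coeff_X_pow, if_neg (by omega), smul_zero]
        · exact J.zero_mem
        · exact (natDegree_X_pow_le _).trans_lt (by omega)
      · exact J.mul_mem_right _ (h1 j hgt)
    have h4 : topCoeff P (C (F.coeff i) * X ^ i * X ^ (P.natDegree - 1 - i)) = F.coeff i := by
      rw [mul_assoc, ← pow_add, ← smul_eq_C_mul, map_smul, topCoeff_of_natDegree_lt hP,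
        coeff_X_pow, if_pos (by omega), smul_eq_mul, mul_one]
      exact (natDegree_X_pow_le _).trans_lt (by omega)
    rw [← Finset.add_sum_erase _ _ (Finset.mem_range.2 (not_le.1 hi)), h4] at h2
    refine (Ideal.add_mem_iff_left _ (Ideal.sum_mem _ fun j hj => ?_)).1 h2
    exact h3 j (Finset.mem_of_mem_erase hj) (Finset.ne_of_mem_erase hj)

variable [Algebra ℚ A] (φ ψ : A →ₗ[ℚ] ℚ)

omit hP in
/-- The functional on `A[t]` that factors through `(A / Ann ψ)[t] / P` and pairs
`t ^ (deg P - 1)` with `ψ`. -/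
noncomputable def bundleFunctional (P : A[X]) (ψ : A →ₗ[ℚ] ℚ) : A[X] →ₗ[ℚ] ℚ :=
  ψ.comp ((topCoeff P).restrictScalars ℚ)

omit hP in
lemma bundleFunctional_apply (F : A[X]) : bundleFunctional P ψ F = ψ (topCoeff P F) := rfl

omit hP in
lemma topCoeff_mem_of_mem_annIdeal {F : A[X]} (h : F ∈ annIdeal (bundleFunctional P ψ)) (G : A[X]) :
    topCoeff P (F * G) ∈ annIdeal ψ := fun b => by
  have := h (b • G)
  rwa [mul_smul_comm, bundleFunctional_apply, map_smul, smul_eq_mul, mul_comm] at this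

/-- Modulo `P` only the remainder matters, and in the basis `1, X, …, X ^ (deg P - 1)` the pairing
by `topCoeff P` is antitriangular with ones on the antidiagonal. Hence a remainder is annihilated
exactly when all its coefficients lie in `annIdeal ψ`. -/
lemma annIdeal_bundleFunctional :
    annIdeal (bundleFunctional P ψ) = (annIdeal ψ).map C ⊔ Ideal.span {P} := by
  refine le_antisymm (fun F hF => ?_) (sup_le (fun F hF G => ?_) ?_)
  · by_cases hP1 : P = 1
    · rw [hP1, Ideal.span_singleton_one, sup_top_eq]; trivial
    rw [← modByMonic_add_div F P]
    refine Ideal.add_mem _ (Ideal.mem_sup_left (Ideal.mem_map_C_iff.2 ?_))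
      (Ideal.mem_sup_right (Ideal.mul_mem_right _ _ (Ideal.mem_span_singleton_self P)))
    refine coeff_mem_of_topCoeff_mem hP (natDegree_modByMonic_lt _ hP hP1) fun k => ?_
    rw [topCoeff_modByMonic hP]
    exact topCoeff_mem_of_mem_annIdeal ψ hF _
  · rw [bundleFunctional_apply]
    exact apply_eq_zero_of_mem_annIdeal (topCoeff_mem (Ideal.mul_mem_right _ _ hF))
  · rw [Ideal.span_singleton_le_iff_mem]
    intro G
    rw [bundleFunctional_apply, topCoeff_mul_self hP, map_zero]

omit hP in
/-- The functional on `A[t]` that extends `φ` and is given by `ψ` on multiples of `t`. -/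
noncomputable def blowupFunctional (P : A[X]) (φ ψ : A →ₗ[ℚ] ℚ) : A[X] →ₗ[ℚ] ℚ where
  toFun F := φ (F.coeff 0) - bundleFunctional P ψ F.divX
  map_add' F G := by simp only [coeff_add, divX_add, map_add]; ring
  map_smul' c F := by
    have : (c • F).divX = c • F.divX := by ext; simp [coeff_divX]
    simp only [coeff_smul, this, map_smul, smul_eq_mul, RingHom.id_apply]; ring

omit hP in
lemma blowupFunctional_apply (F : A[X]) :
    blowupFunctional P φ ψ F = φ (F.coeff 0) - ψ (topCoeff P F.divX) := rfl

omit hP in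
lemma blowupFunctional_X_mul (F : A[X]) :
    blowupFunctional P φ ψ (X * F) = - bundleFunctional P ψ F := by
  rw [blowupFunctional_apply, mul_coeff_zero, coeff_X_zero, zero_mul, map_zero, zero_sub,
    bundleFunctional_apply]
  congr 3
  ext n
  rw [coeff_divX, coeff_X_mul]

lemma blowupFunctional_of_natDegree_lt {F : A[X]} (h : F.natDegree < P.natDegree) :
    blowupFunctional P φ ψ F = φ (F.coeff 0) := by
  rw [blowupFunctional_apply, topCoeff_of_natDegree_lt hP, coeff_divX,
    coeff_eq_zero_of_natDegree_lt (p := F) (n := P.natDegree - 1 + 1) (by omega), map_zero, sub_zero]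
  · rw [natDegree_divX_eq_natDegree_tsub_one]; omega

/-- Modulo `P`, `(P * F).divX` is `F.coeff 0 • P.divX`, and `P.divX` is monic of degree `deg P - 1`,
so its top coefficient is `1`. The two terms of the functional then cancel exactly because of `hψ`.
-/
lemma blowupFunctional_self_mul (hP0 : 0 < P.natDegree) (hψ : ∀ a, ψ a = φ (P.coeff 0 * a))
    (F : A[X]) : blowupFunctional P φ ψ (P * F) = 0 := by
  have key : (P * F).divX = P * F.divX + F.coeff 0 • P.divX := by
    have h1 : X * (P * F).divX + C ((P * F).coeff 0) =
        X * (P * F.divX + F.coeff 0 • P.divX) + C ((P * F).coeff 0) := by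
      have hp := X_mul_divX_add P
      have hf := X_mul_divX_add F
      rw [X_mul_divX_add, mul_coeff_zero, C_mul, smul_eq_C_mul]
      conv_lhs => rw [← hf, mul_add]
      rw [mul_add, add_assoc]
      congr 1
      · ring
      · conv_lhs => rw [← hp]
        ring
    ext n
    have := congrArg (fun q => coeff q (n + 1)) h1
    simpa [coeff_C_succ] using this
  rw [blowupFunctional_apply, key, map_add, map_smul, topCoeff_mul_self hP, zero_add,
    topCoeff_of_natDegree_lt hP, coeff_divX, Nat.sub_add_cancel hP0, hP.coeff_natDegree, hψ,
    mul_coeff_zero, smul_eq_mul, mul_one, sub_self]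
  rw [natDegree_divX_eq_natDegree_tsub_one]; omega

/-- Let `R` be a remainder modulo `P` in the annihilator. Testing against constants puts `R.coeff 0`
in `annIdeal φ`; testing against multiples of `X` reduces to the bundle functional and puts every
coefficient in `annIdeal ψ`. Now split `R` into its constant term and a multiple of `X`. -/
lemma annIdeal_blowupFunctional (hP0 : 0 < P.natDegree) (hψ : ∀ a, ψ a = φ (P.coeff 0 * a)) :
    annIdeal (blowupFunctional P φ ψ) =
      (annIdeal φ).map C ⊔ Ideal.span {X} * (annIdeal ψ).map C ⊔ Ideal.span {P} := by
  have hle : annIdeal φ ≤ annIdeal ψ := fun f hf g => by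
    rw [hψ, ← mul_assoc, mul_comm _ f, mul_assoc]; exact hf _
  have hPmem : P ∈ annIdeal (blowupFunctional P φ ψ) := fun G =>
    blowupFunctional_self_mul hP φ ψ hP0 hψ G
  have hX : ∀ F ∈ (annIdeal ψ).map C, X * F ∈ annIdeal (blowupFunctional P φ ψ) := by
    intro F hF G
    rw [mul_assoc, blowupFunctional_X_mul, bundleFunctional_apply,
      apply_eq_zero_of_mem_annIdeal (topCoeff_mem (Ideal.mul_mem_right _ _ hF)), neg_zero]
  refine le_antisymm (fun F hF => ?_) (sup_le (sup_le (fun F hF G => ?_) ?_) ?_)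
  · have hP1 : P ≠ 1 := by rintro rfl; simp at hP0
    have hR : F %ₘ P ∈ annIdeal (blowupFunctional P φ ψ) := by
      rw [modByMonic_eq_sub_mul_div]
      exact Ideal.sub_mem _ hF (Ideal.mul_mem_right _ _ hPmem)
    have hdeg := natDegree_modByMonic_lt F hP hP1
    rw [← modByMonic_add_div F P]
    refine Ideal.add_mem _ (Ideal.mem_sup_left ?_)
      (Ideal.mem_sup_right (Ideal.mul_mem_right _ _ (Ideal.mem_span_singleton_self P)))
    generalize F %ₘ P = R at hR hdeg
    have h0 : R.coeff 0 ∈ annIdeal φ := fun b => by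
      have := hR (C b)
      rwa [blowupFunctional_of_natDegree_lt hP, coeff_mul_C] at this
      exact (natDegree_mul_C_le _ _).trans_lt hdeg
    have hJ : ∀ i, R.coeff i ∈ annIdeal ψ := by
      refine coeff_mem_of_topCoeff_mem hP hdeg fun k => ?_
      refine mul_one (R * X ^ k) ▸ topCoeff_mem_of_mem_annIdeal ψ (fun G => ?_) 1
      have := hR (X ^ (k + 1) * G)
      rw [show R * (X ^ (k + 1) * G) = X * (R * X ^ k * G) by ring,
        blowupFunctional_X_mul] at this
      exact neg_eq_zero.1 this
    rw [← X_mul_divX_add R]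
    refine Ideal.add_mem _ (Ideal.mem_sup_right (Ideal.mul_mem_mul
      (Ideal.mem_span_singleton_self _) (Ideal.mem_map_C_iff.2 fun i => ?_)))
      (Ideal.mem_sup_left (Ideal.mem_map_of_mem _ h0))
    rw [coeff_divX]
    exact hJ _
  · have h1 : F * G ∈ (annIdeal φ).map C := Ideal.mul_mem_right _ _ hF
    rw [Ideal.mem_map_C_iff] at h1
    rw [blowupFunctional_apply, apply_eq_zero_of_mem_annIdeal (h1 0),
      apply_eq_zero_of_mem_annIdeal (topCoeff_mem (J := annIdeal ψ) (Ideal.mem_map_C_iff.2 _)),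
      sub_zero]
    intro i
    rw [coeff_divX]
    exact hle (h1 _)
  · rw [Ideal.mul_le]
    rintro r hr s hs
    obtain ⟨a, rfl⟩ := Ideal.mem_span_singleton'.1 hr
    rw [mul_assoc]
    exact Ideal.mul_mem_left _ _ (hX s hs)
  · rwa [Ideal.span_singleton_le_iff_mem]

omit hP in
/-- The endomorphism of `A[t]` that acts by `σ` on `A` and sends `t` to `2 t`. -/
noncomputable def scaleHom (σ : A →+* A) : A[X] →+* A[X] :=
  (compRingHom (C 2 * X)).comp (mapRingHom σ)

omit [Algebra ℚ A] hP in
lemma coeff_scaleHom (σ : A →+* A) (F : A[X]) (i : ℕ) :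
    (scaleHom σ F).coeff i = σ (F.coeff i) * 2 ^ i := by
  simp [scaleHom, comp_C_mul_X_coeff]

omit [Algebra ℚ A] hP in
lemma scaleHom_X (σ : A →+* A) : scaleHom σ X = 2 * X := by
  simp [scaleHom, C_ofNat]

omit [Algebra ℚ A] hP in
lemma scaleHom_C (σ : A →+* A) (a : A) : scaleHom σ (C a) = C (σ a) := by
  simp [scaleHom]

omit [Algebra ℚ A] in
-- By `hσ`, scaling preserves the multiples of `P` and so commutes with taking remainders; the
-- coefficient of `X ^ (deg P - 1)` acquires the corresponding power of `2`.
lemma topCoeff_scaleHom (hP0 : 0 < P.natDegree) (σ : A →+* A)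
    (hσ : scaleHom σ P = 2 ^ P.natDegree * P) (F : A[X]) :
    topCoeff P (scaleHom σ F) = σ (topCoeff P F) * 2 ^ (P.natDegree - 1) := by
  have hP1 : P ≠ 1 := by rintro rfl; simp at hP0
  have hdeg := natDegree_modByMonic_lt F hP hP1
  conv_lhs => rw [← modByMonic_add_div F P]
  rw [map_add, map_mul, hσ, mul_comm (2 ^ _) P, mul_assoc, map_add, topCoeff_mul_self hP, add_zero,
    topCoeff_of_natDegree_lt hP, coeff_scaleHom, topCoeff_apply]
  refine lt_of_le_of_lt (natDegree_le_iff_coeff_eq_zero.2 fun i hi => ?_) hdeg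
  rw [coeff_scaleHom, coeff_eq_zero_of_natDegree_lt hi, map_zero, zero_mul]

omit hP in
lemma map_mul_two_pow (ψ : A →ₗ[ℚ] ℚ) (a : A) (n : ℕ) : ψ (a * 2 ^ n) = 2 ^ n * ψ a := by
  have : a * 2 ^ n = (2 ^ n : ℚ) • a := by
    rw [Algebra.smul_def, mul_comm, map_pow, map_ofNat]
  rw [this, map_smul, smul_eq_mul]

lemma bundleFunctional_scaleHom (hP0 : 0 < P.natDegree) (σ : A →+* A)
    (hσ : scaleHom σ P = 2 ^ P.natDegree * P) {n m : ℕ} (hψ : ∀ a, ψ (σ a) = 2 ^ n * ψ a)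
    (hm : m + 1 = n + P.natDegree) (F : A[X]) :
    bundleFunctional P ψ (scaleHom σ F) = 2 ^ m * bundleFunctional P ψ F := by
  rw [bundleFunctional_apply, bundleFunctional_apply, topCoeff_scaleHom hP hP0 σ hσ,
    map_mul_two_pow, hψ, ← mul_assoc, ← pow_add]
  congr 2
  omega

lemma blowupFunctional_scaleHom (hP0 : 0 < P.natDegree) (σ : A →+* A)
    (hσ : scaleHom σ P = 2 ^ P.natDegree * P) {n m : ℕ} (hψ : ∀ a, ψ (σ a) = 2 ^ n * ψ a)
    (hφ : ∀ a, φ (σ a) = 2 ^ m * φ a) (hm : m = n + P.natDegree) (F : A[X]) :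
    blowupFunctional P φ ψ (scaleHom σ F) = 2 ^ m * blowupFunctional P φ ψ F := by
  have h1 : (scaleHom σ F).divX = (2 : ℚ) • scaleHom σ F.divX := by
    ext i
    rw [coeff_divX, coeff_smul, coeff_scaleHom, coeff_scaleHom, coeff_divX, Algebra.smul_def,
      map_ofNat]
    ring
  rw [blowupFunctional_apply, ← bundleFunctional_apply, h1, map_smul,
    bundleFunctional_scaleHom hP ψ hP0 σ hσ hψ (m := m - 1) (by omega), blowupFunctional_apply,
    ← bundleFunctional_apply, coeff_scaleHom, pow_zero, mul_one, hφ, smul_eq_mul, ← mul_assoc,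
    ← pow_succ', mul_sub, Nat.sub_add_cancel (by omega)]

end Functional

/-! ## Homogeneous functionals on polynomial rings -/

section HomogeneousFunctional

open MvPolynomial

variable {ι : Type*}

/-- The endomorphism of a polynomial ring that doubles every variable. -/
noncomputable def doubleHom (ι : Type*) : MvPolynomial ι ℚ →ₐ[ℚ] MvPolynomial ι ℚ :=
  aeval fun i => 2 * X i

lemma doubleHom_X (i : ι) : doubleHom ι (X i) = 2 * X i := by simp [doubleHom]

lemma doubleHom_of_isHomogeneous {f : MvPolynomial ι ℚ} {d : ℕ} (hf : f.IsHomogeneous d) :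
    doubleHom ι f = (2 ^ d : ℚ) • f := by
  conv_lhs => rw [f.as_sum, map_sum]
  conv_rhs => rw [f.as_sum, Finset.smul_sum]
  refine Finset.sum_congr rfl fun m hm => ?_
  have hd : m.degree = d := by
    rw [Finsupp.degree_eq_weight_one]
    exact hf (mem_support_iff.1 hm)
  rw [doubleHom, aeval_monomial, smul_monomial, monomial_eq, smul_eq_mul, C_mul, ← hd]
  simp only [mul_pow, Finsupp.prod_mul, algebraMap_eq]
  have : (m.prod fun _ k => (2 : MvPolynomial ι ℚ) ^ k) = C (2 ^ m.degree) := by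
    rw [Finsupp.prod, Finset.prod_pow_eq_pow_sum, map_pow, map_ofNat]
    rfl
  rw [this]
  ring

/-- `φ` is homogeneous of degree `n`: it vanishes on polynomials that are homogeneous of another
degree. -/
def IsHomogeneousFunctional (φ : MvPolynomial ι ℚ →ₗ[ℚ] ℚ) (n : ℕ) : Prop :=
  ∀ f, φ (doubleHom ι f) = 2 ^ n * φ f

variable {φ ψ : MvPolynomial ι ℚ →ₗ[ℚ] ℚ} {n : ℕ}

/-- Distinct powers of `2` differ in `ℚ`, so the eigenvalue condition separates degrees. In this
form homogeneity passes through the substitutions below without decomposing polynomials. -/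
lemma IsHomogeneousFunctional.apply_eq_zero (h : IsHomogeneousFunctional φ n)
    {f : MvPolynomial ι ℚ} {d : ℕ} (hf : f.IsHomogeneous d) (hd : d ≠ n) : φ f = 0 := by
  have h1 := h f
  rw [doubleHom_of_isHomogeneous hf, map_smul, smul_eq_mul] at h1
  have h2 : ((2 : ℚ) ^ d - 2 ^ n) * φ f = 0 := by linarith
  rcases mul_eq_zero.1 h2 with h3 | h3
  · exact absurd (Nat.pow_right_injective le_rfl (by exact_mod_cast sub_eq_zero.1 h3)) hd
  · exact h3

lemma IsHomogeneousFunctional.apply_homogeneousComponent (h : IsHomogeneousFunctional φ n)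
    (f : MvPolynomial ι ℚ) : φ (homogeneousComponent n f) = φ f := by
  conv_rhs => rw [← sum_homogeneousComponent f, map_sum]
  by_cases hn : n ∈ Finset.range (f.totalDegree + 1)
  · rw [Finset.sum_eq_single_of_mem n hn]
    exact fun d _ hd => h.apply_eq_zero (homogeneousComponent_isHomogeneous d f) hd
  · rw [homogeneousComponent_eq_zero _ _ (by simpa using hn), map_zero, Finset.sum_eq_zero]
    intro d hd
    exact h.apply_eq_zero (homogeneousComponent_isHomogeneous d f) fun he => hn (he ▸ hd)

/-- In degree `n`, only the constant component of the other factor contributes to the pairing. -/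
lemma IsHomogeneousFunctional.mem_annIdeal (h : IsHomogeneousFunctional φ n)
    {f : MvPolynomial ι ℚ} (hf : f.IsHomogeneous n) (h0 : φ f = 0) : f ∈ annIdeal φ := by
  intro g
  rw [← sum_homogeneousComponent g, Finset.mul_sum, map_sum]
  refine Finset.sum_eq_zero fun d _ => ?_
  rcases Nat.eq_zero_or_pos d with rfl | hd
  · rw [homogeneousComponent_zero, mul_comm, ← smul_eq_C_mul, map_smul, h0, smul_zero]
  · exact h.apply_eq_zero (hf.mul (homogeneousComponent_isHomogeneous d g)) (by omega)

lemma IsHomogeneousFunctional.mem_annIdeal_of_lt (h : IsHomogeneousFunctional φ n)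
    {f : MvPolynomial ι ℚ} {d : ℕ} (hf : f.IsHomogeneous d) (hd : n < d) : f ∈ annIdeal φ := by
  intro g
  rw [← sum_homogeneousComponent g, Finset.mul_sum, map_sum]
  exact Finset.sum_eq_zero fun e _ =>
    h.apply_eq_zero (hf.mul (homogeneousComponent_isHomogeneous e g)) (by omega)

/-- Homogeneous functionals of the same degree with nested annihilators are proportional. -/
lemma IsHomogeneousFunctional.exists_smul (hφ : IsHomogeneousFunctional φ n)
    (hψ : IsHomogeneousFunctional ψ n) {m : MvPolynomial ι ℚ} (hm : φ m ≠ 0)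
    (hle : annIdeal φ ≤ annIdeal ψ) : ∃ k : ℚ, ψ = k • φ := by
  have key : ∀ g, φ g = 0 → ψ g = 0 := by
    intro g hg
    rw [← hψ.apply_homogeneousComponent]
    rw [← hφ.apply_homogeneousComponent] at hg
    exact apply_eq_zero_of_mem_annIdeal (hle (hφ.mem_annIdeal
      (homogeneousComponent_isHomogeneous n g) hg))
  refine ⟨ψ m / φ m, LinearMap.ext fun f => ?_⟩
  have := key (f - (φ f / φ m) • m) (by
    rw [map_sub, map_smul, smul_eq_mul, div_mul_cancel₀ _ hm, sub_self])
  rw [map_sub, map_smul, smul_eq_mul, sub_eq_zero] at this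
  rw [this, LinearMap.smul_apply, smul_eq_mul]
  ring

lemma annIdeal_smul {R : Type*} [CommRing R] [Algebra ℚ R] (φ : R →ₗ[ℚ] ℚ) {k : ℚ} (hk : k ≠ 0) :
    annIdeal (k • φ) = annIdeal φ := by
  ext f
  simp [mem_annIdeal, hk]

/-- Multiplying a functional by an element of degree `c`. -/
lemma IsHomogeneousFunctional.comp_mulLeft {c : ℕ} (h : IsHomogeneousFunctional φ (n + c))
    {a : MvPolynomial ι ℚ} (ha : a.IsHomogeneous c) :
    IsHomogeneousFunctional (φ.comp (LinearMap.mulLeft ℚ a)) n := by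
  intro f
  have h1 := h (a * f)
  rw [map_mul, doubleHom_of_isHomogeneous ha, smul_mul_assoc, map_smul, pow_add, smul_eq_mul] at h1
  have h2 : (2 : ℚ) ^ c ≠ 0 := by positivity
  simp only [LinearMap.comp_apply, LinearMap.mulLeft_apply]
  refine mul_left_cancel₀ h2 (h1.trans (by ring))

end HomogeneousFunctional

/-! ## Combinatorics of building sets -/

section Factors

variable {L : Type u} [Lattice L] [BoundedOrder L]

omit [BoundedOrder L] in
lemma mem_latticeFactors {G : Finset L} {w j : L} :
    j ∈ latticeFactors G w ↔ j ∈ G ∧ j ≤ w ∧ ∀ g ∈ G, g ≤ w → j ≤ g → g = j := by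
  simp [latticeFactors]

omit [BoundedOrder L] in
lemma exists_latticeFactors_ge {G : Finset L} {w g : L} (hg : g ∈ G) (hgw : g ≤ w) :
    ∃ j ∈ latticeFactors G w, g ≤ j := by
  classical
  obtain ⟨j, hgj, hj⟩ := Finset.exists_le_maximal (G.filter (· ≤ w)) (a := g) (by simp [hg, hgw])
  have hj' := hj.prop
  simp only [Finset.mem_filter] at hj'
  refine ⟨j, mem_latticeFactors.2 ⟨hj'.1, hj'.2, fun g' hg' hgw' hle => ?_⟩, hgj⟩
  exact (hj.eq_of_le (by simp [hg', hgw']) hle).symm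

variable {G : Finset L} (hG : IsBuildingSet G)
include hG

/-- In the product decomposition of `[⊥, w]`, meeting with the factor `j` is the projection to one
coordinate, and projections preserve joins. -/
lemma IsBuildingSet.sup_inf_factor {w j a b : L} (hj : j ∈ latticeFactors G w) (ha : a ≤ w)
    (hb : b ≤ w) : (a ⊔ b) ⊓ j = (a ⊓ j) ⊔ (b ⊓ j) := by
  classical
  have hw : w ≠ ⊥ := by
    rintro rfl
    have := mem_latticeFactors.1 hj
    exact hG.1 (le_bot_iff.1 this.2.1 ▸ this.1)
  obtain ⟨φ, hφ⟩ := hG.2 w hw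
  obtain ⟨va, hva⟩ := φ.surjective ⟨a, ha⟩
  obtain ⟨vb, hvb⟩ := φ.surjective ⟨b, hb⟩
  set e : ∀ i : latticeFactors G w, Set.Iic (i : L) :=
    Function.update (fun i => (⊥ : Set.Iic (i : L))) ⟨j, hj⟩ ⊤ with he
  have hej : ((φ e : Set.Iic w) : L) = j := by
    have := hφ ⟨j, hj⟩
    convert this using 3
  have hdist : (va ⊔ vb) ⊓ e = (va ⊓ e) ⊔ (vb ⊓ e) := by
    funext i
    by_cases hi : i = ⟨j, hj⟩
    · subst hi; simp [he]
    · simp [he, Function.update_of_ne hi]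
  have := congrArg (fun v => ((φ v : Set.Iic w) : L)) hdist
  simpa [map_inf, map_sup, hva, hvb, hej] using this

lemma IsBuildingSet.factor_inf_factor {w j k : L} (hj : j ∈ latticeFactors G w)
    (hk : k ∈ latticeFactors G w) (hjk : j ≠ k) : j ⊓ k = ⊥ := by
  classical
  have hw : w ≠ ⊥ := by
    rintro rfl
    have := mem_latticeFactors.1 hj
    exact hG.1 (le_bot_iff.1 this.2.1 ▸ this.1)
  obtain ⟨φ, hφ⟩ := hG.2 w hw
  have h1 := hφ ⟨j, hj⟩
  have h2 := hφ ⟨k, hk⟩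
  set ej := Function.update (fun i : latticeFactors G w => (⊥ : Set.Iic (i : L))) ⟨j, hj⟩ ⊤ with hej
  set ek := Function.update (fun i : latticeFactors G w => (⊥ : Set.Iic (i : L))) ⟨k, hk⟩ ⊤ with hek
  have hinf : ej ⊓ ek = ⊥ := by
    funext i
    by_cases hi : i = ⟨j, hj⟩
    · have : i ≠ ⟨k, hk⟩ := by rw [hi]; simpa using hjk
      simp [hek, Function.update_of_ne this]
    · simp [hej, Function.update_of_ne hi]
  have := congrArg (fun v => ((φ v : Set.Iic w) : L)) hinf
  simp only [map_inf, map_bot, Set.Iic.coe_inf, Set.Iic.coe_bot] at this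
  convert this using 2
  · convert h1.symm using 3
  · convert h2.symm using 3

/-- Distinct factors of `g ⊔ g'` meet in `⊥`, so the common lower bound `a` forces `g` and `g'` into
the same factor, which is then the whole join. -/
lemma IsBuildingSet.sup_mem {g g' a : L} (hg : g ∈ G) (hg' : g' ∈ G) (ha : a ≠ ⊥) (hag : a ≤ g)
    (hag' : a ≤ g') : g ⊔ g' ∈ G := by
  obtain ⟨j, hj, hgj⟩ := exists_latticeFactors_ge hg (le_sup_left : g ≤ g ⊔ g')
  obtain ⟨k, hk, hgk⟩ := exists_latticeFactors_ge hg' (le_sup_right : g' ≤ g ⊔ g')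
  by_cases hjk : j = k
  · subst hjk
    have := mem_latticeFactors.1 hj
    rw [le_antisymm (sup_le hgj hgk) this.2.1]
    exact this.1
  · have := hG.factor_inf_factor hj hk hjk
    exact absurd (le_bot_iff.1 (this ▸ le_inf (hag.trans hgj) (hag'.trans hgk))) ha

/-- If `p` is a factor of `p ⊔ x`, then all the other factors lie below `x`. -/
lemma IsBuildingSet.factor_le {p x j : L} (hp : p ∈ latticeFactors G (p ⊔ x))
    (hj : j ∈ latticeFactors G (p ⊔ x)) (hjp : j ≠ p) : j ≤ x := by
  have h := hG.sup_inf_factor hj (le_sup_left : p ≤ p ⊔ x) le_sup_right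
  rw [hG.factor_inf_factor hp hj hjp.symm, bot_sup_eq,
    inf_eq_right.2 (mem_latticeFactors.1 hj).2.1] at h
  exact h ▸ inf_le_left

end Factors

/-! ### Nested sets, nested pairs, and the effect of removing a minimal non-atom from `H` -/

section Nested

variable {L : Type u} [Lattice L] [BoundedOrder L]

/-- A form of nestedness without antichains: a join of elements of `U` that lies in `H` is one of
these elements. -/
def JoinNested (H : Finset L) (U : Set L) : Prop :=
  ∀ E : Finset L, ↑E ⊆ U → E.sup id ∈ H → E.sup id ∈ E

lemma JoinNested.mono {H : Finset L} {U V : Set L} (h : JoinNested H V) (hUV : U ⊆ V) :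
    JoinNested H U := fun E hE => h E (hE.trans hUV)

lemma JoinNested.anti {H K : Finset L} {U : Set L} (h : JoinNested H U) (hK : K ⊆ H) :
    JoinNested K U := fun E hE hEK => h E hE (hK hEK)

/-- The maximal elements of `E` form an antichain with the same join; conversely, an antichain that
contains its join is a singleton. Without antichains, elements of `E` can be freely replaced by
others with the same join. -/
lemma isNested_iff {H S : Finset L} (hH : ⊥ ∉ H) :
    IsNested H S ↔ S ⊆ H ∧ JoinNested H S := by
  classical
  refine ⟨fun h => ⟨h.1, fun E hE hEH => ?_⟩, fun h => ⟨h.1, fun A hA hanti hcard hmem => ?_⟩⟩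
  · by_contra hnot
    set A := E.filter fun e => ∀ f ∈ E, e ≤ f → f = e with hA
    have hsup : A.sup id = E.sup id := by
      refine le_antisymm (Finset.sup_mono (Finset.filter_subset _ _)) (Finset.sup_le fun e he => ?_)
      obtain ⟨m, hem, hm⟩ := Finset.exists_le_maximal E he
      refine hem.trans (Finset.le_sup (f := id) (Finset.mem_filter.2 ⟨hm.prop, fun f hf hmf => ?_⟩))
      exact (hm.eq_of_le hf hmf).symm
    have hanti : IsAntichain (· ≤ ·) (A : Set L) := by
      intro a ha b hb hab hle
      exact hab ((Finset.mem_filter.1 ha).2 b (Finset.mem_filter.1 hb).1 hle).symm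
    refine h.2 A (fun a ha => hE (Finset.mem_filter.1 ha).1) hanti ?_ (hsup ▸ hEH)
    by_contra hlt
    have : A.card = 0 ∨ A.card = 1 := by omega
    rcases this with h0 | h1
    · rw [Finset.card_eq_zero.1 h0, Finset.sup_empty] at hsup
      exact hH (hsup ▸ hEH)
    · obtain ⟨a, ha⟩ := Finset.card_eq_one.1 h1
      rw [ha, Finset.sup_singleton, id] at hsup
      exact hnot (hsup ▸ (Finset.mem_filter.1 (ha ▸ Finset.mem_singleton_self a : a ∈ A)).1)
  · have hj := h.2 A hA hmem
    have hsub : A ⊆ {A.sup id} := fun a ha => by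
      by_contra hne
      exact hanti ha hj (by simpa using hne) (Finset.le_sup (f := id) ha)
    have := Finset.card_le_card hsub
    simp at this
    omega

/-- The finite set of atoms below `x`. -/
noncomputable def atomsBelow [Finite L] (x : L) : Finset L :=
  (Set.toFinite {a | IsAtom a ∧ a ≤ x}).toFinset

lemma mem_atomsBelow [Finite L] {x a : L} : a ∈ atomsBelow x ↔ IsAtom a ∧ a ≤ x := by
  simp [atomsBelow]

lemma sup_atomsBelow [Finite L] [IsAtomistic L] (x : L) : (atomsBelow x).sup id = x := by
  refine le_antisymm (Finset.sup_le fun a ha => (mem_atomsBelow.1 ha).2) ?_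
  exact (isLUB_atoms_le x).2 fun a ha => Finset.le_sup (f := id) (mem_atomsBelow.2 ha)

/-- The support of the pair `(S, x)`: the elements of `S` and the atoms below `x`. -/
def pairSupp (S : Finset L) (x : L) : Set L := {u | u ∈ S ∨ IsAtom u ∧ u ≤ x}

/-- The pairs `(S, x)` that describe the elements of the blowup of `L` at the non-atoms of `H`. -/
structure IsNestedPair (H S : Finset L) (x : L) : Prop where
  subset : S ⊆ H
  not_isAtom : ∀ s ∈ S, ¬ IsAtom s
  not_le : ∀ h ∈ H, ¬ IsAtom h → ¬ h ≤ x
  nested : JoinNested H (pairSupp S x)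

lemma pairSupp_mono {S T : Finset L} {x y : L} (hS : S ⊆ T) (hx : x ≤ y) :
    pairSupp S x ⊆ pairSupp T y :=
  fun _ hu => hu.imp (fun h => hS h) fun h => ⟨h.1, h.2.trans hx⟩

lemma IsNestedPair.mono {H S T : Finset L} {x y : L} (h : IsNestedPair H T y) (hS : S ⊆ T)
    (hx : x ≤ y) : IsNestedPair H S x where
  subset := hS.trans h.subset
  not_isAtom s hs := h.not_isAtom s (hS hs)
  not_le g hg hga hgx := h.not_le g hg hga (hgx.trans hx)
  nested := h.nested.mono (pairSupp_mono hS hx)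

section Partial

variable {G H : Finset L} (hG : IsBuildingSet G) (hH : IsPartialBuildingSet G H)
include hG hH

lemma IsPartialBuildingSet.bot_notMem : ⊥ ∉ H := fun h => hG.1 (hH.subset h)

lemma IsPartialBuildingSet.ne_bot {h : L} (hh : h ∈ H) : h ≠ ⊥ := by
  rintro rfl
  exact hH.bot_notMem hG hh

/-- A join that lies in `H` and is not one of the joined elements is not an atom. -/
lemma IsPartialBuildingSet.not_isAtom_sup {E : Finset L} (hE : E ⊆ H) (hs : E.sup id ∈ H)
    (hn : E.sup id ∉ E) : ¬ IsAtom (E.sup id) := by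
  intro ha
  have hemp : E = ∅ := by
    by_contra hne
    obtain ⟨e, he⟩ := Finset.nonempty_iff_ne_empty.2 hne
    rcases ha.le_iff.1 (Finset.le_sup (f := id) he) with h | h
    · exact hH.ne_bot hG (hE he) h
    · exact hn (h ▸ he)
  rw [hemp, Finset.sup_empty] at hs
  exact hH.bot_notMem hG hs

lemma IsPartialBuildingSet.sup_mem {g h a : L} (hg : g ∈ G) (hh : h ∈ H) (hha : ¬ IsAtom h)
    (ha : IsAtom a) (hag : a ≤ g) (hah : a ≤ h) : g ⊔ h ∈ H :=
  (hH.filter h hh hha _ (hG.sup_mem hg (hH.subset hh) ha.1 hag hah) le_sup_right).1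

end Partial

section Erase

open scoped Classical

variable {G H : Finset L} (hG : IsBuildingSet G) (hH : IsPartialBuildingSet G H)
  {p : L} (hp : p ∈ H) (hpa : ¬ IsAtom p) (hmin : ∀ h ∈ H, ¬ IsAtom h → h ≤ p → h = p)

include hH hpa hmin in
lemma IsPartialBuildingSet.erase : IsPartialBuildingSet G (H.erase p) where
  subset := (Finset.erase_subset _ _).trans hH.subset
  atoms_mem a ha := Finset.mem_erase.2 ⟨by rintro rfl; exact hpa ha, hH.atoms_mem a ha⟩
  filter q hq hqa g hg hqg := by
    obtain ⟨hqp, hqH⟩ := Finset.mem_erase.1 hq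
    obtain ⟨h1, h2⟩ := hH.filter q hqH hqa g hg hqg
    refine ⟨Finset.mem_erase.2 ⟨?_, h1⟩, h2⟩
    rintro rfl
    exact hqp (hmin q hqH hqa hqg)

lemma mem_latticeFactors_of_erase {w : L} (hH : IsPartialBuildingSet G H)
    (hp : p ∈ H) (hpa : ¬ IsAtom p) (hpw : p ≤ w)
    (hw : ∀ h ∈ H.erase p, ¬ IsAtom h → ¬ h ≤ w) : p ∈ latticeFactors G w := by
  refine mem_latticeFactors.2 ⟨hH.subset hp, hpw, fun g hg hgw hpg => ?_⟩
  obtain ⟨h1, h2⟩ := hH.filter p hp hpa g hg hpg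
  by_contra hne
  exact hw g (Finset.mem_erase.2 ⟨hne, h1⟩) h2 hgw

include hG hH hp hmin in
/-- Replacing `p` by atoms below it preserves nestedness after erasing `p`. -/
lemma JoinNested.erase_of_atoms {V W : Set L} (hW : JoinNested H W) (hpW : p ∈ W)
    (hVH : V ⊆ H) (hV : ∀ v ∈ V, v ∈ W ∨ IsAtom v ∧ v ≤ p) : JoinNested (H.erase p) V := by
  intro E hE hEH
  by_contra hn
  obtain ⟨hjp, hjH⟩ := Finset.mem_erase.1 hEH
  have hja := hH.not_isAtom_sup hG (fun e he => hVH (hE he)) hjH hn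
  by_cases hex : ∃ a ∈ E, IsAtom a ∧ a ≤ p
  · obtain ⟨a, haE, ha, hap⟩ := hex
    -- All the atoms below `p` are traded for `p`. The join becomes `p ⊔ E.sup id`, which stays in
    -- `H` because `p` and the old join share the atom `a`.
    set E' := insert p (E.filter fun e => ¬ (IsAtom e ∧ e ≤ p)) with hE'
    have hsup : E'.sup id = p ⊔ E.sup id := by
      rw [hE', Finset.sup_insert]
      refine le_antisymm (sup_le_sup_left (Finset.sup_mono (Finset.filter_subset _ _)) _)
        (sup_le le_sup_left (Finset.sup_le fun e he => ?_))
      by_cases h : IsAtom e ∧ e ≤ p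
      · exact h.2.trans le_sup_left
      · exact (Finset.le_sup (f := id) (Finset.mem_filter.2 ⟨he, h⟩)).trans le_sup_right
    have hmem : E'.sup id ∈ H := by
      rw [hsup]
      exact hH.sup_mem hG (hH.subset hp) hjH hja ha hap (Finset.le_sup (f := id) haE)
    have hsub : (E' : Set L) ⊆ W := by
      intro e he
      rcases Finset.mem_insert.1 he with rfl | he
      · exact hpW
      · obtain ⟨h1, h2⟩ := Finset.mem_filter.1 he
        exact (hV e (hE h1)).resolve_right h2
    have hin := hW E' hsub hmem
    rw [hsup] at hin
    rcases Finset.mem_insert.1 hin with h | h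
    · exact hjp (hmin _ hjH hja (sup_eq_left.1 h))
    · have h1 := (Finset.mem_filter.1 h).1
      have h2 : E.sup id = p ⊔ E.sup id := le_antisymm le_sup_right (Finset.le_sup (f := id) h1)
      exact hn (h2 ▸ h1)
  · push Not at hex
    refine hn (hW E (fun e he => (hV e (hE he)).resolve_right fun h => ?_) hjH)
    exact hex e he h.1 h.2

include hG hH hpa hmin in
/-- A set that is not `H`-nested either has atoms that join to `p`, or stays not nested
after erasing `p` from `H` and replacing it by a set of atoms with join `p`. -/
lemma exists_atoms_or_not_joinNested_erase {V : Set L} (hVH : V ⊆ H) (hV : ¬ JoinNested H V) :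
    (∃ E : Finset L, ↑E ⊆ V ∧ (∀ e ∈ E, IsAtom e ∧ e ≤ p) ∧ E.sup id = p) ∨
      (p ∉ V → ¬ JoinNested (H.erase p) V) ∧
      ∀ E₀ : Finset L, (∀ e ∈ E₀, IsAtom e) → E₀.sup id = p →
        ¬ JoinNested (H.erase p) ((V \ {p}) ∪ E₀) := by
  unfold JoinNested at hV
  push Not at hV
  obtain ⟨E, hE, hEH, hn⟩ := hV
  by_cases hjp : E.sup id = p
  · refine Or.inl ⟨E, hE, fun e he => ?_, hjp⟩
    have hep : e ≤ p := hjp ▸ Finset.le_sup (f := id) he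
    refine ⟨?_, hep⟩
    by_contra hea
    have h1 := hmin e (hVH (hE he)) hea hep
    exact hn (hjp ▸ h1 ▸ he)
  · have hEH' : E.sup id ∈ H.erase p := Finset.mem_erase.2 ⟨hjp, hEH⟩
    refine Or.inr ⟨fun _ h => hn (h E hE hEH'), fun E₀ hE₀ hs h => ?_⟩
    by_cases hpE : p ∈ E
    · have hsup : (E.erase p ∪ E₀).sup id = E.sup id := by
        rw [Finset.sup_union, hs, sup_comm]
        conv_rhs => rw [← Finset.insert_erase hpE, Finset.sup_insert]
        rfl
      have := h (E.erase p ∪ E₀) ?_ (hsup.symm ▸ hEH')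
      · rw [hsup] at this
        rcases Finset.mem_union.1 this with h1 | h1
        · exact hn (Finset.mem_of_mem_erase h1)
        · exact hH.not_isAtom_sup hG (fun e he => hVH (hE he)) hEH hn (hE₀ _ h1)
      · intro e he
        rcases Finset.mem_union.1 he with h1 | h1
        · exact Or.inl ⟨hE (Finset.mem_of_mem_erase h1), Finset.ne_of_mem_erase h1⟩
        · exact Or.inr h1
    · refine hn (h E (fun e he => Or.inl ⟨hE he, ?_⟩) hEH')
      rintro rfl
      exact hpE he

include hG hH hp hpa hmin in
/-- In the presence of atoms joining to `p` together with `a ≤ h`, the element `h` must lie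
above `p`. -/
lemma not_joinNested_of_not_le {V : Set L} {Z : Finset L} {a h : L} (ha : IsAtom a)
    (hZV : ↑Z ⊆ V) (hZ : ∀ z ∈ Z, IsAtom z) (hZa : Z.sup id ⊔ a = p)
    (hh : h ∈ H.erase p) (hha : ¬ IsAtom h) (hah : a ≤ h) (hph : ¬ p ≤ h) :
    ¬ JoinNested (H.erase p) (V ∪ {h}) := by
  intro hnest
  have hsup : (insert h Z).sup id = p ⊔ h := by
    rw [Finset.sup_insert, id, ← hZa, sup_comm h, sup_assoc, sup_eq_right.2 hah]
  have hap : a ≤ p := hZa ▸ le_sup_right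
  have hmem : p ⊔ h ∈ H.erase p :=
    (hH.erase hpa hmin).sup_mem hG (hH.subset hp) hh hha ha hap hah
  have := hnest (insert h Z) ?_ (hsup.symm ▸ hmem)
  · rw [hsup] at this
    rcases Finset.mem_insert.1 this with h1 | h1
    · exact hph (sup_eq_right.1 h1)
    · have h2 := (hZ _ h1).le_iff.1 (le_sup_left : p ≤ p ⊔ h)
      rcases h2 with h2 | h2
      · exact hH.ne_bot hG hp h2
      · exact hpa (h2 ▸ hZ _ h1)
  · intro e he
    rcases Finset.mem_insert.1 he with rfl | he
    · exact Or.inr rfl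
    · exact Or.inl (hZV he)

lemma IsNestedPair.erase {S : Finset L} {x : L} (h : IsNestedPair H S x) :
    IsNestedPair (H.erase p) (S.erase p) x where
  subset := Finset.erase_subset_erase _ h.subset
  not_isAtom s hs := h.not_isAtom s (Finset.mem_of_mem_erase hs)
  not_le g hg := h.not_le g (Finset.mem_of_mem_erase hg)
  nested := (h.nested.mono (pairSupp_mono (Finset.erase_subset _ _) le_rfl)).anti
    (Finset.erase_subset _ _)

variable {S : Finset L} {x : L}

include hG in
lemma IsBuildingSet.le_or_le_of_isAtom (hH : IsPartialBuildingSet G H)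
    (hpf : p ∈ latticeFactors G (p ⊔ x)) {a : L} (ha : IsAtom a) (hax : a ≤ p ⊔ x) :
    a ≤ p ∨ a ≤ x := by
  obtain ⟨j, hj, haj⟩ := exists_latticeFactors_ge (hH.subset (hH.atoms_mem a ha)) hax
  by_cases hjp : j = p
  · exact Or.inl (hjp ▸ haj)
  · exact Or.inr (haj.trans (hG.factor_le hpf hj hjp))

include hG hH hp hpa hmin in
-- Enlarge `h` to a factor `g` of `p ⊔ x`, so that `g = (p ⊓ g) ⊔ (x ⊓ g)`. If `p ≤ g`, then `g` is
-- the join of `p` and atoms below `x`, against nestedness; otherwise `p` lies in another factor,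
-- whence `p ⊓ g = ⊥` and `g ≤ x`, against `hx`.
lemma not_le_sup_of_joinNested [Finite L] [IsAtomistic L]
    (hx : ∀ h ∈ H, ¬ IsAtom h → ¬ h ≤ x)
    (hn : JoinNested H (insert p (pairSupp S x))) :
    ∀ h ∈ H.erase p, ¬ IsAtom h → ¬ h ≤ p ⊔ x := by
  intro h hh hha hle
  obtain ⟨hhp, hhH⟩ := Finset.mem_erase.1 hh
  obtain ⟨g, hg, hhg⟩ := exists_latticeFactors_ge (hH.subset hhH) hle
  have hg' := mem_latticeFactors.1 hg
  obtain ⟨hgH, hga⟩ := hH.filter h hhH hha g hg'.1 hhg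
  have hgp : g ≠ p := by
    rintro rfl
    exact hhp (hmin h hhH hha hhg)
  have hdist := hG.sup_inf_factor hg (le_sup_left : p ≤ p ⊔ x) le_sup_right
  rw [inf_eq_right.2 hg'.2.1] at hdist
  obtain ⟨j, hj, hpj⟩ := exists_latticeFactors_ge (hH.subset hp) (le_sup_left : p ≤ p ⊔ x)
  by_cases hjg : j = g
  · subst hjg
    rw [inf_eq_left.2 hpj] at hdist
    have hsup : (insert p (atomsBelow (x ⊓ j))).sup id = j := by
      rw [Finset.sup_insert, sup_atomsBelow, id, ← hdist]
    have := hn (insert p (atomsBelow (x ⊓ j))) ?_ (hsup.symm ▸ hgH)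
    · rw [hsup] at this
      rcases Finset.mem_insert.1 this with h1 | h1
      · exact hgp h1
      · exact hga (mem_atomsBelow.1 h1).1
    · intro e he
      rcases Finset.mem_insert.1 he with rfl | he
      · exact Or.inl rfl
      · have := mem_atomsBelow.1 he
        exact Or.inr (Or.inr ⟨this.1, this.2.trans inf_le_left⟩)
  · have h1 : p ⊓ g ≤ ⊥ := by
      rw [← hG.factor_inf_factor hj hg hjg]
      exact inf_le_inf_right _ hpj
    rw [le_bot_iff.1 h1, bot_sup_eq] at hdist
    exact hx g hgH hga (hdist ▸ inf_le_left)

include hG hH hp hpa hmin in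
lemma isNestedPair_sup_of_joinNested [Finite L] [IsAtomistic L] (h : IsNestedPair H S x)
    (hpS : p ∉ S) (hn : JoinNested H (insert p (pairSupp S x))) :
    IsNestedPair (H.erase p) S (p ⊔ x) := by
  have hle := not_le_sup_of_joinNested hG hH hp hpa hmin h.not_le hn
  have hpf := mem_latticeFactors_of_erase hH hp hpa le_sup_left hle
  have hSH : S ⊆ H.erase p := fun s hs =>
    Finset.mem_erase.2 ⟨by rintro rfl; exact hpS hs, h.subset hs⟩
  refine ⟨hSH, h.not_isAtom, hle, hn.erase_of_atoms hG hH hp hmin (Or.inl rfl) ?_ ?_⟩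
  · rintro v (hv | hv)
    · exact h.subset hv
    · exact hH.atoms_mem v hv.1
  · rintro v (hv | hv)
    · exact Or.inl (Or.inr (Or.inl hv))
    · rcases hG.le_or_le_of_isAtom hH hpf hv.1 hv.2 with h1 | h1
      · exact Or.inr ⟨hv.1, h1⟩
      · exact Or.inl (Or.inr (Or.inr ⟨hv.1, h1⟩))

include hG hH hp hpa hmin in
-- A converse to `isNestedPair_sup_of_joinNested`: pairs for `H` containing `p` correspond to pairs
-- for `H.erase p` whose join with `p` exists. These become the exceptional elements of the blowup
-- at `p`.
lemma isNestedPair_insert [Finite L] [IsAtomistic L] (h : IsNestedPair (H.erase p) S (p ⊔ x))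
    (hpx : ¬ p ≤ x) : IsNestedPair H (insert p S) x := by
  have hSH : S ⊆ H := h.subset.trans (Finset.erase_subset _ _)
  refine ⟨Finset.insert_subset hp hSH, ?_, ?_, ?_⟩
  · intro s hs
    rcases Finset.mem_insert.1 hs with rfl | hs
    · exact hpa
    · exact h.not_isAtom s hs
  · intro g hg hga hgx
    by_cases hgp : g = p
    · exact hpx (hgp ▸ hgx)
    · exact h.not_le g (Finset.mem_erase.2 ⟨hgp, hg⟩) hga (hgx.trans le_sup_right)
  · by_contra hcon
    have hsub : pairSupp (insert p S) x ⊆ H := by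
      rintro v (hv | hv)
      · exact Finset.insert_subset hp hSH hv
      · exact hH.atoms_mem v hv.1
    rcases exists_atoms_or_not_joinNested_erase hG hH hpa hmin hsub hcon with
      ⟨E, hE, hEa, hEs⟩ | ⟨-, h2⟩
    · refine hpx (hEs ▸ Finset.sup_le fun e he => ?_)
      rcases hE he with h1 | h1
      · rcases Finset.mem_insert.1 h1 with rfl | h1
        · exact absurd (hEa _ he).1 hpa
        · exact absurd (hEa _ he).1 (h.not_isAtom e h1)
      · exact h1.2
    · refine h2 (atomsBelow p) (fun e he => (mem_atomsBelow.1 he).1) (sup_atomsBelow p)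
        (h.nested.mono ?_)
      rintro v (⟨hv | hv, hvp⟩ | hv)
      · exact Or.inl ((Finset.mem_insert.1 hv).resolve_left hvp)
      · exact Or.inr ⟨hv.1, hv.2.trans le_sup_right⟩
      · have := mem_atomsBelow.1 hv
        exact Or.inr ⟨this.1, this.2.trans le_sup_left⟩

include hG in
-- For a factor, submodularity is an equality. Choose a basis `C` of `p ⊔ x` over `x` among the
-- atoms below `p`; meeting with `p` distributes over `x ⊔ C.sup id`, so `C` also spans `p` over `p
-- ⊓ x`.
lemma latticeRank_sup_of_factor [Finite L] [IsAtomistic L] [IsUpperModularLattice L]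
    (hpf : p ∈ latticeFactors G (p ⊔ x)) :
    latticeRank (p ⊔ x) + latticeRank (p ⊓ x) = latticeRank p + latticeRank x := by
  refine le_antisymm (latticeRank_sup_add_inf_le p x) ?_
  obtain ⟨C, hC, hCs, hCr⟩ := exists_basis_subset (x := x) (p := p ⊔ x) le_sup_right
    (B := atomsBelow p) (fun b hb => (mem_atomsBelow.1 hb).1) (by rw [sup_atomsBelow, sup_comm])
  have hCp : C.sup id ≤ p := Finset.sup_le fun c hc => (mem_atomsBelow.1 (hC hc)).2
  have h1 := hG.sup_inf_factor hpf (le_sup_right : x ≤ p ⊔ x) (hCp.trans le_sup_left)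
  rw [hCs, inf_eq_right.2 le_sup_left, inf_eq_left.2 hCp, inf_comm] at h1
  have h2 := latticeRank_sup_finset_le (p ⊓ x) (B := C) fun c hc => (mem_atomsBelow.1 (hC hc)).1
  rw [← h1] at h2
  omega

end Erase

end Nested

/-! ## The defining ideals and their behaviour under blowups -/

section NestedIdeal

open MvPolynomial
open scoped Polynomial Classical

variable {L : Type u} [Lattice L] [BoundedOrder L]

/-- The ideal of relations of a local De Concini–Procesi algebra, in the polynomial ring with one
variable for each element of `L`; the variables outside `H` are set to zero. -/
noncomputable def nestedIdeal (H : Finset L) (U : Set L) : Ideal (MvPolynomial L ℚ) :=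
  Ideal.span ({f | ∃ g, g ∉ H ∧ f = X g} ∪
    {f | ∃ T : Finset L, T ⊆ H ∧ ¬ JoinNested H (U ∪ T) ∧ f = ∏ t ∈ T, X t} ∪
    {f | ∃ a, IsAtom a ∧ f = ∑ h ∈ H with a ≤ h, X h})

lemma X_mem_nestedIdeal {H : Finset L} {U : Set L} {g : L} (hg : g ∉ H) :
    X g ∈ nestedIdeal H U :=
  Ideal.subset_span (Or.inl (Or.inl ⟨g, hg, rfl⟩))

lemma prod_mem_nestedIdeal {H : Finset L} {U : Set L} {T : Finset L} (hT : T ⊆ H)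
    (hU : ¬ JoinNested H (U ∪ T)) : ∏ t ∈ T, X t ∈ nestedIdeal H U :=
  Ideal.subset_span (Or.inl (Or.inr ⟨T, hT, hU, rfl⟩))

lemma sum_mem_nestedIdeal {H : Finset L} {U : Set L} {a : L} (ha : IsAtom a) :
    ∑ h ∈ H with a ≤ h, X h ∈ nestedIdeal H U :=
  Ideal.subset_span (Or.inr ⟨a, ha, rfl⟩)

lemma nestedIdeal_le {H : Finset L} {U : Set L} {I : Ideal (MvPolynomial L ℚ)}
    (h1 : ∀ g, g ∉ H → X g ∈ I)
    (h2 : ∀ T : Finset L, T ⊆ H → ¬ JoinNested H (U ∪ T) → ∏ t ∈ T, X t ∈ I)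
    (h3 : ∀ a, IsAtom a → ∑ h ∈ H with a ≤ h, X h ∈ I) : nestedIdeal H U ≤ I := by
  refine Ideal.span_le.2 ?_
  rintro f ((⟨g, hg, rfl⟩ | ⟨T, hT, hn, rfl⟩) | ⟨a, ha, rfl⟩)
  exacts [h1 g hg, h2 T hT hn, h3 a ha]

lemma nestedIdeal_mono {H : Finset L} {U V : Set L} (h : U ⊆ V) :
    nestedIdeal H U ≤ nestedIdeal H V :=
  nestedIdeal_le (fun _ hg => X_mem_nestedIdeal hg)
    (fun _ hT hn => prod_mem_nestedIdeal hT fun h' =>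
      hn (h'.mono (Set.union_subset_union_left _ h)))
    fun _ ha => sum_mem_nestedIdeal ha

/-- The substitution that expresses the old coordinates after the blowup at `p`: the variable of
`p` becomes the new variable, which is subtracted from the variables of the atoms below `p`. -/
noncomputable def blowupHom (p : L) : MvPolynomial L ℚ →ₐ[ℚ] (MvPolynomial L ℚ)[X] :=
  aeval fun g => if g = p then Polynomial.X else
    if IsAtom g ∧ g ≤ p then Polynomial.C (X g) - Polynomial.X else Polynomial.C (X g)

/-- The pullback of coordinates along the blow-down map. -/
noncomputable def pullbackHom (p : L) : MvPolynomial L ℚ →ₐ[ℚ] MvPolynomial L ℚ :=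
  aeval fun g => if g = p then 0 else if IsAtom g ∧ g ≤ p then X g + X p else X g

/-- The extension of `pullbackHom` that sends the new variable to the variable of `p`. -/
noncomputable def unblowupHom (p : L) : (MvPolynomial L ℚ)[X] →+* MvPolynomial L ℚ :=
  Polynomial.eval₂RingHom (pullbackHom p : MvPolynomial L ℚ →+* MvPolynomial L ℚ) (X p)

lemma blowupHom_X (p g : L) : blowupHom p (X g) = if g = p then Polynomial.X else
    if IsAtom g ∧ g ≤ p then Polynomial.C (X g) - Polynomial.X else Polynomial.C (X g) := by
  simp [blowupHom]

lemma pullbackHom_X (p g : L) : pullbackHom p (X g) =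
    if g = p then 0 else if IsAtom g ∧ g ≤ p then X g + X p else X g := by
  simp [pullbackHom]

lemma unblowupHom_C (p : L) (f : MvPolynomial L ℚ) :
    unblowupHom p (Polynomial.C f) = pullbackHom p f := by simp [unblowupHom]

lemma unblowupHom_X (p : L) : unblowupHom p Polynomial.X = X p := by simp [unblowupHom]

lemma unblowupHom_blowupHom {p : L} (f : MvPolynomial L ℚ) :
    unblowupHom p (blowupHom p f) = f := by
  have : ((unblowupHom p).comp (blowupHom p : MvPolynomial L ℚ →+* (MvPolynomial L ℚ)[X])) =
      RingHom.id _ := by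
    refine MvPolynomial.ringHom_ext (fun r => ?_) fun g => ?_
    · simp only [RingHom.comp_apply, RingHom.coe_coe, RingHom.id_apply]
      rw [← algebraMap_eq, AlgHom.commutes]
      exact (unblowupHom_C p _).trans ((pullbackHom p).commutes r)
    · simp only [RingHom.comp_apply, RingHom.coe_coe, RingHom.id_apply, blowupHom_X]
      split_ifs with h1 h2
      · rw [unblowupHom_X, h1]
      · rw [map_sub, unblowupHom_C, unblowupHom_X, pullbackHom_X, if_neg h1, if_pos h2,
          add_sub_cancel_right]
      · rw [unblowupHom_C, pullbackHom_X, if_neg h1, if_neg h2]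
  exact congrArg (fun φ => φ f) this

/-- The only discrepancy is the constant `C (X p)`, whose role the new variable has taken over. It
vanishes modulo the relations for `H.erase p`. -/
lemma blowupHom_unblowupHom {p : L} {K : Ideal (MvPolynomial L ℚ)[X]}
    (hK : Polynomial.C (X p) ∈ K) (f : (MvPolynomial L ℚ)[X]) :
    blowupHom p (unblowupHom p f) - f ∈ K := by
  rw [← Ideal.Quotient.eq]
  have : ((Ideal.Quotient.mk K).comp
      ((blowupHom p : MvPolynomial L ℚ →+* (MvPolynomial L ℚ)[X]).comp (unblowupHom p))) =
      Ideal.Quotient.mk K := by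
    refine Polynomial.ringHom_ext' (MvPolynomial.ringHom_ext (fun r => ?_) fun g => ?_) ?_
    · simp only [RingHom.comp_apply, unblowupHom_C, RingHom.coe_coe]
      rw [← algebraMap_eq, AlgHom.commutes, AlgHom.commutes]
      rfl
    · simp only [RingHom.comp_apply, unblowupHom_C, RingHom.coe_coe, pullbackHom_X]
      split_ifs with h1 h2
      · rw [h1, map_zero, map_zero, Ideal.Quotient.eq_zero_iff_mem.2 hK]
      · rw [map_add, blowupHom_X, if_neg h1, if_pos h2, blowupHom_X, if_pos rfl, sub_add_cancel]
      · rw [blowupHom_X, if_neg h1, if_neg h2]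
    · simp only [RingHom.comp_apply, unblowupHom_X, RingHom.coe_coe, blowupHom_X, if_true]
  exact congrArg (fun φ => φ f) this

variable {G H : Finset L} (hG : IsBuildingSet G) (hH : IsPartialBuildingSet G H)
  {p : L} (hp : p ∈ H) (hpa : ¬ IsAtom p) (hmin : ∀ h ∈ H, ¬ IsAtom h → h ≤ p → h = p)

lemma IsAtom.eq_of_le_isAtom {a b : L} (ha : IsAtom a) (hb : IsAtom b) (h : a ≤ b) : a = b :=
  (hb.le_iff.1 h).resolve_left ha.1

section Linear

include hH hp hpa

/-- If `a ≤ p`, the new variable coming from `x_p` cancels the one subtracted from `x_a`; if not,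
neither occurs. -/
lemma blowupHom_sum {a : L} (ha : IsAtom a) :
    blowupHom p (∑ h ∈ H with a ≤ h, X h) = Polynomial.C (∑ h ∈ H.erase p with a ≤ h, X h) := by
  have hmem : ∀ b, IsAtom b → b ≠ p := by rintro b hb rfl; exact hpa hb
  rw [← Finset.insert_erase hp, Finset.filter_insert, map_sum, map_sum,
    Finset.erase_insert (Finset.notMem_erase _ _)]
  have haH : a ∈ (H.erase p).filter (a ≤ ·) :=
    Finset.mem_filter.2 ⟨Finset.mem_erase.2 ⟨hmem a ha, hH.atoms_mem a ha⟩, le_rfl⟩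
  have hrest : ∀ h ∈ ((H.erase p).filter (a ≤ ·)).erase a,
      blowupHom p (X h) = Polynomial.C (X h) := by
    intro h hh
    obtain ⟨h1, h2⟩ := Finset.mem_erase.1 hh
    obtain ⟨h2, h3⟩ := Finset.mem_filter.1 h2
    rw [blowupHom_X, if_neg (Finset.ne_of_mem_erase h2), if_neg]
    exact fun h4 => h1 (ha.eq_of_le_isAtom h4.1 h3).symm
  by_cases hap : a ≤ p
  · rw [if_pos hap, Finset.sum_insert (by simp), ← Finset.add_sum_erase _ _ haH,
      ← Finset.add_sum_erase _ (fun h => Polynomial.C (X h)) haH, Finset.sum_congr rfl hrest,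
      blowupHom_X, if_pos rfl, blowupHom_X, if_neg (hmem a ha), if_pos ⟨ha, hap⟩]
    ring
  · rw [if_neg hap, ← Finset.add_sum_erase _ _ haH,
      ← Finset.add_sum_erase _ (fun h => Polynomial.C (X h)) haH, Finset.sum_congr rfl hrest,
      blowupHom_X, if_neg (hmem a ha), if_neg fun h => hap h.2]

lemma pullbackHom_sum {a : L} (ha : IsAtom a) :
    pullbackHom p (∑ h ∈ H.erase p with a ≤ h, X h) = ∑ h ∈ H with a ≤ h, X h := by
  rw [← unblowupHom_C, ← blowupHom_sum hH hp hpa ha, unblowupHom_blowupHom]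

end Linear

section Products

omit [Lattice L] [BoundedOrder L] in
lemma prod_filter_split {R : Type*} [CommRing R] (q : L → Prop) [DecidablePred q] (T : Finset L) (f : L → R) :
    ∏ t ∈ T, f t = (∏ t ∈ T with ¬ q t, f t) * ∏ t ∈ T with q t, f t := by
  rw [mul_comm, Finset.prod_filter_mul_prod_filter_not]

lemma blowupHom_prod {T : Finset L} (hpT : p ∉ T) :
    blowupHom p (∏ t ∈ T, X t) =
      Polynomial.C (∏ t ∈ T with ¬ (IsAtom t ∧ t ≤ p), X t) *
        ∏ t ∈ T with IsAtom t ∧ t ≤ p, (Polynomial.C (X t) - Polynomial.X) := by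
  rw [prod_filter_split (fun t => IsAtom t ∧ t ≤ p), map_mul, map_prod, map_prod, map_prod]
  have hne : ∀ t ∈ T, t ≠ p := by rintro t ht rfl; exact hpT ht
  congr 1
  · refine Finset.prod_congr rfl fun t ht => ?_
    obtain ⟨h1, h2⟩ := Finset.mem_filter.1 ht
    rw [blowupHom_X, if_neg (hne t h1), if_neg h2]
  · refine Finset.prod_congr rfl fun t ht => ?_
    obtain ⟨h1, h2⟩ := Finset.mem_filter.1 ht
    rw [blowupHom_X, if_neg (hne t h1), if_pos h2]

lemma pullbackHom_prod {T : Finset L} (hpT : p ∉ T) :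
    pullbackHom p (∏ t ∈ T, X t) =
      (∏ t ∈ T with ¬ (IsAtom t ∧ t ≤ p), X t) * ∏ t ∈ T with IsAtom t ∧ t ≤ p, (X t + X p) := by
  rw [prod_filter_split (fun t => IsAtom t ∧ t ≤ p), map_mul, map_prod, map_prod]
  have hne : ∀ t ∈ T, t ≠ p := by rintro t ht rfl; exact hpT ht
  congr 1
  · refine Finset.prod_congr rfl fun t ht => ?_
    obtain ⟨h1, h2⟩ := Finset.mem_filter.1 ht
    rw [pullbackHom_X, if_neg (hne t h1), if_neg h2]
  · refine Finset.prod_congr rfl fun t ht => ?_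
    obtain ⟨h1, h2⟩ := Finset.mem_filter.1 ht
    rw [pullbackHom_X, if_neg (hne t h1), if_pos h2]

lemma dvd_prod_sub_prod {R : Type*} [CommRing R] {ι : Type*} (B : Finset ι) (f g : ι → R) (x : R)
    (h : ∀ b, x ∣ f b - g b) : x ∣ ∏ b ∈ B, f b - ∏ b ∈ B, g b := by
  induction B using Finset.induction_on with
  | empty => simp
  | insert b B hb ih =>
    rw [Finset.prod_insert hb, Finset.prod_insert hb]
    have : f b * ∏ b ∈ B, f b - g b * ∏ b ∈ B, g b =
        (f b - g b) * ∏ b ∈ B, f b + g b * (∏ b ∈ B, f b - ∏ b ∈ B, g b) := by ring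
    rw [this]
    exact dvd_add ((h b).mul_right _) (ih.mul_left _)

end Products

section Pullback

include hG hH hp hmin

lemma not_joinNested_insert_of_erase {U W : Set L} (hWH : W ⊆ H)
    (hWU : ∀ w ∈ W, w ∈ U ∨ IsAtom w ∧ w ≤ p) {T : Finset L} (hT : T ⊆ H.erase p)
    (hn : ¬ JoinNested (H.erase p) (W ∪ T)) :
    ¬ JoinNested H (insert p (U ∪ T.filter fun t => ¬ (IsAtom t ∧ t ≤ p))) := by
  intro h
  refine hn (h.erase_of_atoms hG hH hp hmin (Or.inl rfl) ?_ ?_)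
  · exact Set.union_subset hWH fun t ht => Finset.mem_of_mem_erase (hT ht)
  · rintro v (hv | hv)
    · exact (hWU v hv).imp (fun h => Or.inr (Or.inl h)) id
    · by_cases hva : IsAtom v ∧ v ≤ p
      · exact Or.inr hva
      · exact Or.inl (Or.inr (Or.inr (Finset.mem_coe.2 (Finset.mem_filter.2 ⟨hv, hva⟩))))

include hpa in
/-- The pullback of a relation for the centre of the blowup becomes a relation after multiplication
by the variable of `p`. -/
lemma pullbackHom_mem {U W : Set L} (hWH : W ⊆ H) (hWU : ∀ w ∈ W, w ∈ U ∨ IsAtom w ∧ w ≤ p)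
    {f : MvPolynomial L ℚ} (hf : f ∈ nestedIdeal (H.erase p) W) :
    X p * pullbackHom p f ∈ nestedIdeal H U ∧
      (p ∈ U ∨ W ⊆ U → pullbackHom p f ∈ nestedIdeal H U) := by
  have hsimple : ∀ g ∈ nestedIdeal H U, X p * g ∈ nestedIdeal H U :=
    fun g hg => Ideal.mul_mem_left _ _ hg
  have key1 : nestedIdeal (H.erase p) W ≤
      ((nestedIdeal H U).colon {X p}).comap (pullbackHom p) ∧ (p ∈ U ∨ W ⊆ U →
        nestedIdeal (H.erase p) W ≤ (nestedIdeal H U).comap (pullbackHom p)) := by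
    have hX : ∀ g, g ∉ H.erase p → pullbackHom p (X g) ∈ nestedIdeal H U := by
      intro g hg
      rw [pullbackHom_X]
      split_ifs with h1 h2
      · exact Ideal.zero_mem _
      · exact absurd (Finset.mem_erase.2 ⟨h1, hH.atoms_mem g h2.1⟩) hg
      · exact X_mem_nestedIdeal fun h => hg (Finset.mem_erase.2 ⟨h1, h⟩)
    have hsum : ∀ a, IsAtom a →
        pullbackHom p (∑ h ∈ H.erase p with a ≤ h, X h) ∈ nestedIdeal H U := by
      intro a ha
      rw [pullbackHom_sum hH hp hpa ha]
      exact sum_mem_nestedIdeal ha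
    -- Once `p` is present it stands in for all the atoms below it, so those members of `T` may be
    -- dropped at the price of a factor `x_p`.
    have hmul : ∀ T : Finset L, T ⊆ H.erase p → ¬ JoinNested (H.erase p) (W ∪ T) →
        X p * ∏ t ∈ T with ¬ (IsAtom t ∧ t ≤ p), X t ∈ nestedIdeal H U := by
      intro T hT hn
      have hpT : p ∉ T.filter fun t => ¬ (IsAtom t ∧ t ≤ p) := fun h =>
        Finset.notMem_erase p H (hT (Finset.mem_filter.1 h).1)
      rw [← Finset.prod_insert (f := fun t => (X t : MvPolynomial L ℚ)) hpT]
      refine prod_mem_nestedIdeal (Finset.insert_subset hp fun t ht =>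
        Finset.mem_of_mem_erase (hT (Finset.mem_filter.1 ht).1)) fun h =>
          not_joinNested_insert_of_erase hG hH hp hmin hWH hWU hT hn (h.mono ?_)
      rw [Finset.coe_insert, Set.union_insert]
    constructor
    · refine nestedIdeal_le (fun g hg => ?_) (fun T hT hn => ?_) fun a ha => ?_
      · rw [Ideal.mem_comap, Submodule.mem_colon_singleton, smul_eq_mul, mul_comm]
        exact hsimple _ (hX g hg)
      · rw [Ideal.mem_comap, Submodule.mem_colon_singleton, smul_eq_mul, mul_comm,
          pullbackHom_prod fun h => Finset.notMem_erase p H (hT h), ← mul_assoc]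
        exact Ideal.mul_mem_right _ _ (hmul T hT hn)
      · rw [Ideal.mem_comap, Submodule.mem_colon_singleton, smul_eq_mul, mul_comm]
        exact hsimple _ (hsum a ha)
    · intro hU
      refine nestedIdeal_le (fun g hg => hX g hg) (fun T hT hn => ?_) fun a ha => hsum a ha
      rw [Ideal.mem_comap, pullbackHom_prod fun h => Finset.notMem_erase p H (hT h)]
      by_cases hpU : p ∈ U
      · refine Ideal.mul_mem_right _ _ (prod_mem_nestedIdeal (fun t ht =>
          Finset.mem_of_mem_erase (hT (Finset.mem_filter.1 ht).1)) fun h =>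
          not_joinNested_insert_of_erase hG hH hp hmin hWH hWU hT hn (h.mono ?_))
        exact Set.insert_subset (Or.inl hpU) le_rfl
      · have hWU' := hU.resolve_left hpU
        -- Expanding the product of the `x_t + x_p`: the multiples of `x_p` are covered by `hmul`,
        -- and the remaining term is the product over `T`, a relation because `W ⊆ U`.
        obtain ⟨q, hq⟩ := dvd_prod_sub_prod (T.filter fun t => IsAtom t ∧ t ≤ p)
          (fun t => X t + X p) (fun t => X t) (X p : MvPolynomial L ℚ) (by simp)
        rw [sub_eq_iff_eq_add] at hq
        rw [hq, mul_add, ← prod_filter_split (fun t => IsAtom t ∧ t ≤ p) T, ← mul_assoc,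
          mul_comm _ (X p : MvPolynomial L ℚ)]
        refine Ideal.add_mem _ (Ideal.mul_mem_right _ _ (hmul T hT hn))
          (prod_mem_nestedIdeal (hT.trans (Finset.erase_subset _ _)) fun h => hn ?_)
        exact (h.mono (Set.union_subset_union_left _ hWU')).anti (Finset.erase_subset _ _)
  refine ⟨?_, fun h => key1.2 h hf⟩
  have := key1.1 hf
  rwa [Ideal.mem_comap, Submodule.mem_colon_singleton, smul_eq_mul, mul_comm] at this

end Pullback

/-! ### Exchange of basis elements modulo the relations -/

section Exchange

include hG hH hp hpa hmin

/-- In the presence of atoms that together with `a` join to `p`, the variable of `a` becomes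
independent of `a`. -/
lemma prod_mul_X_add_mem {V : Set L} {B Z : Finset L} {a : L} (hB : ∀ b ∈ B, IsAtom b)
    (ha : IsAtom a) (hZV : ↑Z ⊆ V ∪ B) (hZ : ∀ z ∈ Z, IsAtom z) (hZa : Z.sup id ⊔ a = p) :
    (∏ b ∈ B, X b) * (X a + ∑ h ∈ H.erase p with p ≤ h, X h) ∈ nestedIdeal (H.erase p) V := by
  have hH' := hH.erase hpa hmin
  have hap : a ≤ p := hZa ▸ le_sup_right
  have hpa' : ¬ p ≤ a := fun h => hpa (le_antisymm h hap ▸ ha)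
  -- The linear relation at `a` has three kinds of terms: `x_a`, those above `p`, and those above
  -- `a` but not above `p`. The last kind is killed by the product over `B`, by
  -- `not_joinNested_of_not_le`.
  have hsplit : (∑ h ∈ H.erase p with a ≤ h, (X h : MvPolynomial L ℚ)) =
      (X a + ∑ h ∈ H.erase p with p ≤ h, X h) +
        ∑ h ∈ ((H.erase p).filter fun h => a ≤ h ∧ ¬ p ≤ h).erase a, X h := by
    have ha' : a ∈ (H.erase p).filter fun h => a ≤ h ∧ ¬ p ≤ h :=
      Finset.mem_filter.2 ⟨hH'.atoms_mem a ha, le_rfl, hpa'⟩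
    rw [← Finset.sum_filter_add_sum_filter_not _ (fun h => p ≤ h), Finset.filter_filter,
      Finset.filter_filter, ← Finset.add_sum_erase _ _ ha']
    have : ((H.erase p).filter fun h => a ≤ h ∧ p ≤ h) = (H.erase p).filter fun h => p ≤ h :=
      Finset.filter_congr fun h _ => ⟨fun h => h.2, fun h => ⟨hap.trans h, h⟩⟩
    rw [this]
    ring
  have h1 := Ideal.mul_mem_left (nestedIdeal (H.erase p) V) (∏ b ∈ B, X b)
    (sum_mem_nestedIdeal (H := H.erase p) (U := V) ha)
  rw [hsplit, mul_add] at h1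
  refine (Ideal.add_mem_iff_left _ ?_).1 h1
  rw [Finset.mul_sum]
  refine Ideal.sum_mem _ fun h hh => ?_
  obtain ⟨hha, hh⟩ := Finset.mem_erase.1 hh
  obtain ⟨hhH, hah, hph⟩ := Finset.mem_filter.1 hh
  have hhat : ¬ IsAtom h := fun h' => hha (ha.eq_of_le_isAtom h' hah).symm
  have hhB : h ∉ B := fun h' => hhat (hB h h')
  rw [mul_comm, ← Finset.prod_insert (f := fun t => (X t : MvPolynomial L ℚ)) hhB]
  refine prod_mem_nestedIdeal (Finset.insert_subset hhH fun b hb => hH'.atoms_mem b (hB b hb))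
    fun hn => not_joinNested_of_not_le hG hH hp hpa hmin ha hZV hZ hZa hhH hhat hah hph
      (hn.mono ?_)
  rw [Finset.coe_insert, Set.union_insert, Set.union_singleton]

variable [Finite L] [IsAtomistic L] [IsUpperModularLattice L]

/-- Monomials of bases of `p` over `x ⊓ p` agree modulo the relations. -/
lemma prod_sub_prod_mem {U : Set L} {x₀ : L} (hU : ∀ a, IsAtom a → a ≤ x₀ → a ∈ U)
    {A B : Finset L} (hA : ∀ a ∈ A, IsAtom a) (hB : ∀ b ∈ B, IsAtom b)
    (hAp : x₀ ⊔ A.sup id = p) (hBp : x₀ ⊔ B.sup id = p)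
    (hAr : latticeRank p = latticeRank x₀ + A.card)
    (hBr : latticeRank p = latticeRank x₀ + B.card) :
    ∏ a ∈ A, X a - ∏ b ∈ B, X b ∈ nestedIdeal (H.erase p) U := by
  rw [← Ideal.Quotient.eq]
  refine eq_of_exchange (fun B => Ideal.Quotient.mk (nestedIdeal (H.erase p) U) (∏ b ∈ B, X b))
    (fun C a b haC hbC hC ha hb hap hbp => ?_) hA hB hAp hBp hAr hBr
  rw [Ideal.Quotient.eq, Finset.prod_insert haC, Finset.prod_insert hbC]
  have hZ : ∀ z ∈ atomsBelow x₀ ∪ C, IsAtom z := fun z hz => (Finset.mem_union.1 hz).elim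
    (fun h => (mem_atomsBelow.1 h).1) (hC z)
  have hZU : (↑(atomsBelow x₀ ∪ C) : Set L) ⊆ U ∪ C := by
    intro z hz
    rcases Finset.mem_union.1 hz with h | h
    · exact Or.inl (hU z (mem_atomsBelow.1 h).1 (mem_atomsBelow.1 h).2)
    · exact Or.inr h
  have hs : (atomsBelow x₀ ∪ C).sup id = x₀ ⊔ C.sup id := by
    rw [Finset.sup_union, sup_atomsBelow]
  have h1 := prod_mul_X_add_mem hG hH hp hpa hmin (V := U) hC ha hZU hZ (hs ▸ hap)
  have h2 := prod_mul_X_add_mem hG hH hp hpa hmin (V := U) hC hb hZU hZ (hs ▸ hbp)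
  have := Ideal.sub_mem _ h1 h2
  convert this using 1
  ring

omit [IsUpperModularLattice L] in
/-- The variables of the atoms below `p` agree on the centre of the blowup at `p`. -/
lemma X_sub_X_mem {U : Set L} (hU : ∀ a, IsAtom a → a ≤ p → a ∈ U) {a b : L} (ha : IsAtom a)
    (hb : IsAtom b) (hap : a ≤ p) (hbp : b ≤ p) : X a - X b ∈ nestedIdeal (H.erase p) U := by
  have h := fun c (hc : IsAtom c) (hcp : c ≤ p) =>
    prod_mul_X_add_mem hG hH hp hpa hmin (V := U) (B := ∅) (Z := atomsBelow p) (a := c) (by simp)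
      hc (fun z hz => Or.inl (hU z (mem_atomsBelow.1 hz).1 (mem_atomsBelow.1 hz).2))
      (fun z hz => (mem_atomsBelow.1 hz).1) (by rw [sup_atomsBelow, sup_eq_left.2 hcp])
  have := Ideal.sub_mem _ (h a ha hap) (h b hb hbp)
  convert this using 1
  simp

end Exchange

end NestedIdeal

/-! ### Comparison of the relations before and after the blowup at `p` -/

section BlowupRelations

open MvPolynomial
open scoped Polynomial Classical

variable {L : Type u} [Lattice L] [BoundedOrder L]

/-- The polynomial `∏ (t - x_a)` over a set `A` of atoms. -/
noncomputable def atomPoly (A : Finset L) : (MvPolynomial L ℚ)[X] :=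
  ∏ a ∈ A, (Polynomial.X - Polynomial.C (X a))

omit [Lattice L] [BoundedOrder L]

lemma atomPoly_monic (A : Finset L) : (atomPoly A).Monic :=
  Polynomial.monic_prod_of_monic _ _ fun _ _ => Polynomial.monic_X_sub_C _

lemma natDegree_atomPoly (A : Finset L) : (atomPoly A).natDegree = A.card := by
  rw [atomPoly, Polynomial.natDegree_prod_of_monic _ _ fun _ _ => Polynomial.monic_X_sub_C _]
  simp

lemma coeff_zero_atomPoly (A : Finset L) :
    (atomPoly A).coeff 0 = (-1) ^ A.card * ∏ a ∈ A, X a := by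
  rw [atomPoly, Polynomial.coeff_zero_prod]
  simp [Finset.prod_neg]

lemma prod_C_sub_X (A : Finset L) :
    ∏ a ∈ A, (Polynomial.C (X a : MvPolynomial L ℚ) - Polynomial.X) =
      (-1) ^ A.card * atomPoly A := by
  rw [atomPoly, ← Finset.prod_const, ← Finset.prod_mul_distrib]
  exact Finset.prod_congr rfl fun _ _ => by ring

lemma scaleHom_atomPoly (A : Finset L) :
    scaleHom (doubleHom L : MvPolynomial L ℚ →+* MvPolynomial L ℚ) (atomPoly A) =
      2 ^ (atomPoly A).natDegree * atomPoly A := by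
  rw [natDegree_atomPoly, atomPoly, map_prod, ← Finset.prod_const, ← Finset.prod_mul_distrib]
  refine Finset.prod_congr rfl fun a _ => ?_
  rw [map_sub, scaleHom_X, scaleHom_C, RingHom.coe_coe, doubleHom_X, map_mul, mul_sub]
  simp [Polynomial.C_ofNat]

variable [Lattice L] [BoundedOrder L] [Finite L] [IsAtomistic L] [IsUpperModularLattice L]
  {G H : Finset L} (hG : IsBuildingSet G) (hH : IsPartialBuildingSet G H)
  {p : L} (hp : p ∈ H) (hpa : ¬ IsAtom p) (hmin : ∀ h ∈ H, ¬ IsAtom h → h ≤ p → h = p)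
  {K : Ideal (MvPolynomial L ℚ)[X]} {U : Set L} {x₀ : L} (hx₀ : x₀ ≤ p)
  (hUx : ∀ a, IsAtom a → a ≤ x₀ → a ∈ U)
  (hK₀ : nestedIdeal (H.erase p) (U \ {p}) ≤ K.comap Polynomial.C)
  (hKJ : ∀ F ∈ (nestedIdeal (H.erase p) (U \ {p} ∪ {a | IsAtom a ∧ a ≤ p})).map Polynomial.C,
    Polynomial.X * F ∈ K)
  {A : Finset L} (hA : ∀ a ∈ A, IsAtom a) (hAp : x₀ ⊔ A.sup id = p)
  (hAr : latticeRank p = latticeRank x₀ + A.card) (hKA : atomPoly A ∈ K)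

section

include hG hH hp hpa hmin hx₀ hUx hK₀ hKJ hA hAp hAr hKA

/-- `B` contains a basis `C`, and it suffices that `atomPoly C - atomPoly A` lies in `K`. The
constant terms agree by basis exchange. The other coefficients come with a factor `t`, so they need
only agree modulo the relations of the centre, where all atoms below `p` have equal variables and
both polynomials are the same power of a linear one. -/
lemma prod_C_sub_X_mem {B : Finset L} (hB : ∀ b ∈ B, IsAtom b) (hBp : x₀ ⊔ B.sup id = p) :
    ∏ b ∈ B, (Polynomial.C (X b : MvPolynomial L ℚ) - Polynomial.X) ∈ K := by
  obtain ⟨C, hCB, hCp, hCr⟩ := exists_basis_subset hx₀ hB hBp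
  have hC : ∀ c ∈ C, IsAtom c := fun c hc => hB c (hCB hc)
  rw [← Finset.prod_sdiff hCB, prod_C_sub_X C]
  refine Ideal.mul_mem_left _ _ (Ideal.mul_mem_left _ _ ?_)
  have hcard : C.card = A.card := by omega
  have hUx' : ∀ a, IsAtom a → a ≤ x₀ → a ∈ U \ {p} := fun a ha hax =>
    ⟨hUx a ha hax, by rintro rfl; exact hpa ha⟩
  suffices h : atomPoly C - atomPoly A ∈ K by simpa using Ideal.add_mem _ h hKA
  rw [← Polynomial.X_mul_divX_add (atomPoly C - atomPoly A)]
  refine Ideal.add_mem _ (hKJ _ (Ideal.mem_map_C_iff.2 fun i => ?_)) (hK₀ ?_)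
  · rw [Polynomial.coeff_divX]
    set J := nestedIdeal (H.erase p) (U \ {p} ∪ {a | IsAtom a ∧ a ≤ p})
    have hle : ∀ B' : Finset L, x₀ ⊔ B'.sup id = p → ∀ b ∈ B', b ≤ p := fun B' h b hb =>
      h ▸ (Finset.le_sup (f := id) hb).trans le_sup_right
    have hAmap : ∀ B' : Finset L, (∀ b ∈ B', IsAtom b) → x₀ ⊔ B'.sup id = p → ∀ a, IsAtom a →
        a ≤ p → (atomPoly B').map (Ideal.Quotient.mk J) =
          (Polynomial.X - Polynomial.C (Ideal.Quotient.mk J (X a))) ^ B'.card := by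
      intro B' hB' hBp' a ha hap
      rw [atomPoly, Polynomial.map_prod]
      refine Finset.prod_eq_pow_card fun b hb => ?_
      rw [Polynomial.map_sub, Polynomial.map_X, Polynomial.map_C,
        (Ideal.Quotient.eq (I := J)).2 (X_sub_X_mem hG hH hp hpa hmin
          (U := U \ {p} ∪ {a | IsAtom a ∧ a ≤ p}) (fun c hc hcp => Or.inr ⟨hc, hcp⟩) (hB' b hb) ha (hle B' hBp' b hb) hap)]
    have h0 : (atomPoly C - atomPoly A).map (Ideal.Quotient.mk J) = 0 := by
      rw [Polynomial.map_sub, sub_eq_zero]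
      obtain ⟨a, ha⟩ : ∃ a, IsAtom a ∧ a ≤ p := by
        obtain h | ⟨a, ha, hap⟩ := eq_bot_or_exists_atom_le p
        · exact absurd h (hH.ne_bot hG hp)
        · exact ⟨a, ha, hap⟩
      rw [hAmap C hC hCp a ha.1 ha.2, hAmap A hA hAp a ha.1 ha.2, hcard]
    rw [← Ideal.Quotient.eq_zero_iff_mem, ← Polynomial.coeff_map, h0, Polynomial.coeff_zero]
  · rw [Polynomial.coeff_sub, coeff_zero_atomPoly, coeff_zero_atomPoly, hcard, ← mul_sub]
    exact Ideal.mul_mem_left _ _ (prod_sub_prod_mem hG hH hp hpa hmin hUx' hC hA hCp hAp hCr hAr)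

/-- The relations after the blowup hold in any quotient in which the relations of the blowup
algebra hold. -/
lemma nestedIdeal_le_comap_blowupHom (hUH : U ⊆ H)
    (hxU : ∀ a ∈ U, IsAtom a → a ≤ p → a ≤ x₀)
    (hKp : p ∈ U → nestedIdeal (H.erase p) (U \ {p} ∪ {a | IsAtom a ∧ a ≤ p}) ≤
      K.comap Polynomial.C) :
    nestedIdeal H U ≤ K.comap (blowupHom p) := by
  refine nestedIdeal_le (fun g hg => ?_) (fun T hT hn => ?_) fun a ha => ?_
  · have hgp : g ≠ p := by rintro rfl; exact hg hp
    rw [Ideal.mem_comap, blowupHom_X, if_neg hgp, if_neg fun h => hg (hH.atoms_mem g h.1)]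
    exact hK₀ (X_mem_nestedIdeal fun h => hg (Finset.mem_of_mem_erase h))
  · rw [Ideal.mem_comap]
    set B := (T.erase p).filter fun t => IsAtom t ∧ t ≤ p with hB
    set T₀ := (T.erase p).filter fun t => ¬ (IsAtom t ∧ t ≤ p) with hT₀
    have hT₀' : T₀ ⊆ H.erase p := (Finset.filter_subset _ _).trans (Finset.erase_subset_erase _ hT)
    have hθ : blowupHom p (∏ t ∈ T.erase p, X t) = Polynomial.C (∏ t ∈ T₀, X t) *
        ∏ b ∈ B, (Polynomial.C (X b) - Polynomial.X) :=
      blowupHom_prod (Finset.notMem_erase p T)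
    have hdvd : blowupHom p (∏ t ∈ T.erase p, X t) ∣ blowupHom p (∏ t ∈ T, X t) :=
      map_dvd _ (Finset.prod_dvd_prod_of_subset _ _ _ (Finset.erase_subset _ _))
    rcases exists_atoms_or_not_joinNested_erase hG hH hpa hmin
      (Set.union_subset hUH (by exact_mod_cast hT)) hn with ⟨E, hE, hEa, hEs⟩ | ⟨h1, h2⟩
    · have hBp : x₀ ⊔ B.sup id = p := by
        refine le_antisymm (sup_le hx₀ (Finset.sup_le fun b hb => (Finset.mem_filter.1 hb).2.2)) ?_
        conv_lhs => rw [← hEs]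
        refine Finset.sup_le fun e he => ?_
        rcases hE he with h | h
        · exact (hxU e h (hEa e he).1 (hEa e he).2).trans le_sup_left
        · refine (Finset.le_sup (f := id) (Finset.mem_filter.2 ⟨Finset.mem_erase.2 ⟨?_, h⟩,
            hEa e he⟩)).trans le_sup_right
          rintro rfl
          exact hpa (hEa _ he).1
      refine Ideal.mem_of_dvd _ hdvd ?_
      rw [hθ]
      exact Ideal.mul_mem_left _ _ (prod_C_sub_X_mem hG hH hp hpa hmin hx₀ hUx hK₀ hKJ hA hAp hAr
        hKA (fun b hb => (Finset.mem_filter.1 hb).2.1) hBp)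
    · have hT₀J : ∏ t ∈ T₀, X t ∈
          nestedIdeal (H.erase p) (U \ {p} ∪ {a | IsAtom a ∧ a ≤ p}) := by
        refine prod_mem_nestedIdeal hT₀' fun h => h2 (atomsBelow p)
          (fun e he => (mem_atomsBelow.1 he).1) (sup_atomsBelow p) (h.mono ?_)
        rintro v (⟨hv | hv, hvp⟩ | hv)
        · exact Or.inl (Or.inl ⟨hv, hvp⟩)
        · by_cases hva : IsAtom v ∧ v ≤ p
          · exact Or.inl (Or.inr hva)
          · exact Or.inr (Finset.mem_coe.2
              (Finset.mem_filter.2 ⟨Finset.mem_erase.2 ⟨hvp, hv⟩, hva⟩))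
        · exact Or.inl (Or.inr (mem_atomsBelow.1 hv))
      -- The relation `hT₀J` of the centre holds in `K` outright if `p ∈ U`, and after
      -- multiplication by `t` in any case. If `p ∈ T`, the factor `x_p` provides that `t`;
      -- otherwise the part divisible by `t` is split off, and the constant part is a relation for
      -- `U` itself.
      by_cases hpU : p ∈ U
      · refine Ideal.mem_of_dvd _ hdvd ?_
        rw [hθ]
        exact Ideal.mul_mem_right _ _ (hKp hpU hT₀J)
      by_cases hpT : p ∈ T
      · rw [← Finset.mul_prod_erase _ _ hpT, map_mul, blowupHom_X, if_pos rfl, hθ, ← mul_assoc]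
        exact Ideal.mul_mem_right _ _ (hKJ _ (Ideal.mem_map_of_mem _ hT₀J))
      · have hpV : p ∉ U ∪ ↑T := fun h => h.elim hpU hpT
        have hTe : T.erase p = T := Finset.erase_eq_of_notMem hpT
        have hI₀ : ∏ t ∈ T, X t ∈ nestedIdeal (H.erase p) (U \ {p}) := by
          refine prod_mem_nestedIdeal (hTe ▸ Finset.erase_subset_erase p hT) ?_
          rw [Set.sdiff_singleton_eq_self hpU]
          exact h1 hpV
        rw [← hTe, hθ]
        obtain ⟨q, hq⟩ := dvd_prod_sub_prod B
          (fun b => (Polynomial.C (X b : MvPolynomial L ℚ) - Polynomial.X))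
          (fun b => Polynomial.C (X b : MvPolynomial L ℚ)) Polynomial.X
          fun b => Dvd.intro (-1) (by ring)
        rw [sub_eq_iff_eq_add] at hq
        rw [hq, mul_add, ← map_prod, ← map_mul, ← mul_assoc, mul_comm _ Polynomial.X]
        refine Ideal.add_mem _ (Ideal.mul_mem_right _ _ (hKJ _ (Ideal.mem_map_of_mem _ hT₀J)))
          (hK₀ ?_)
        rw [hB, hT₀, ← prod_filter_split, hTe]
        exact hI₀
  · rw [Ideal.mem_comap, blowupHom_sum hH hp hpa ha]
    exact hK₀ (sum_mem_nestedIdeal ha)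

end

section

include hG hH hp hpa hmin

omit [IsUpperModularLattice L] in
/-- The relations of the blowup algebra hold in the local algebra after the blowup. -/
lemma blowup_ideal_le_comap_unblowupHom (hUH : U ⊆ H) (hUx : ∀ a, IsAtom a → a ≤ x₀ → a ∈ U)
    (hA : ∀ a ∈ A, IsAtom a) (hAp : x₀ ⊔ A.sup id = p) :
    (Ideal.span {Polynomial.X} * (nestedIdeal (H.erase p)
        (U \ {p} ∪ {a | IsAtom a ∧ a ≤ p})).map Polynomial.C ⊔ Ideal.span {atomPoly A} ≤
      (nestedIdeal H U).comap (unblowupHom p)) ∧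
    (p ∉ U → (nestedIdeal (H.erase p) (U \ {p})).map Polynomial.C ≤
      (nestedIdeal H U).comap (unblowupHom p)) ∧
    (p ∈ U → (nestedIdeal (H.erase p) (U \ {p} ∪ {a | IsAtom a ∧ a ≤ p})).map Polynomial.C ≤
      (nestedIdeal H U).comap (unblowupHom p)) := by
  have hW : U \ {p} ∪ {a | IsAtom a ∧ a ≤ p} ⊆ H :=
    Set.union_subset (Set.sdiff_subset.trans hUH) fun a ha => hH.atoms_mem a ha.1
  have hWU : ∀ w ∈ U \ {p} ∪ {a | IsAtom a ∧ a ≤ p}, w ∈ U ∨ IsAtom w ∧ w ≤ p :=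
    fun w hw => hw.imp (fun h => h.1) id
  refine ⟨sup_le ?_ ?_, fun hpU => ?_, fun hpU => ?_⟩
  · rw [Ideal.span_singleton_mul_le_iff]
    intro F hF
    rw [Ideal.mem_comap, map_mul, unblowupHom_X]
    rw [Ideal.mem_map_C_iff] at hF
    rw [F.as_sum_range_C_mul_X_pow, map_sum, Finset.mul_sum]
    refine Ideal.sum_mem _ fun i _ => ?_
    rw [map_mul, ← mul_assoc, unblowupHom_C]
    exact Ideal.mul_mem_right _ _ (pullbackHom_mem hG hH hp hpa hmin hW hWU (hF i)).1
  · rw [Ideal.span_singleton_le_iff_mem, Ideal.mem_comap]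
    -- Each `t - x_a` goes to `x_p - (x_a + x_p) = -x_a`. The product of the `x_a` is a relation,
    -- since `A` and the atoms below `x₀` join to `p ∈ H`.
    have h1 : unblowupHom p (atomPoly A) = (-1) ^ A.card * ∏ a ∈ A, X a := by
      rw [atomPoly, map_prod, ← Finset.prod_const, ← Finset.prod_mul_distrib]
      refine Finset.prod_congr rfl fun a ha => ?_
      have hap : a ≠ p := by rintro rfl; exact hpa (hA _ ha)
      have hle : a ≤ p := hAp ▸ (Finset.le_sup (f := id) ha).trans le_sup_right
      rw [map_sub, unblowupHom_X, unblowupHom_C, pullbackHom_X, if_neg hap, if_pos ⟨hA a ha, hle⟩]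
      ring
    rw [h1]
    refine Ideal.mul_mem_left _ _ (prod_mem_nestedIdeal (fun a ha => hH.atoms_mem a (hA a ha))
      fun h => ?_)
    have hs : (atomsBelow x₀ ∪ A).sup id = p := by rw [Finset.sup_union, sup_atomsBelow, hAp]
    have := h (atomsBelow x₀ ∪ A) ?_ (hs.symm ▸ hp)
    · rw [hs] at this
      rcases Finset.mem_union.1 this with h | h
      · exact hpa (mem_atomsBelow.1 h).1
      · exact hpa (hA _ h)
    · intro e he
      rcases Finset.mem_union.1 he with h | h
      · exact Or.inl (hUx e (mem_atomsBelow.1 h).1 (mem_atomsBelow.1 h).2)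
      · exact Or.inr h
  · rw [Ideal.map_le_iff_le_comap]
    intro f hf
    rw [Ideal.mem_comap, Ideal.mem_comap, unblowupHom_C]
    rw [Set.sdiff_singleton_eq_self hpU] at hf
    exact (pullbackHom_mem hG hH hp hpa hmin hUH (fun w hw => Or.inl hw) hf).2 (Or.inr le_rfl)
  · rw [Ideal.map_le_iff_le_comap]
    intro f hf
    rw [Ideal.mem_comap, Ideal.mem_comap, unblowupHom_C]
    exact (pullbackHom_mem hG hH hp hpa hmin hW hWU hf).2 (Or.inl hpU)

end

end BlowupRelations

/-! ## Dualising functionals -/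

section Duality

open MvPolynomial
open scoped Polynomial Classical

variable {L : Type u} [Lattice L] [BoundedOrder L]

/-- The pairs that describe the elements of the blowup that do not lie over `⊤`. -/
structure IsLocalPair (H S : Finset L) (x : L) : Prop extends IsNestedPair H S x where
  top_notMem : ⊤ ∉ S
  ne_top : x ≠ ⊤

/-- The join of everything below `g` in the support of the pair `(S, x)`. -/
noncomputable def lowerJoin (S : Finset L) (x g : L) : L := {s ∈ S | s < g}.sup id ⊔ x ⊓ g

/-- The monomial of top degree. -/
noncomputable def topMonomial (S : Finset L) (x : L) : MvPolynomial L ℚ :=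
  ∏ g ∈ insert ⊤ S, (-X g) ^ (intervalRank (lowerJoin S x g) g - 1)

/-- `φ` is a dualising functional, homogeneous of degree `n`, for the local algebra at `(S, x)`. -/
structure IsDualizing (n : ℕ) (H S : Finset L) (x : L) (φ : MvPolynomial L ℚ →ₗ[ℚ] ℚ) : Prop where
  annIdeal_eq : annIdeal φ = nestedIdeal H (pairSupp S x)
  homogeneous : IsHomogeneousFunctional φ n
  topMonomial_ne_zero : φ (topMonomial S x) ≠ 0
  prod_notMem : ∀ B : Finset L, (∀ b ∈ B, IsAtom b) → IsLocalPair H S (x ⊔ B.sup id) →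
    latticeRank (x ⊔ B.sup id) = latticeRank x + B.card →
    ∏ b ∈ B, X b ∉ nestedIdeal H (pairSupp S x)

variable {G H : Finset L} (hG : IsBuildingSet G) (hH : IsPartialBuildingSet G H)
  {p : L} (hp : p ∈ H) (hpa : ¬ IsAtom p) (hmin : ∀ h ∈ H, ¬ IsAtom h → h ≤ p → h = p)
  {S : Finset L} {x : L}

lemma pairSupp_insert :
    pairSupp (insert p S) x = insert p (pairSupp S x) := by
  ext u
  simp [pairSupp, or_assoc]

section

include hG hH

/-- A variant of `JoinNested.erase_of_atoms` in which `p` is represented in `W` by atoms `Z` with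
join `p`. Thus `p` need only belong to `G`, and no minimality is involved. -/
lemma JoinNested.of_atoms_sup (hpG : p ∈ G) {V W : Set L} {Z : Finset L} (hW : JoinNested H W)
    (hZW : ↑Z ⊆ W) (hZ : ∀ z ∈ Z, IsAtom z) (hZp : Z.sup id = p) (hVH : V ⊆ H)
    (hV : ∀ v ∈ V, v ∈ W ∨ IsAtom v ∧ v ≤ p) : JoinNested H V := by
  intro E hE hEH
  by_contra hn
  have hja := hH.not_isAtom_sup hG (fun e he => hVH (hE he)) hEH hn
  by_cases hex : ∃ a ∈ E, IsAtom a ∧ a ≤ p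
  · obtain ⟨a, haE, ha, hap⟩ := hex
    have hsup : (Z ∪ E.filter fun e => ¬ (IsAtom e ∧ e ≤ p)).sup id = p ⊔ E.sup id := by
      rw [Finset.sup_union, hZp]
      refine le_antisymm (sup_le_sup_left (Finset.sup_mono (Finset.filter_subset _ _)) _)
        (sup_le le_sup_left (Finset.sup_le fun e he => ?_))
      by_cases h : IsAtom e ∧ e ≤ p
      · exact h.2.trans le_sup_left
      · exact (Finset.le_sup (f := id) (Finset.mem_filter.2 ⟨he, h⟩)).trans le_sup_right
    have hmem : p ⊔ E.sup id ∈ H :=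
      hH.sup_mem hG hpG hEH hja ha hap (Finset.le_sup (f := id) haE)
    have hin := hW (Z ∪ E.filter fun e => ¬ (IsAtom e ∧ e ≤ p)) ?_ (hsup.symm ▸ hmem)
    · rw [hsup] at hin
      rcases Finset.mem_union.1 hin with h | h
      · exact (hH.filter _ hEH hja _ (hH.subset hmem) le_sup_right).2 (hZ _ h)
      · have h1 := (Finset.mem_filter.1 h).1
        have h2 : E.sup id = p ⊔ E.sup id := le_antisymm le_sup_right (Finset.le_sup (f := id) h1)
        exact hn (h2 ▸ h1)
    · intro e he
      rcases Finset.mem_union.1 he with h | h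
      · exact hZW h
      · obtain ⟨h1, h2⟩ := Finset.mem_filter.1 h
        exact (hV e (hE h1)).resolve_right h2
  · push Not at hex
    exact hn (hW E (fun e he => (hV e (hE he)).resolve_right fun h => hex e he h.1 h.2) hEH)

/-- The atoms in `A`, with those of `V`, already span `p`, so after multiplication by their product
all other atoms below `p` may be adjoined to the support. Multiplication by the class of the centre
therefore factors through the algebra of the centre. -/
lemma prod_mul_mem_nestedIdeal (hpG : p ∈ G) {V W : Set L} {A Z : Finset L}
    (hA : ∀ a ∈ A, IsAtom a) (hZ : ∀ z ∈ Z, IsAtom z) (hZV : ↑Z ⊆ V ∪ A) (hZp : Z.sup id = p)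
    (hWH : W ⊆ H) (hW : ∀ w ∈ W, w ∈ V ∨ IsAtom w ∧ w ≤ p) {f : MvPolynomial L ℚ}
    (hf : f ∈ nestedIdeal H W) : (∏ a ∈ A, X a) * f ∈ nestedIdeal H V := by
  have key : nestedIdeal H W ≤ (nestedIdeal H V).colon {∏ a ∈ A, X a} := by
    refine nestedIdeal_le (fun g hg => ?_) (fun T hT hn => ?_) fun a ha => ?_ <;>
      rw [Submodule.mem_colon_singleton, smul_eq_mul]
    · exact Ideal.mul_mem_right _ _ (X_mem_nestedIdeal hg)
    · have h1 : ∏ t ∈ T ∪ A, X t ∈ nestedIdeal H V := by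
        refine prod_mem_nestedIdeal (Finset.union_subset hT fun a ha => hH.atoms_mem a (hA a ha))
          fun h => hn ?_
        refine h.of_atoms_sup hG hH hpG (fun z hz => ?_) hZ hZp ?_ ?_
        · exact (hZV hz).imp id fun h => Finset.mem_coe.2 (Finset.mem_union_right _ h)
        · exact Set.union_subset hWH (by exact_mod_cast hT)
        · rintro v (hv | hv)
          · exact (hW v hv).imp (fun h => Or.inl h) id
          · exact Or.inl (Or.inr (Finset.mem_coe.2 (Finset.mem_union_left _ hv)))
      rw [← Finset.prod_union_inter]
      exact Ideal.mul_mem_right _ _ h1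
    · exact Ideal.mul_mem_right _ _ (sum_mem_nestedIdeal ha)
  have := key hf
  rwa [Submodule.mem_colon_singleton, smul_eq_mul, mul_comm] at this

end

section Degenerate

include hG hH hp hpa hmin

/-- If `p` is incompatible with `(S, x)`, the variable `x_p` is a relation on both sides, and no
other relation is lost on erasing `p`: the centre does not meet this local algebra. -/
lemma nestedIdeal_erase_eq (h : IsNestedPair H S x)
    (hn : ¬ JoinNested H (insert p (pairSupp S x))) (hpS : p ∉ S) :
    nestedIdeal H (pairSupp S x) = nestedIdeal (H.erase p) (pairSupp S x) := by
  have hUH : pairSupp S x ⊆ H := by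
    rintro v (hv | hv)
    exacts [h.subset hv, hH.atoms_mem v hv.1]
  have hpU : p ∉ pairSupp S x := fun h => h.elim hpS fun h => hpa h.1
  have hsum : ∀ (a : L), (∑ h ∈ H with a ≤ h, (X h : MvPolynomial L ℚ)) =
      (if a ≤ p then X p else 0) + ∑ h ∈ H.erase p with a ≤ h, X h := by
    intro a
    rw [Finset.sum_filter, Finset.sum_filter, Finset.add_sum_erase _ (fun h => if a ≤ h then
      (X h : MvPolynomial L ℚ) else 0) hp]
  have hp1 : X p ∈ nestedIdeal H (pairSupp S x) := by
    have := prod_mem_nestedIdeal (H := H) (U := pairSupp S x) (T := {p}) (by simpa using hp)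
      (by rwa [Finset.coe_singleton, Set.union_singleton])
    simpa using this
  have hp2 : X p ∈ nestedIdeal (H.erase p) (pairSupp S x) :=
    X_mem_nestedIdeal (Finset.notMem_erase p H)
  refine le_antisymm (nestedIdeal_le (fun g hg => ?_) (fun T hT hT' => ?_) fun a ha => ?_)
    (nestedIdeal_le (fun g hg => ?_) (fun T hT hT' => ?_) fun a ha => ?_)
  · exact X_mem_nestedIdeal fun h => hg (Finset.mem_of_mem_erase h)
  · by_cases hpT : p ∈ T
    · exact Ideal.mem_of_dvd _ (Finset.dvd_prod_of_mem _ hpT) hp2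
    · have hpV : p ∉ pairSupp S x ∪ ↑T := fun h => h.elim hpU hpT
      refine prod_mem_nestedIdeal (fun t ht => Finset.mem_erase.2 ⟨by rintro rfl; exact hpT ht,
        hT ht⟩) ?_
      rcases exists_atoms_or_not_joinNested_erase hG hH hpa hmin
        (Set.union_subset hUH (by exact_mod_cast hT)) hT' with ⟨E, hE, hEa, hEs⟩ | ⟨h1, -⟩
      -- Here the atoms `E` of the support and of `T` join to `p`. Substituting `E` for `p` in the
      -- failure `hn` gives the failure needed after erasure; the other alternative would put `p`
      -- below `x`.
      · rcases exists_atoms_or_not_joinNested_erase hG hH hpa hmin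
          (Set.insert_subset hp hUH) hn with ⟨E₁, hE₁, hEa₁, hEs₁⟩ | ⟨-, h2⟩
        · refine absurd (hEs₁ ▸ Finset.sup_le fun e he => ?_) (h.not_le p hp hpa)
          rcases hE₁ he with rfl | he' | he'
          · exact absurd (hEa₁ _ he).1 hpa
          · exact absurd (hEa₁ _ he).1 (h.not_isAtom _ he')
          · exact he'.2
        · refine fun h3 => h2 E (fun e he => (hEa e he).1) hEs (h3.mono ?_)
          rintro v (⟨hv | hv, hvp⟩ | hv)
          · exact absurd hv hvp
          · exact Or.inl hv
          · exact hE hv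
      · exact h1 hpV
  · rw [hsum]
    refine Ideal.add_mem _ ?_ (sum_mem_nestedIdeal ha)
    split_ifs
    exacts [hp2, Ideal.zero_mem _]
  · by_cases hgp : g = p
    · rwa [hgp]
    · exact X_mem_nestedIdeal fun h => hg (Finset.mem_erase.2 ⟨hgp, h⟩)
  · exact prod_mem_nestedIdeal (hT.trans (Finset.erase_subset _ _)) fun h =>
      hT' (h.anti (Finset.erase_subset _ _))
  · have h1 := sum_mem_nestedIdeal (H := H) (U := pairSupp S x) ha
    rw [hsum] at h1
    refine (Ideal.add_mem_iff_right _ ?_).1 h1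
    split_ifs
    exacts [hp1, Ideal.zero_mem _]

end Degenerate

section TopMonomial

include hG hH hp hpa hmin in
-- By nestedness, either `p < g` or `p` and `g` share no atom. So `p` contributes to the left side
-- as a member of the nested set exactly when it contributes to the right side through `p ⊔ x`.
lemma lowerJoin_insert [Finite L] [IsAtomistic L] (hpf : p ∈ latticeFactors G (p ⊔ x))
    (hn : JoinNested H (insert p (pairSupp S x))) (hSH : S ⊆ H) (hSa : ∀ s ∈ S, ¬ IsAtom s)
    (hpS : p ∉ S) (hpt : p ≠ ⊤) {g : L} (hg : g ∈ insert ⊤ S) :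
    lowerJoin (insert p S) x g = lowerJoin S (p ⊔ x) g := by
  have hshare : ∀ a, IsAtom a → a ≤ p → a ≤ g → p < g := by
    intro a ha hap hag
    rcases Finset.mem_insert.1 hg with rfl | hgS
    · exact lt_top_iff_ne_top.2 hpt
    · have hgp : g ≠ p := by rintro rfl; exact hpS hgS
      have hmem : p ⊔ g ∈ H :=
        hH.sup_mem hG (hH.subset hp) (hSH hgS) (hSa g hgS) ha hap hag
      have hs : ({p, g} : Finset L).sup id = p ⊔ g := by simp
      have := hn {p, g} ?_ (hs.symm ▸ hmem)
      · rw [hs, Finset.mem_insert, Finset.mem_singleton] at this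
        rcases this with h | h
        · exact absurd (hmin g (hSH hgS) (hSa g hgS) (sup_eq_left.1 h)) hgp
        · exact lt_of_le_of_ne (sup_eq_right.1 h) hgp.symm
      · intro e he
        rcases Finset.mem_insert.1 he with rfl | he
        · exact Or.inl rfl
        · rw [Finset.mem_singleton.1 he]
          exact Or.inr (Or.inl hgS)
  unfold lowerJoin
  rw [Finset.filter_insert]
  apply le_antisymm
  · refine sup_le ?_ ((inf_le_inf_right _ le_sup_right).trans le_sup_right)
    split_ifs with h
    · rw [Finset.sup_insert]
      exact sup_le ((le_inf le_sup_left h.le).trans le_sup_right) le_sup_left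
    · exact le_sup_left
  · refine sup_le ?_ ?_
    · refine le_sup_of_le_left (Finset.sup_mono ?_)
      split_ifs
      exacts [Finset.subset_insert _ _, le_rfl]
    · rw [← sup_atomsBelow ((p ⊔ x) ⊓ g)]
      refine Finset.sup_le fun a ha => ?_
      obtain ⟨ha, hle⟩ := mem_atomsBelow.1 ha
      have hag := hle.trans inf_le_right
      rcases hG.le_or_le_of_isAtom hH hpf ha (hle.trans inf_le_left) with h | h
      · rw [if_pos (hshare a ha h hag), Finset.sup_insert]
        exact h.trans (le_sup_left.trans le_sup_left)
      · exact (le_inf h hag).trans le_sup_right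

include hmin in
lemma lowerJoin_insert_self (hSH : S ⊆ H) (hSa : ∀ s ∈ S, ¬ IsAtom s) :
    lowerJoin (insert p S) x p = x ⊓ p := by
  have : (insert p S).filter (· < p) = ∅ := by
    refine Finset.filter_eq_empty_iff.2 fun s hs hlt => ?_
    rcases Finset.mem_insert.1 hs with rfl | hs
    · exact lt_irrefl _ hlt
    · exact hlt.ne (hmin s (hSH hs) (hSa s hs) hlt.le)
  rw [lowerJoin, this, Finset.sup_empty, bot_sup_eq]

include hG hH hp hpa hmin in
-- The exponent of `x_p` is one less than the degree of the bundle polynomial `P`, which is what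
-- `topCoeff P` extracts.
lemma topMonomial_insert [Finite L] [IsAtomistic L] (hpf : p ∈ latticeFactors G (p ⊔ x))
    (hn : JoinNested H (insert p (pairSupp S x))) (hSH : S ⊆ H) (hSa : ∀ s ∈ S, ¬ IsAtom s)
    (hpS : p ∉ S) (hpt : p ≠ ⊤) :
    topMonomial (insert p S) x =
      (-X p) ^ (latticeRank p - latticeRank (x ⊓ p) - 1) * topMonomial S (p ⊔ x) := by
  rw [topMonomial, Finset.insert_comm, Finset.prod_insert, lowerJoin_insert_self hmin hSH hSa,
    topMonomial, intervalRank]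
  · congr 1
    exact Finset.prod_congr rfl fun g hg => by
      rw [lowerJoin_insert hG hH hp hpa hmin hpf hn hSH hSa hpS hpt hg]
  · simp [hpt, hpS]

lemma blowupHom_topMonomial (hpS : p ∉ S) (hpt : p ≠ ⊤) (hpa : ¬ IsAtom p) (hp0 : p ≠ ⊥)
    (hSa : ∀ s ∈ S, ¬ IsAtom s) (x : L) :
    blowupHom p (topMonomial S x) = Polynomial.C (topMonomial S x) := by
  rw [topMonomial, map_prod, map_prod]
  refine Finset.prod_congr rfl fun g hg => ?_
  have hgp : g ≠ p := by
    rintro rfl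
    exact (Finset.mem_insert.1 hg).elim hpt hpS
  have hga : ¬ IsAtom g := by
    rcases Finset.mem_insert.1 hg with rfl | hg
    · intro ht
      rcases ht.le_iff.1 (le_top : p ≤ ⊤) with h | h
      exacts [hp0 h, hpt h]
    · exact hSa g hg
  rw [map_pow, map_pow, map_neg, map_neg, blowupHom_X, if_neg hgp, if_neg fun h => hga h.1]

end TopMonomial

end Duality

/-! ### The induction step: blowup and bundle cases -/

section DualityStep

open MvPolynomial
open scoped Polynomial Classical

lemma coeff_zero_mem_annIdeal {A : Type*} [CommRing A] [Algebra ℚ A] {P : A[X]} (hP : P.Monic)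
    {φ ψ : A →ₗ[ℚ] ℚ} {F : A[X]} (hF : F ∈ annIdeal (blowupFunctional P φ ψ))
    (hdeg : F.natDegree < P.natDegree) : F.coeff 0 ∈ annIdeal φ := fun b => by
  have := hF (Polynomial.C b)
  rwa [blowupFunctional_of_natDegree_lt hP, Polynomial.coeff_mul_C] at this
  exact (Polynomial.natDegree_mul_C_le _ _).trans_lt hdeg

lemma coeff_mem_annIdeal {A : Type*} [CommRing A] [Algebra ℚ A] {P : A[X]} (hP : P.Monic)
    {ψ : A →ₗ[ℚ] ℚ} {F : A[X]} (hF : F ∈ annIdeal (bundleFunctional P ψ))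
    (hdeg : F.natDegree < P.natDegree) (i : ℕ) : F.coeff i ∈ annIdeal ψ :=
  coeff_mem_of_topCoeff_mem hP hdeg (fun _ => topCoeff_mem_of_mem_annIdeal ψ hF _) i

lemma neg_one_pow_mul_self {R : Type*} [CommRing R] (n : ℕ) : ((-1) ^ n * (-1) ^ n : R) = 1 := by
  rw [← mul_pow, neg_mul_neg, one_mul, one_pow]

lemma neg_pow_eq {R : Type*} [CommRing R] (a : R) (n : ℕ) : (-a) ^ n = (-1) ^ n * a ^ n :=
  neg_pow a n

variable {L : Type u} [Lattice L] [BoundedOrder L]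

lemma blowupHom_doubleHom (p : L) (f : MvPolynomial L ℚ) :
    blowupHom p (doubleHom L f) =
      scaleHom (doubleHom L : MvPolynomial L ℚ →+* MvPolynomial L ℚ) (blowupHom p f) := by
  have : (blowupHom p : MvPolynomial L ℚ →+* (MvPolynomial L ℚ)[X]).comp
      (doubleHom L : MvPolynomial L ℚ →+* MvPolynomial L ℚ) =
      (scaleHom (doubleHom L : MvPolynomial L ℚ →+* MvPolynomial L ℚ)).comp
        (blowupHom p : MvPolynomial L ℚ →+* (MvPolynomial L ℚ)[X]) := by
    have hC2 : (Polynomial.C 2 : (MvPolynomial L ℚ)[X]) = 2 := Polynomial.C_ofNat 2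
    refine MvPolynomial.ringHom_ext (fun r => ?_) fun g => ?_
    · simp only [RingHom.comp_apply, RingHom.coe_coe]
      rw [← algebraMap_eq, AlgHom.commutes, AlgHom.commutes, Polynomial.algebraMap_apply,
        scaleHom_C, RingHom.coe_coe, AlgHom.commutes]
    · simp only [RingHom.comp_apply, RingHom.coe_coe, doubleHom_X, map_mul, map_ofNat,
        blowupHom_X]
      split_ifs
      · rw [scaleHom_X]
      · rw [map_sub, scaleHom_X, scaleHom_C, RingHom.coe_coe, doubleHom_X, map_mul, hC2, mul_sub]
      · rw [scaleHom_C, RingHom.coe_coe, doubleHom_X, map_mul, hC2]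
  exact congrArg (fun φ => φ f) this

variable {G H : Finset L} (hG : IsBuildingSet G) (hH : IsPartialBuildingSet G H)
  {p : L} (hp : p ∈ H) (hpa : ¬ IsAtom p) (hmin : ∀ h ∈ H, ¬ IsAtom h → h ≤ p → h = p)
  {S : Finset L} {x : L}

lemma IsLocalPair.of_erase (h : IsLocalPair H S x) (hpS : p ∉ S) :
    IsLocalPair (H.erase p) S x := by
  have := h.toIsNestedPair.erase (p := p)
  rw [Finset.erase_eq_of_notMem hpS] at this
  exact ⟨this, h.top_notMem, h.ne_top⟩

lemma sup_inf_factor_finset_le (hG : IsBuildingSet G) {w : L} (hpf : p ∈ latticeFactors G w)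
    {B : Finset L} (hB : ∀ b ∈ B, IsAtom b) (hw : x ⊔ B.sup id ≤ w) :
    (x ⊔ B.sup id) ⊓ p ≤ x ⊓ p ⊔ (B.filter (· ≤ p)).sup id := by
  induction B using Finset.induction_on with
  | empty => simp
  | insert b B hb ih =>
    have hbw : b ≤ w := (Finset.le_sup (f := id) (Finset.mem_insert_self b B)).trans
      (le_sup_right.trans hw)
    have hBw : x ⊔ B.sup id ≤ w :=
      (sup_le_sup_left (Finset.sup_mono (Finset.subset_insert _ _)) _).trans hw
    rw [Finset.sup_insert, id, sup_comm b, ← sup_assoc, hG.sup_inf_factor hpf hBw hbw]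
    refine sup_le ((ih (fun c hc => hB c (Finset.mem_insert_of_mem hc)) hBw).trans
      (sup_le_sup_left (Finset.sup_mono (Finset.filter_subset_filter _
        (Finset.subset_insert _ _))) _)) ?_
    rcases (hB b (Finset.mem_insert_self b B)).le_iff.1 (inf_le_left : b ⊓ p ≤ b) with h | h
    · rw [h]; exact bot_le
    · have hmem : b ∈ (insert b B).filter (· ≤ p) :=
        Finset.mem_filter.2 ⟨Finset.mem_insert_self b B, inf_eq_left.1 h⟩
      exact inf_le_left.trans ((Finset.le_sup (f := id) hmem).trans le_sup_right)

variable [Finite L] [IsAtomistic L] [IsUpperModularLattice L]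

section

omit [Finite L] [IsAtomistic L] [IsUpperModularLattice L] in
include hG hH in
lemma pairSupp_sup_eq (hpf : p ∈ latticeFactors G (p ⊔ x)) :
    pairSupp S (p ⊔ x) = pairSupp S x ∪ {a | IsAtom a ∧ a ≤ p} := by
  ext u
  constructor
  · rintro (h | ⟨h1, h2⟩)
    · exact Or.inl (Or.inl h)
    · rcases hG.le_or_le_of_isAtom hH hpf h1 h2 with h3 | h3
      exacts [Or.inr ⟨h1, h3⟩, Or.inl (Or.inr ⟨h1, h3⟩)]
  · rintro ((h | h) | h)
    exacts [Or.inl h, Or.inr ⟨h.1, h.2.trans le_sup_right⟩, Or.inr ⟨h.1, h.2.trans le_sup_left⟩]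

omit [IsAtomistic L] in
-- Otherwise the members of `B` below `p` would span `p` over `x ⊓ p`, putting `p` below `x ⊔ B.sup
-- id`. The inequality keeps the degree in `t` of the transformed product below that of `P`.
lemma card_filter_lt {A B : Finset L} (hAr : latticeRank p = latticeRank (x ⊓ p) + A.card)
    (hB : ∀ b ∈ B, IsAtom b) (hBr : latticeRank (x ⊔ B.sup id) = latticeRank x + B.card)
    (hpB : ¬ p ≤ x ⊔ B.sup id) : (B.filter fun b => IsAtom b ∧ b ≤ p).card < A.card := by
  have h1 := latticeRank_sup_of_subset (inf_le_left : x ⊓ p ≤ x) hB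
    (Finset.filter_subset (fun b => IsAtom b ∧ b ≤ p) B) hBr
  have hle : x ⊓ p ⊔ (B.filter fun b => IsAtom b ∧ b ≤ p).sup id ≤ p :=
    sup_le inf_le_right (Finset.sup_le fun b hb => (Finset.mem_filter.1 hb).2.2)
  by_contra hcon
  have h2 := eq_of_le_of_latticeRank_le hle (by omega)
  refine hpB ?_
  conv_lhs => rw [← h2]
  exact sup_le_sup inf_le_left (Finset.sup_mono (Finset.filter_subset _ _))

include hG hH hp hpa hmin

/-- The data of the blowup of the local algebra at `(S, x)` along the one at `(S, p ⊔ x)`. -/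
lemma exists_blowup_data (hx : IsLocalPair (H.erase p) S x)
    (hz : IsLocalPair (H.erase p) S (p ⊔ x)) (hpx : ¬ p ≤ x) {n m : ℕ}
    {φ ψ : MvPolynomial L ℚ →ₗ[ℚ] ℚ} (hφ : IsDualizing n (H.erase p) S x φ)
    (hψ : IsDualizing m (H.erase p) S (p ⊔ x) ψ)
    (hnm : n + latticeRank x = m + latticeRank (p ⊔ x)) :
    ∃ A : Finset L, (∀ a ∈ A, IsAtom a) ∧ x ⊓ p ⊔ A.sup id = p ∧
      latticeRank p = latticeRank (x ⊓ p) + A.card ∧ 0 < A.card ∧ n = m + A.card ∧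
      ∃ k : ℚ, k ≠ 0 ∧
        φ.comp (LinearMap.mulLeft ℚ ((atomPoly A).coeff 0)) = k • ψ := by
  have hpf : p ∈ latticeFactors G (p ⊔ x) :=
    mem_latticeFactors_of_erase hH hp hpa le_sup_left hz.not_le
  obtain ⟨A, hA', hAp, hAr⟩ := exists_basis_subset (x := x ⊓ p) (p := p) inf_le_right
    (B := atomsBelow p) (fun b hb => (mem_atomsBelow.1 hb).1)
    (by rw [sup_atomsBelow, sup_eq_right.2 inf_le_right])
  have hA : ∀ a ∈ A, IsAtom a := fun a ha => (mem_atomsBelow.1 (hA' ha)).1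
  have hAle : A.sup id ≤ p := Finset.sup_le fun a ha => (mem_atomsBelow.1 (hA' ha)).2
  have hrk := latticeRank_sup_of_factor hG hpf
  rw [inf_comm] at hrk
  have hc : 0 < A.card := by
    have : latticeRank (x ⊓ p) < latticeRank p :=
      latticeRank_strictMono (lt_of_le_of_ne inf_le_right fun h => hpx (inf_eq_right.1 h))
    omega
  have hxA : x ⊔ A.sup id = p ⊔ x := by
    refine le_antisymm (sup_le le_sup_right (hAle.trans le_sup_left)) (sup_le ?_ le_sup_left)
    conv_lhs => rw [← hAp]
    exact sup_le_sup_right inf_le_left _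
  have hn : n = m + A.card := by omega
  refine ⟨A, hA, hAp, hAr, hc, hn, ?_⟩
  have hP0 := coeff_zero_atomPoly A
  have hhom : ((atomPoly A).coeff 0).IsHomogeneous A.card := by
    rw [hP0]
    have h1 : (∏ a ∈ A, X a : MvPolynomial L ℚ).IsHomogeneous (∑ _a ∈ A, 1) :=
      IsHomogeneous.prod A _ _ fun a _ => isHomogeneous_X ℚ a
    rw [← Finset.card_eq_sum_ones] at h1
    have h2 : ((-1) ^ A.card * ∏ a ∈ A, X a : MvPolynomial L ℚ) =
        C ((-1) ^ A.card) * ∏ a ∈ A, X a := by simp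
    rw [h2]
    simpa using (isHomogeneous_C L ((-1) ^ A.card : ℚ)).mul h1
  have hle : annIdeal ψ ≤ annIdeal (φ.comp (LinearMap.mulLeft ℚ ((atomPoly A).coeff 0))) := by
    intro f hf g
    rw [hψ.annIdeal_eq, pairSupp_sup_eq hG hH hpf] at hf
    have h1 := prod_mul_mem_nestedIdeal hG (hH.erase hpa hmin) (hH.subset hp)
      (V := pairSupp S x) (A := A) (Z := atomsBelow (x ⊓ p) ∪ A) hA (fun z hz => ?_)
      (fun z hz => ?_) (by rw [Finset.sup_union, sup_atomsBelow, hAp]) ?_ (fun w hw => hw) hf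
    · have h2 : (atomPoly A).coeff 0 * f ∈ annIdeal φ := by
        rw [hP0, mul_assoc, hφ.annIdeal_eq]
        exact Ideal.mul_mem_left _ _ h1
      simpa [mul_assoc] using h2 g
    · rcases Finset.mem_union.1 hz with h | h
      exacts [(mem_atomsBelow.1 h).1, hA z h]
    · rcases Finset.mem_union.1 hz with h | h
      · exact Or.inl (Or.inr ⟨(mem_atomsBelow.1 h).1,
          (mem_atomsBelow.1 h).2.trans inf_le_left⟩)
      · exact Or.inr h
    · rintro v ((hv | hv) | hv)
      exacts [hx.subset hv, (hH.erase hpa hmin).atoms_mem v hv.1,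
        (hH.erase hpa hmin).atoms_mem v hv.1]
  -- Both functionals are homogeneous of degree `m`, and by `hle` the annihilator of one contains
  -- that of the other, so they are proportional. The factor is nonzero because the product over `A`
  -- is not a relation.
  obtain ⟨k, hk⟩ := hψ.homogeneous.exists_smul
    (IsHomogeneousFunctional.comp_mulLeft (hn ▸ hφ.homogeneous) hhom) hψ.topMonomial_ne_zero hle
  refine ⟨k, ?_, hk⟩
  rintro rfl
  refine hφ.prod_notMem A hA (hxA ▸ hz) (by rw [hxA]; omega) ?_
  rw [← hφ.annIdeal_eq]
  intro g
  have h1 := congrArg (fun f => f ((-1) ^ A.card * g)) hk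
  simp only [LinearMap.comp_apply, LinearMap.mulLeft_apply, zero_smul, LinearMap.zero_apply,
    hP0] at h1
  have h2 : (-1) ^ A.card * (∏ a ∈ A, X a : MvPolynomial L ℚ) * ((-1) ^ A.card * g) =
      (∏ a ∈ A, X a) * g := by
    linear_combination (∏ a ∈ A, X a) * g * neg_one_pow_mul_self (R := MvPolynomial L ℚ) A.card
  rwa [h2] at h1

/-- The functional is `blowupFunctional`, composed with the substitution. It is built from the
multiple `ψ'` of `ψ`, for which the compatibility with `φ` holds by definition. The top monomial is
constant in `t`, so its value is the one under `φ`. -/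
lemma exists_isDualizing_blowup (hpt : p ≠ ⊤) (hx : IsLocalPair H S x) (hpS : p ∉ S)
    (hz : IsLocalPair (H.erase p) S (p ⊔ x)) {n m : ℕ}
    {φ ψ : MvPolynomial L ℚ →ₗ[ℚ] ℚ} (hφ : IsDualizing n (H.erase p) S x φ)
    (hψ : IsDualizing m (H.erase p) S (p ⊔ x) ψ)
    (hnm : n + latticeRank x = m + latticeRank (p ⊔ x)) :
    ∃ Φ, IsDualizing n H S x Φ := by
  have hpx : ¬ p ≤ x := hx.not_le p hp hpa
  have hpf : p ∈ latticeFactors G (p ⊔ x) :=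
    mem_latticeFactors_of_erase hH hp hpa le_sup_left hz.not_le
  obtain ⟨A, hA, hAp, hAr, hc, hn, k, hk, hψ'⟩ :=
    exists_blowup_data hG hH hp hpa hmin (hx.of_erase hpS) hz hpx hφ hψ hnm
  have hU : pairSupp S x \ {p} = pairSupp S x :=
    Set.sdiff_singleton_eq_self fun h => h.elim hpS fun h => hpa h.1
  have hpU : p ∉ pairSupp S x := fun h => h.elim hpS fun h => hpa h.1
  have hUH : pairSupp S x ⊆ H := by
    rintro v (hv | hv)
    exacts [hx.subset hv, hH.atoms_mem v hv.1]
  have hUx : ∀ a, IsAtom a → a ≤ x ⊓ p → a ∈ pairSupp S x :=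
    fun a ha h => Or.inr ⟨ha, h.trans inf_le_left⟩
  have hxU : ∀ a ∈ pairSupp S x, IsAtom a → a ≤ p → a ≤ x ⊓ p := fun a ha haa hap =>
    le_inf (ha.elim (fun h => absurd haa (hx.not_isAtom a h)) fun h => h.2) hap
  set ψ' := φ.comp (LinearMap.mulLeft ℚ ((atomPoly A).coeff 0)) with hψdef
  have hP := atomPoly_monic A
  have hPd : 0 < (atomPoly A).natDegree := by rwa [natDegree_atomPoly]
  have hannψ : annIdeal ψ' = nestedIdeal (H.erase p)
      (pairSupp S x \ {p} ∪ {a | IsAtom a ∧ a ≤ p}) := by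
    rw [hψ', annIdeal_smul _ hk, hψ.annIdeal_eq, hU, pairSupp_sup_eq hG hH hpf]
  have hannφ : annIdeal φ = nestedIdeal (H.erase p) (pairSupp S x \ {p}) := by
    rw [hφ.annIdeal_eq, hU]
  have hann := annIdeal_blowupFunctional hP φ ψ' hPd fun a => rfl
  rw [hannψ, hannφ] at hann
  have hθ : nestedIdeal H (pairSupp S x) ≤
      (annIdeal (blowupFunctional (atomPoly A) φ ψ')).comap (blowupHom p) := by
    refine nestedIdeal_le_comap_blowupHom hG hH hp hpa hmin inf_le_right hUx ?_ ?_ hA hAp hAr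
      ?_ hUH hxU fun h => absurd h hpU
    · rw [hann, ← Ideal.map_le_iff_le_comap, sup_assoc]
      exact le_sup_left
    · intro F hF
      rw [hann]
      exact Ideal.mem_sup_left (Ideal.mem_sup_right
        (Ideal.mul_mem_mul (Ideal.mem_span_singleton_self _) hF))
    · rw [hann]
      exact Ideal.mem_sup_right (Ideal.mem_span_singleton_self _)
  obtain ⟨h1, h2, -⟩ := blowup_ideal_le_comap_unblowupHom hG hH hp hpa hmin hUH hUx hA hAp
  refine ⟨(blowupFunctional (atomPoly A) φ ψ').comp (blowupHom p).toLinearMap, ?_, ?_, ?_, ?_⟩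
  · refine annIdeal_comp (blowupHom p) (unblowupHom p) _ _ hθ ?_ (fun f => ?_) fun g => ?_
    · rw [hann, sup_assoc]
      exact sup_le (h2 hpU) h1
    · rw [unblowupHom_blowupHom, sub_self]
      exact Ideal.zero_mem _
    · refine blowupHom_unblowupHom ?_ g
      rw [hann, sup_assoc]
      exact Ideal.mem_sup_left (Ideal.mem_map_of_mem _
        (X_mem_nestedIdeal (Finset.notMem_erase p H)))
  · intro f
    simp only [LinearMap.comp_apply, AlgHom.toLinearMap_apply]
    rw [blowupHom_doubleHom]
    refine blowupFunctional_scaleHom hP φ ψ' hPd _ (scaleHom_atomPoly A) (n := m) (fun a => ?_)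
      hφ.homogeneous (by rw [natDegree_atomPoly, hn]) _
    rw [hψ']
    simp only [LinearMap.smul_apply, smul_eq_mul]
    have := hψ.homogeneous a
    rw [RingHom.coe_coe, this]
    ring
  · rw [LinearMap.comp_apply, AlgHom.toLinearMap_apply,
      blowupHom_topMonomial hpS hpt hpa (hH.ne_bot hG hp) hx.not_isAtom,
      blowupFunctional_of_natDegree_lt hP _ _ (by simpa using hPd), Polynomial.coeff_C_zero]
    exact hφ.topMonomial_ne_zero
  · intro B hB hBl hBr hmem
    have hpB : p ∉ B := fun h => hpa (hB p h)
    have h3 := hθ hmem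
    rw [Ideal.mem_comap, blowupHom_prod hpB, prod_C_sub_X] at h3
    -- The transformed product has degree in `t` below `deg P`, so its constant term, the product
    -- over `B`, would be a relation before the blowup.
    have h4 := coeff_zero_mem_annIdeal hP h3 ?_
    · rw [hφ.annIdeal_eq, Polynomial.mul_coeff_zero, Polynomial.coeff_C_zero,
        ← prod_C_sub_X, Polynomial.coeff_zero_prod] at h4
      simp only [Polynomial.coeff_sub, Polynomial.coeff_C_zero, Polynomial.coeff_X_zero,
        sub_zero] at h4
      rw [← prod_filter_split] at h4
      exact hφ.prod_notMem B hB (hBl.of_erase hpS) hBr h4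
    · rw [← prod_C_sub_X]
      refine lt_of_le_of_lt (Polynomial.natDegree_C_mul_le _ _) ?_
      refine lt_of_le_of_lt (Polynomial.natDegree_prod_le _ _) ?_
      rw [natDegree_atomPoly]
      refine lt_of_le_of_lt (Finset.sum_le_card_nsmul _ _ 1 fun b _ => ?_) ?_
      · exact (Polynomial.natDegree_sub_le _ _).trans (by simp)
      · rw [smul_eq_mul, mul_one]
        exact card_filter_lt hAr hB hBr (hBl.not_le p hp hpa)

/-- The functional is `bundleFunctional` over the centre, composed with the substitution. Its degree
is that of `ψ` plus `deg P - 1`, one less than the degree of `φ`, matching the extra element of the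
nested set. -/
lemma exists_isDualizing_bundle (hGt : ⊤ ∈ G) (hpt : p ≠ ⊤) (hx : IsLocalPair H (insert p S) x) (hpS : p ∉ S)
    (hz : IsLocalPair (H.erase p) S (p ⊔ x)) {n m : ℕ}
    {φ ψ : MvPolynomial L ℚ →ₗ[ℚ] ℚ} (hφ : IsDualizing (n + 1) (H.erase p) S x φ)
    (hψ : IsDualizing m (H.erase p) S (p ⊔ x) ψ)
    (hnm : n + 1 + latticeRank x = m + latticeRank (p ⊔ x)) :
    ∃ Φ, IsDualizing n H (insert p S) x Φ := by
  have hpx : ¬ p ≤ x := hx.not_le p hp hpa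
  have hSH : S ⊆ H := (Finset.subset_insert _ _).trans hx.subset
  have hSa : ∀ s ∈ S, ¬ IsAtom s := fun s hs => hx.not_isAtom s (Finset.mem_insert_of_mem hs)
  have hnest := hx.nested
  rw [pairSupp_insert] at hnest
  have hpf : p ∈ latticeFactors G (p ⊔ x) :=
    mem_latticeFactors_of_erase hH hp hpa le_sup_left hz.not_le
  have hx' : IsLocalPair (H.erase p) S x :=
    ⟨hz.toIsNestedPair.mono le_rfl le_sup_right, hz.top_notMem, hx.ne_top⟩
  obtain ⟨A, hA, hAp, hAr, hc, hn, k, hk, hψ'⟩ :=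
    exists_blowup_data hG hH hp hpa hmin hx' hz hpx hφ hψ hnm
  have hpU' : p ∉ pairSupp S x := fun h => h.elim hpS fun h => hpa h.1
  have hU : pairSupp (insert p S) x \ {p} = pairSupp S x := by
    rw [pairSupp_insert, Set.insert_sdiff_self_of_notMem hpU']
  have hpU : p ∈ pairSupp (insert p S) x := Or.inl (Finset.mem_insert_self _ _)
  have hUH : pairSupp (insert p S) x ⊆ H := by
    rintro v (hv | hv)
    exacts [hx.subset hv, hH.atoms_mem v hv.1]
  have hUx : ∀ a, IsAtom a → a ≤ x ⊓ p → a ∈ pairSupp (insert p S) x :=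
    fun a ha h => Or.inr ⟨ha, h.trans inf_le_left⟩
  have hxU : ∀ a ∈ pairSupp (insert p S) x, IsAtom a → a ≤ p → a ≤ x ⊓ p := fun a ha haa hap =>
    le_inf (ha.elim (fun h => absurd haa (hx.not_isAtom a h)) fun h => h.2) hap
  have hP := atomPoly_monic A
  have hPd : 0 < (atomPoly A).natDegree := by rwa [natDegree_atomPoly]
  have hannψ : annIdeal ψ = nestedIdeal (H.erase p)
      (pairSupp (insert p S) x \ {p} ∪ {a | IsAtom a ∧ a ≤ p}) := by
    rw [hψ.annIdeal_eq, hU, pairSupp_sup_eq hG hH hpf]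
  have hann := annIdeal_bundleFunctional hP ψ
  rw [hannψ] at hann
  have hJ : nestedIdeal (H.erase p) (pairSupp (insert p S) x \ {p} ∪ {a | IsAtom a ∧ a ≤ p}) ≤
      (annIdeal (bundleFunctional (atomPoly A) ψ)).comap Polynomial.C := by
    rw [hann, ← Ideal.map_le_iff_le_comap]
    exact le_sup_left
  have hθ : nestedIdeal H (pairSupp (insert p S) x) ≤
      (annIdeal (bundleFunctional (atomPoly A) ψ)).comap (blowupHom p) := by
    refine nestedIdeal_le_comap_blowupHom hG hH hp hpa hmin inf_le_right hUx ?_ ?_ hA hAp hAr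
      ?_ hUH hxU fun _ => hJ
    · exact (nestedIdeal_mono Set.subset_union_left).trans hJ
    · intro F hF
      rw [hann]
      exact Ideal.mem_sup_left (Ideal.mul_mem_left _ _ hF)
    · rw [hann]
      exact Ideal.mem_sup_right (Ideal.mem_span_singleton_self _)
  obtain ⟨h1, -, h2⟩ := blowup_ideal_le_comap_unblowupHom hG hH hp hpa hmin hUH hUx hA hAp
  refine ⟨(bundleFunctional (atomPoly A) ψ).comp (blowupHom p).toLinearMap, ?_, ?_, ?_, ?_⟩
  · refine annIdeal_comp (blowupHom p) (unblowupHom p) _ _ hθ ?_ (fun f => ?_) fun g => ?_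
    · rw [hann]
      exact sup_le (h2 hpU) (le_sup_right.trans h1)
    · rw [unblowupHom_blowupHom, sub_self]
      exact Ideal.zero_mem _
    · exact blowupHom_unblowupHom (hJ (X_mem_nestedIdeal (Finset.notMem_erase p H))) g
  · intro f
    simp only [LinearMap.comp_apply, AlgHom.toLinearMap_apply]
    rw [blowupHom_doubleHom]
    exact bundleFunctional_scaleHom hP ψ hPd _ (scaleHom_atomPoly A) hψ.homogeneous
      (by rw [natDegree_atomPoly, hn]) _
  · rw [LinearMap.comp_apply, AlgHom.toLinearMap_apply,
      topMonomial_insert hG hH hp hpa hmin hpf hnest hSH hSa hpS hpt, map_mul, map_pow, map_neg,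
      blowupHom_X, if_pos rfl, blowupHom_topMonomial hpS hpt hpa (hH.ne_bot hG hp) hSa,
      bundleFunctional_apply, mul_comm, ← Polynomial.smul_eq_C_mul, map_smul]
    have hcc : latticeRank p - latticeRank (x ⊓ p) - 1 = (atomPoly A).natDegree - 1 := by
      rw [natDegree_atomPoly]; omega
    rw [hcc, neg_pow_eq, topCoeff_of_natDegree_lt hP]
    · have h3 : ((-1) ^ ((atomPoly A).natDegree - 1) * Polynomial.X ^ ((atomPoly A).natDegree - 1) :
          (MvPolynomial L ℚ)[X]) = Polynomial.C (C ((-1) ^ ((atomPoly A).natDegree - 1))) *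
            Polynomial.X ^ ((atomPoly A).natDegree - 1) := by simp
      rw [h3, Polynomial.coeff_C_mul_X_pow, if_pos rfl, smul_eq_mul, mul_comm, ← smul_eq_C_mul,
        map_smul, smul_eq_mul]
      exact mul_ne_zero (pow_ne_zero _ (by norm_num)) hψ.topMonomial_ne_zero
    · refine lt_of_le_of_lt (Polynomial.natDegree_mul_le) ?_
      have h3 : ((-1) ^ ((atomPoly A).natDegree - 1) : (MvPolynomial L ℚ)[X]).natDegree = 0 := by
        rw [← Polynomial.C_1, ← Polynomial.C_neg, ← Polynomial.C_pow, Polynomial.natDegree_C]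
      rw [h3, zero_add]
      exact (Polynomial.natDegree_X_pow_le _).trans_lt (by omega)
  · intro B hB hBl hBr hmem
    have hpB : p ∉ B := fun h => hpa (hB p h)
    have h3 := hθ hmem
    set B₁ := B.filter fun b => IsAtom b ∧ b ≤ p with hB₁
    set B₂ := B.filter fun b => ¬ (IsAtom b ∧ b ≤ p) with hB₂
    have hlt : B₁.card < A.card :=
      card_filter_lt hAr hB hBr (hBl.not_le p hp hpa)
    rw [Ideal.mem_comap, blowupHom_prod hpB, prod_C_sub_X, mul_left_comm] at h3
    have h4 := Ideal.mul_mem_left _ ((-1) ^ B₁.card) h3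
    rw [← mul_assoc, neg_one_pow_mul_self, one_mul] at h4
    -- The leading coefficient in `t` is the product over `B₂`, the atoms of `B` not below `p`. It
    -- would be a relation of the centre, against `hψ.prod_notMem`.
    have h5 := coeff_mem_annIdeal hP h4 ?_ B₁.card
    · have h6 : (atomPoly B₁).coeff B₁.card = 1 := by
        conv_lhs => rw [← natDegree_atomPoly B₁]
        exact (atomPoly_monic B₁).coeff_natDegree
      rw [Polynomial.coeff_C_mul, h6, mul_one, hψ.annIdeal_eq] at h5
      have hnest' := hBl.nested
      rw [pairSupp_insert] at hnest'
      have hle1 : (IsNestedPair H S (x ⊔ B.sup id)) :=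
        hBl.toIsNestedPair.mono (Finset.subset_insert _ _) le_rfl
      have hz1 := isNestedPair_sup_of_joinNested hG hH hp hpa hmin hle1 hpS hnest'
      have hpf1 : p ∈ latticeFactors G (p ⊔ (x ⊔ B.sup id)) :=
        mem_latticeFactors_of_erase hH hp hpa le_sup_left hz1.not_le
      have hsup : p ⊔ (x ⊔ B.sup id) = p ⊔ x ⊔ B₂.sup id := by
        rw [sup_assoc]
        refine le_antisymm (sup_le le_sup_left (sup_le (le_sup_left.trans le_sup_right)
          (Finset.sup_le fun b hb => ?_))) (sup_le_sup_left (sup_le_sup_left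
            (Finset.sup_mono (Finset.filter_subset _ _)) _) _)
        by_cases hbp : IsAtom b ∧ b ≤ p
        · exact hbp.2.trans le_sup_left
        · exact (Finset.le_sup (f := id) (Finset.mem_filter.2 ⟨hb, hbp⟩)).trans
            (le_sup_right.trans le_sup_right)
      have hB2 : ∀ b ∈ B₂, IsAtom b := fun b hb => hB b (Finset.mem_filter.1 hb).1
      refine hψ.prod_notMem B₂ hB2 ⟨hsup ▸ hz1, hz.top_notMem, ?_⟩ ?_ h5
      · rw [← hsup]
        intro htop
        obtain ⟨h7, h8⟩ := hH.filter p hp hpa ⊤ hGt le_top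
        exact hz1.not_le ⊤ (Finset.mem_erase.2 ⟨hpt.symm, h7⟩) h8 htop.ge
      -- Independence of `B₂` over `p ⊔ x`: compare the modular equalities for `x` and for `x ⊔
      -- B.sup id`, whose meets with `p` differ in rank by at most `B₁.card`.
      · have r1 := latticeRank_sup_of_factor hG hpf
        have r2 := latticeRank_sup_of_factor hG hpf1
        have r3 := latticeRank_mono (sup_inf_factor_finset_le (x := x) hG hpf1 hB le_sup_right)
        have r4 := latticeRank_sup_finset_le (x ⊓ p) (B := B.filter (· ≤ p))
          fun b hb => hB b (Finset.mem_filter.1 hb).1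
        have r5 : B.filter (· ≤ p) = B₁ :=
          Finset.filter_congr fun b hb => ⟨fun h => ⟨hB b hb, h⟩, fun h => h.2⟩
        have r6 := latticeRank_sup_finset_le (p ⊔ x) hB2
        have r7 : B₁.card + B₂.card = B.card := Finset.card_filter_add_card_filter_not _
        rw [inf_comm] at r1 r2
        rw [r5] at r4 r3
        rw [hsup] at r2
        omega
    · refine lt_of_le_of_lt (Polynomial.natDegree_C_mul_le _ _) ?_
      rwa [natDegree_atomPoly, natDegree_atomPoly]

end

end DualityStep

/-! ### The base case, and the induction on the number of non-atoms -/

section DualityBase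

open MvPolynomial
open scoped Polynomial Classical

lemma annIdeal_lcoeff (n : ℕ) :
    annIdeal (Polynomial.lcoeff ℚ n) = Ideal.span {(Polynomial.X : ℚ[X]) ^ (n + 1)} := by
  ext F
  rw [Ideal.mem_span_singleton, mem_annIdeal]
  constructor
  · intro h
    rw [Polynomial.X_pow_dvd_iff]
    intro d hd
    have := h (Polynomial.X ^ (n - d))
    rwa [Polynomial.lcoeff_apply, Polynomial.coeff_mul_X_pow', if_pos (Nat.sub_le _ _),
      Nat.sub_sub_self (by omega)] at this
  · intro h G
    exact Polynomial.X_pow_dvd_iff.1 (h.mul_right G) n (Nat.lt_succ_self n)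

variable {L : Type u} [Lattice L] [BoundedOrder L]

/-- The evaluation of the variables at multiples of a single variable, the one of `⊤`. -/
noncomputable def topHom (L : Type u) [Lattice L] [BoundedOrder L] :
    MvPolynomial L ℚ →ₐ[ℚ] ℚ[X] :=
  aeval fun g => if g = ⊤ then Polynomial.X else if IsAtom g then -Polynomial.X else 0

lemma topHom_X (g : L) : topHom L (X g) =
    if g = ⊤ then Polynomial.X else if IsAtom g then -Polynomial.X else 0 := by
  simp [topHom]

lemma topHom_doubleHom (f : MvPolynomial L ℚ) :
    topHom L (doubleHom L f) = scaleHom (RingHom.id ℚ) (topHom L f) := by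
  have : (topHom L : MvPolynomial L ℚ →+* ℚ[X]).comp
      (doubleHom L : MvPolynomial L ℚ →+* MvPolynomial L ℚ) =
      (scaleHom (RingHom.id ℚ)).comp (topHom L : MvPolynomial L ℚ →+* ℚ[X]) := by
    refine MvPolynomial.ringHom_ext (fun r => ?_) fun g => ?_
    · simp only [RingHom.comp_apply, RingHom.coe_coe]
      rw [← algebraMap_eq, AlgHom.commutes, AlgHom.commutes, Polynomial.algebraMap_apply,
        scaleHom_C, RingHom.id_apply]
    · simp only [RingHom.comp_apply, RingHom.coe_coe, doubleHom_X, map_mul, map_ofNat, topHom_X]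
      split_ifs
      · rw [scaleHom_X]
      · rw [map_neg, scaleHom_X, mul_neg]
      · rw [map_zero, mul_zero]
  exact congrArg (fun φ => φ f) this

variable [Finite L] [IsAtomistic L] [IsUpperModularLattice L]
  {G H : Finset L} (hG : IsBuildingSet G) (hH : IsPartialBuildingSet G H)

include hG hH in
-- If `⊤` is not an atom, the linear relations say `x_a = -x_⊤`, so one variable remains. A basis of
-- `⊤` over `x` has `n + 1` elements, and its product gives the relation `x_⊤ ^ (n + 1) = 0`. If `⊤`
-- is an atom, then `n = 0` and the linear relation is `x_⊤ = 0`.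
lemma exists_isDualizing_base (htop : ⊤ ∈ H) (hbase : ∀ h ∈ H, ¬ IsAtom h → h = ⊤) {S : Finset L}
    {x : L} (hx : IsLocalPair H S x) {n : ℕ} (hn : latticeRank (⊤ : L) = n + 1 + latticeRank x) :
    S = ∅ ∧ ∃ φ, IsDualizing n H S x φ := by
  have hS : S = ∅ := by
    refine Finset.eq_empty_of_forall_notMem fun s hs => ?_
    have := hbase s (hx.subset hs) (hx.not_isAtom s hs)
    exact hx.top_notMem (this ▸ hs)
  refine ⟨hS, (Polynomial.lcoeff ℚ n).comp (topHom L).toLinearMap, ?_⟩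
  subst hS
  have hmemH : ∀ g, g ∉ H → topHom L (X g) = 0 := fun g hg => by
    rw [topHom_X, if_neg (by rintro rfl; exact hg htop), if_neg fun h => hg (hH.atoms_mem g h)]
  have hsumtop : IsAtom (⊤ : L) → ∀ a, IsAtom a →
      ∑ h ∈ H with a ≤ h, (X h : MvPolynomial L ℚ) = X ⊤ := by
    intro ht a ha
    have : H.filter (a ≤ ·) = {⊤} := by
      rw [ha.eq_of_le_isAtom ht le_top]
      ext h
      simp only [Finset.mem_filter, Finset.mem_singleton, top_le_iff]
      exact ⟨fun h => h.2, fun h => ⟨h ▸ htop, h⟩⟩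
    rw [this, Finset.sum_singleton]
  have hsum : ¬ IsAtom (⊤ : L) → ∀ a, IsAtom a →
      ∑ h ∈ H with a ≤ h, (X h : MvPolynomial L ℚ) = X a + X ⊤ := by
    intro ht a ha
    have hat : a ≠ ⊤ := by rintro rfl; exact ht ha
    have : H.filter (a ≤ ·) = {a, ⊤} := by
      ext h
      simp only [Finset.mem_filter, Finset.mem_singleton, Finset.mem_insert]
      constructor
      · rintro ⟨hh, hah⟩
        by_cases h' : IsAtom h
        · exact Or.inl (ha.eq_of_le_isAtom h' hah).symm
        · exact Or.inr (hbase h hh h')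
      · rintro (rfl | rfl)
        exacts [⟨hH.atoms_mem _ ha, le_rfl⟩, ⟨htop, le_top⟩]
    rw [this, Finset.sum_pair hat]
  have hdvd : ∀ a, IsAtom a → Polynomial.X ∣ topHom L (X a) := by
    intro a ha
    rw [topHom_X]
    split_ifs
    exacts [dvd_rfl, (dvd_neg).2 dvd_rfl]
  have hlt : ¬ latticeRank (⊤ : L) ≤ latticeRank x := by omega
  have hθ : nestedIdeal H (pairSupp ∅ x) ≤
      (annIdeal (Polynomial.lcoeff ℚ n)).comap (topHom L) := by
    rw [annIdeal_lcoeff]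
    refine nestedIdeal_le (fun g hg => ?_) (fun T hT hT' => ?_) fun a ha => ?_
    · rw [Ideal.mem_comap, hmemH g hg]
      exact Ideal.zero_mem _
    · rw [Ideal.mem_comap, Ideal.mem_span_singleton]
      unfold JoinNested at hT'
      push Not at hT'
      obtain ⟨E, hE, hEH, hEn⟩ := hT'
      have hEsub : E ⊆ H := fun e he => by
        rcases hE he with (h | h) | h
        exacts [absurd h (Finset.notMem_empty e), hH.atoms_mem e h.1, hT h]
      have hj := hbase _ hEH (hH.not_isAtom_sup hG hEsub hEH hEn)
      -- Only the join `⊤` can violate nestedness here, so the atoms in `T` span `⊤` over `x`; there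
      -- are at least `n + 1` of them.
      have hsup : x ⊔ (T.filter IsAtom).sup id = ⊤ := by
        refine top_le_iff.1 (hj ▸ Finset.sup_le fun e he => ?_)
        have hea : IsAtom e := by
          by_contra h
          exact hEn (hj ▸ hbase e (hEsub he) h ▸ he)
        rcases hE he with (h | h) | h
        · exact absurd h (Finset.notMem_empty e)
        · exact h.2.trans le_sup_left
        · exact (Finset.le_sup (f := id) (Finset.mem_filter.2 ⟨h, hea⟩)).trans le_sup_right
      have hcard := latticeRank_sup_finset_le x (B := T.filter IsAtom)
        fun b hb => (Finset.mem_filter.1 hb).2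
      rw [hsup] at hcard
      calc (Polynomial.X : ℚ[X]) ^ (n + 1) ∣ Polynomial.X ^ (T.filter IsAtom).card :=
            pow_dvd_pow _ (by omega)
        _ = ∏ t ∈ T.filter IsAtom, Polynomial.X := (Finset.prod_const _).symm
        _ ∣ ∏ t ∈ T.filter IsAtom, topHom L (X t) :=
            Finset.prod_dvd_prod_of_dvd _ _ fun t ht => hdvd t (Finset.mem_filter.1 ht).2
        _ ∣ ∏ t ∈ T, topHom L (X t) :=
            Finset.prod_dvd_prod_of_subset _ _ _ (Finset.filter_subset _ _)
        _ = topHom L (∏ t ∈ T, X t) := (map_prod _ _ _).symm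
    · rw [Ideal.mem_comap, Ideal.mem_span_singleton]
      by_cases ht : IsAtom (⊤ : L)
      · rw [hsumtop ht a ha, topHom_X, if_pos rfl]
        have := latticeRank_atom ht
        have h0 : n = 0 := by omega
        rw [h0, zero_add, pow_one]
      · have hat : a ≠ ⊤ := by rintro rfl; exact ht ha
        rw [hsum ht a ha, map_add, topHom_X, topHom_X, if_pos rfl, if_neg hat, if_pos ha,
          neg_add_cancel]
        exact dvd_zero _
  refine ⟨?_, ?_, ?_, ?_⟩
  · refine annIdeal_comp (topHom L)
      (Polynomial.aeval (R := ℚ) (X ⊤ : MvPolynomial L ℚ) : ℚ[X] →+* MvPolynomial L ℚ) _ _ hθ ?_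
      (fun f => ?_) fun g => ?_
    · rw [annIdeal_lcoeff, Ideal.span_singleton_le_iff_mem, Ideal.mem_comap, RingHom.coe_coe,
        map_pow, Polynomial.aeval_X]
      by_cases ht : IsAtom (⊤ : L)
      · have := sum_mem_nestedIdeal (H := H) (U := pairSupp ∅ x) ht
        rw [hsumtop ht ⊤ ht] at this
        exact Ideal.pow_mem_of_mem _ this _ (Nat.succ_pos n)
      · obtain ⟨B, hB, hBs, hBr⟩ := exists_basis_subset (x := x) (p := ⊤) le_top
          (B := atomsBelow ⊤) (fun b hb => (mem_atomsBelow.1 hb).1)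
          (by rw [sup_atomsBelow, sup_top_eq])
        have hBa : ∀ b ∈ B, IsAtom b := fun b hb => (mem_atomsBelow.1 (hB hb)).1
        have h1 : ∏ b ∈ B, X b ∈ nestedIdeal H (pairSupp ∅ x) := by
          refine prod_mem_nestedIdeal (fun b hb => hH.atoms_mem b (hBa b hb)) fun h => ?_
          have hs : (atomsBelow x ∪ B).sup id = ⊤ := by
            rw [Finset.sup_union, sup_atomsBelow, hBs]
          have := h (atomsBelow x ∪ B) ?_ (hs.symm ▸ htop)
          · rw [hs] at this
            rcases Finset.mem_union.1 this with h | h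
            exacts [ht (mem_atomsBelow.1 h).1, ht (hBa _ h)]
          · intro e he
            rcases Finset.mem_union.1 he with h | h
            exacts [Or.inl (Or.inr (mem_atomsBelow.1 h)), Or.inr h]
        have h2 : ∀ b ∈ B, Ideal.Quotient.mk (nestedIdeal H (pairSupp ∅ x)) (X b) =
            Ideal.Quotient.mk (nestedIdeal H (pairSupp ∅ x)) (-X ⊤) := by
          intro b hb
          rw [Ideal.Quotient.eq, sub_neg_eq_add, ← hsum ht b (hBa b hb)]
          exact sum_mem_nestedIdeal (hBa b hb)
        have hcard : B.card = n + 1 := by omega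
        rw [← Ideal.Quotient.eq_zero_iff_mem, map_prod, Finset.prod_congr rfl h2,
          Finset.prod_const, hcard, ← map_pow, Ideal.Quotient.eq_zero_iff_mem, neg_pow_eq] at h1
        have := Ideal.mul_mem_left _ ((-1) ^ (n + 1)) h1
        rwa [← mul_assoc, neg_one_pow_mul_self, one_mul] at this
    · rw [← Ideal.Quotient.eq]
      have : (Ideal.Quotient.mk (nestedIdeal H (pairSupp ∅ x))).comp
          ((Polynomial.aeval (R := ℚ) (X ⊤ : MvPolynomial L ℚ) : ℚ[X] →+* MvPolynomial L ℚ).comp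
            (topHom L : MvPolynomial L ℚ →+* ℚ[X])) = Ideal.Quotient.mk _ := by
        refine MvPolynomial.ringHom_ext (fun r => ?_) fun g => ?_
        · simp only [RingHom.comp_apply, RingHom.coe_coe]
          rw [← algebraMap_eq, AlgHom.commutes, AlgHom.commutes]
        · simp only [RingHom.comp_apply, RingHom.coe_coe, topHom_X]
          split_ifs with h1 h2
          · rw [Polynomial.aeval_X, h1]
          · rw [map_neg, Polynomial.aeval_X, Ideal.Quotient.eq]
            have ht : ¬ IsAtom (⊤ : L) := fun h => h1 (h2.eq_of_le_isAtom h le_top)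
            have := sum_mem_nestedIdeal (H := H) (U := pairSupp ∅ x) h2
            rw [hsum ht g h2] at this
            rw [← Ideal.neg_mem_iff]
            convert this using 1
            ring
          · rw [map_zero, map_zero, eq_comm, Ideal.Quotient.eq_zero_iff_mem]
            exact X_mem_nestedIdeal fun h => h1 (hbase g h h2)
      exact congrArg (fun φ => φ f) this
    · have : (topHom L).comp (Polynomial.aeval (R := ℚ) (X ⊤ : MvPolynomial L ℚ)) = AlgHom.id ℚ _ := by
        refine Polynomial.algHom_ext ?_
        rw [AlgHom.comp_apply, Polynomial.aeval_X, topHom_X, if_pos rfl, AlgHom.id_apply]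
      have h1 := congrArg (fun φ => φ g) this
      simp only [AlgHom.comp_apply, AlgHom.id_apply] at h1
      rw [RingHom.coe_coe, h1, sub_self]
      exact Ideal.zero_mem _
  · intro f
    simp only [LinearMap.comp_apply, AlgHom.toLinearMap_apply, Polynomial.lcoeff_apply]
    rw [topHom_doubleHom, coeff_scaleHom, RingHom.id_apply, mul_comm]
  · have h1 : topMonomial ∅ x = (-X ⊤) ^ n := by
      have : latticeRank (⊤ : L) - latticeRank x - 1 = n := by omega
      simp [topMonomial, lowerJoin, intervalRank, this]
    simp only [LinearMap.comp_apply, AlgHom.toLinearMap_apply, Polynomial.lcoeff_apply]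
    rw [h1, map_pow, map_neg, topHom_X, if_pos rfl, neg_pow_eq, ← Polynomial.C_1,
      ← Polynomial.C_neg, ← Polynomial.C_pow, Polynomial.coeff_C_mul_X_pow, if_pos rfl]
    exact pow_ne_zero _ (by norm_num)
  · intro B hB hBl hBr hmem
    have h1 := hθ hmem
    have h2 : topHom L (∏ b ∈ B, X b) = Polynomial.C ((-1) ^ B.card) * Polynomial.X ^ B.card := by
      rw [Polynomial.C_pow, Polynomial.C_neg, Polynomial.C_1, ← neg_pow_eq, map_prod]
      refine Finset.prod_eq_pow_card fun b hb => ?_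
      rw [topHom_X, if_neg, if_pos (hB b hb)]
      rintro rfl
      exact hBl.ne_top (top_le_iff.1 ((Finset.le_sup (f := id) hb).trans le_sup_right))
    rw [Ideal.mem_comap, annIdeal_lcoeff, Ideal.mem_span_singleton, h2,
      Polynomial.X_pow_dvd_iff] at h1
    have h3 := latticeRank_strictMono (lt_top_iff_ne_top.2 hBl.ne_top)
    have h4 := h1 B.card (by omega)
    rw [Polynomial.coeff_C_mul_X_pow, if_pos rfl] at h4
    exact pow_ne_zero _ (by norm_num) h4

/-- Every local algebra has a dualising functional. -/
theorem exists_isDualizing (hG : IsBuildingSet G) (hGt : ⊤ ∈ G) {r : ℕ}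
    (hr : latticeRank (⊤ : L) = r + 1) (hH : IsPartialBuildingSet G H) (htop : ⊤ ∈ H)
    {S : Finset L} {x : L} (hx : IsLocalPair H S x) :
    ∃ n φ, n + S.card + latticeRank x = r ∧ IsDualizing n H S x φ := by
  generalize hk : (H.filter fun h => ¬ IsAtom h).card = k
  induction k using Nat.strong_induction_on generalizing H S x with
  | _ k ih =>
    subst hk
    by_cases hbase : ∀ h ∈ H, ¬ IsAtom h → h = ⊤
    · have := latticeRank_strictMono (lt_top_iff_ne_top.2 hx.ne_top)
      obtain ⟨rfl, φ, hφ⟩ := exists_isDualizing_base hG hH htop hbase hx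
        (n := r - latticeRank x) (by omega)
      exact ⟨r - latticeRank x, φ, by simp; omega, hφ⟩
    · push Not at hbase
      obtain ⟨h, hhH, hha, hht⟩ := hbase
      obtain ⟨p, hph, hpm⟩ := Finset.exists_le_minimal (H.filter fun h => ¬ IsAtom h)
        (a := h) (Finset.mem_filter.2 ⟨hhH, hha⟩)
      obtain ⟨hp, hpa⟩ := Finset.mem_filter.1 hpm.prop
      have hmin : ∀ h ∈ H, ¬ IsAtom h → h ≤ p → h = p := fun g hg hga hgp =>
        hpm.eq_of_le (Finset.mem_filter.2 ⟨hg, hga⟩) hgp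
      have hpt : p ≠ ⊤ := fun h => hht (top_le_iff.1 (h ▸ hph))
      have htop' : ⊤ ∈ H.erase p := Finset.mem_erase.2 ⟨hpt.symm, htop⟩
      have hcard : ((H.erase p).filter fun h => ¬ IsAtom h).card <
          (H.filter fun h => ¬ IsAtom h).card := by
        refine Finset.card_lt_card (Finset.ssubset_iff_of_subset
          (Finset.filter_subset_filter _ (Finset.erase_subset _ _)) |>.2 ⟨p, hpm.prop, ?_⟩)
        simp
      have ih' := fun {S x} (hx : IsLocalPair (H.erase p) S x) =>
        ih _ hcard (hH.erase hpa hmin) htop' hx rfl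
      -- The centre never lies over `⊤`: `⊤` is still a non-atom of `H.erase p`, and nested pairs
      -- have no such element below their second component.
      have hcentre : ∀ {S : Finset L}, IsNestedPair (H.erase p) S (p ⊔ x) → ⊤ ∉ S →
          IsLocalPair (H.erase p) S (p ⊔ x) := fun h1 h2 => ⟨h1, h2, fun h3 =>
        h1.not_le ⊤ htop' (hH.filter p hp hpa ⊤ hGt le_top).2 h3.ge⟩
      by_cases hpS : p ∈ S
      · obtain ⟨S, hpS', rfl⟩ : ∃ S', p ∉ S' ∧ insert p S' = S :=
          ⟨S.erase p, Finset.notMem_erase p S, Finset.insert_erase hpS⟩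
        have htS : ⊤ ∉ S := fun h => hx.top_notMem (Finset.mem_insert_of_mem h)
        have hnest := hx.nested
        rw [pairSupp_insert] at hnest
        have hx' : IsNestedPair H S x := hx.toIsNestedPair.mono (Finset.subset_insert _ _) le_rfl
        have hz := hcentre (isNestedPair_sup_of_joinNested hG hH hp hpa hmin hx' hpS' hnest) htS
        have hx'' : IsLocalPair H S x := ⟨hx', htS, hx.ne_top⟩
        obtain ⟨n, φ, hn, hφ⟩ := ih' (hx''.of_erase hpS')
        obtain ⟨m, ψ, hm, hψ⟩ := ih' hz
        have hlt : latticeRank x < latticeRank (p ⊔ x) := latticeRank_strictMono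
          (lt_of_le_of_ne le_sup_right fun h => hx.not_le p hp hpa (h ▸ le_sup_left))
        -- The centre has degree at least `0`, and `p ⊔ x` has larger rank than `x`, so `n` is
        -- positive.
        obtain ⟨n, rfl⟩ : ∃ n', n = n' + 1 := ⟨n - 1, by omega⟩
        obtain ⟨Φ, hΦ⟩ := exists_isDualizing_bundle hG hH hp hpa hmin hGt hpt hx hpS' hz hφ hψ
          (by omega)
        exact ⟨n, Φ, by rw [Finset.card_insert_of_notMem hpS']; omega, hΦ⟩
      · obtain ⟨n, φ, hn, hφ⟩ := ih' (hx.of_erase hpS)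
        by_cases hnest : JoinNested H (insert p (pairSupp S x))
        · have hz := hcentre (isNestedPair_sup_of_joinNested hG hH hp hpa hmin hx.toIsNestedPair
            hpS hnest) hx.top_notMem
          obtain ⟨m, ψ, hm, hψ⟩ := ih' hz
          obtain ⟨Φ, hΦ⟩ := exists_isDualizing_blowup hG hH hp hpa hmin hpt hx hpS hz hφ hψ
            (by omega)
          exact ⟨n, Φ, hn, hΦ⟩
        · have heq := nestedIdeal_erase_eq hG hH hp hpa hmin hx.toIsNestedPair hnest hpS
          refine ⟨n, φ, hn, heq ▸ hφ.annIdeal_eq, hφ.homogeneous, hφ.topMonomial_ne_zero, ?_⟩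
          intro B hB hBl hBr
          rw [heq]
          exact hφ.prod_notMem B hB (hBl.of_erase hpS) hBr

end DualityBase

/-! ## The elements of an iterated blowup -/

section Stage

open scoped Classical

variable {L : Type u} [Lattice L] [BoundedOrder L] [Finite L]

/-- A description of the elements of a stage by pairs `(S, x)`, where `F` is the set of elements
that have been blown up. -/
structure StageModel (X : BlowupStage L) (F : Finset L) where
  /-- The pair that describes an element. -/
  code : X.carrier → Finset L × L
  le_iff : ∀ a b, a ≤ b ↔ (code a).1 ⊆ (code b).1 ∧ (code a).2 ≤ (code b).2
  exists_iff : ∀ S x, IsNestedPair (F ∪ atomsBelow ⊤) S x ↔ ∃ a, code a = (S, x)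
  elt_of_mem : ∀ g ∈ F, ∃ a, X.elt g = some a ∧ code a = ({g}, ⊥)
  elt_of_not_le : ∀ g, (∀ f ∈ F, ¬ f ≤ g) → ∃ a, X.elt g = some a ∧ code a = (∅, g)
  proj_eq : ∀ a, X.proj a = (code a).1.sup id ⊔ (code a).2

lemma mem_union_atomsBelow {F : Finset L} {g : L} :
    g ∈ F ∪ atomsBelow ⊤ ↔ g ∈ F ∨ IsAtom g := by
  simp [mem_atomsBelow]

lemma StageModel.code_injective {X : BlowupStage L} {F : Finset L} (M : StageModel X F)
    {a b : X.carrier} (h : M.code a = M.code b) : a = b :=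
  le_antisymm ((M.le_iff a b).2 (by rw [h]; exact ⟨le_rfl, le_rfl⟩))
    ((M.le_iff b a).2 (by rw [h]; exact ⟨le_rfl, le_rfl⟩))

/-- The description of the lattice before any blowup. -/
noncomputable def StageModel.init : StageModel (BlowupStage.init L) ∅ where
  code x := (∅, x)
  le_iff a b := by
    exact ⟨fun h => ⟨le_rfl, h⟩, fun h => h.2⟩
  exists_iff S x := by
    constructor
    · intro h
      refine ⟨x, Prod.ext ?_ rfl⟩
      refine (Finset.eq_empty_of_forall_notMem fun s hs => ?_).symm
      have := mem_union_atomsBelow.1 (h.subset hs)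
      exact h.not_isAtom s hs (this.resolve_left (Finset.notMem_empty s))
    · rintro ⟨a, ha⟩
      obtain ⟨rfl, rfl⟩ := Prod.ext_iff.1 ha
      refine ⟨Finset.empty_subset _, by simp, fun h hh hha => ?_, fun E hE hEH => ?_⟩
      · exact absurd (mem_union_atomsBelow.1 hh) (by simpa using hha)
      · have hat : IsAtom (E.sup id) := by simpa using mem_union_atomsBelow.1 hEH
        have hne : E.Nonempty := by
          by_contra h
          rw [Finset.not_nonempty_iff_eq_empty.1 h, Finset.sup_empty] at hat
          exact hat.1 rfl
        obtain ⟨e, he⟩ := hne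
        have hea : IsAtom e := (hE he).elim (fun h => absurd h (Finset.notMem_empty e)) fun h => h.1
        have := hea.eq_of_le_isAtom hat (Finset.le_sup (f := id) he)
        rwa [← this]
  elt_of_mem g hg := absurd hg (Finset.notMem_empty g)
  elt_of_not_le g _ := ⟨g, rfl, rfl⟩
  proj_eq a := by
    exact (bot_sup_eq (α := L) a).symm

/-- The stage obtained by blowing up at a given element of the current poset. -/
noncomputable def BlowupStage.blowupAtElt (X : BlowupStage L) (q : L) (p : X.carrier) :
    BlowupStage L where
  carrier := Blowup p
  elt := fun x =>
    if x = q then (X.elt ⊥).bind (Blowup.exc? p) else (X.elt x).bind (Blowup.old? p)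
  proj := fun z => X.proj z.down

omit [Finite L] in
lemma BlowupStage.blowupAt_eq {X : BlowupStage L} {q : L} {p : X.carrier} (h : X.elt q = some p) :
    X.blowupAt q = X.blowupAtElt q p := by
  unfold BlowupStage.blowupAt
  rw [h]
  rfl

/-! ### One blowup in terms of pairs -/

section Step

variable {X : BlowupStage L} {F : Finset L} (M : StageModel X F) {p : L} {a₀ : X.carrier}
  (ha₀ : M.code a₀ = (∅, p))

include ha₀

lemma StageModel.base_le_iff (a : X.carrier) : a₀ ≤ a ↔ p ≤ (M.code a).2 := by
  rw [M.le_iff, ha₀]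
  simp

/-- Nested pairs are closed downwards, so below any upper bound the pair with second component `p ⊔
(M.code a).2` is itself the code of an element, and that element is the join. -/
lemma StageModel.code_of_isLUB {a s : X.carrier} (hs : IsLUB {a₀, a} s) :
    M.code s = ((M.code a).1, p ⊔ (M.code a).2) := by
  have h0 : a₀ ≤ s := hs.1 (by simp)
  have h1 : a ≤ s := hs.1 (by simp)
  rw [M.base_le_iff ha₀] at h0
  rw [M.le_iff] at h1
  have hpair : IsNestedPair (F ∪ atomsBelow ⊤) (M.code a).1 (p ⊔ (M.code a).2) :=
    ((M.exists_iff _ _).2 ⟨s, rfl⟩).mono h1.1 (sup_le h0 h1.2)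
  obtain ⟨t, ht⟩ := (M.exists_iff _ _).1 hpair
  have hst : s ≤ t := hs.2 (by
    rintro b (rfl | rfl)
    · rw [M.base_le_iff ha₀, ht]; exact le_sup_left
    · rw [M.le_iff, ht]; exact ⟨le_rfl, le_sup_right⟩)
  rw [M.le_iff, ht] at hst
  exact Prod.ext (Finset.Subset.antisymm hst.1 h1.1) (le_antisymm hst.2 (sup_le h0 h1.2))

lemma StageModel.exists_isLUB_iff (a : X.carrier) : (∃ s, IsLUB {a₀, a} s) ↔
    IsNestedPair (F ∪ atomsBelow ⊤) (M.code a).1 (p ⊔ (M.code a).2) := by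
  constructor
  · rintro ⟨s, hs⟩
    exact (M.exists_iff _ _).2 ⟨s, M.code_of_isLUB ha₀ hs⟩
  · intro h
    obtain ⟨t, ht⟩ := (M.exists_iff _ _).1 h
    refine ⟨t, ?_, fun u hu => ?_⟩
    · rintro b (rfl | rfl)
      · rw [M.base_le_iff ha₀, ht]; exact le_sup_left
      · rw [M.le_iff, ht]; exact ⟨le_rfl, le_sup_right⟩
    · have h0 : a₀ ≤ u := hu (by simp)
      have h1 : a ≤ u := hu (by simp)
      rw [M.base_le_iff ha₀] at h0
      rw [M.le_iff] at h1 ⊢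
      rw [ht]
      exact ⟨h1.1, sup_le h0 h1.2⟩

omit ha₀ in
/-- The pair that describes an element of the blowup. -/
noncomputable def StageModel.blowupCode (M : StageModel X F) (p : L) :
    Blowup a₀ → Finset L × L
  | .old a _ => M.code a
  | .exc a _ _ => (insert p (M.code a).1, (M.code a).2)

variable [IsAtomistic L] {G : Finset L}

/-- The description of the blowup of a stage. -/
noncomputable def StageModel.blowup (hG : IsBuildingSet G)
    (hH : IsPartialBuildingSet G (insert p F ∪ atomsBelow ⊤)) (hpa : ¬ IsAtom p)
    (hpF : ∀ f ∈ F, ¬ f ≤ p) : StageModel (X.blowupAtElt p a₀) (insert p F) :=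
  have hp : p ∈ insert p F ∪ atomsBelow ⊤ := by simp
  have hpF' : p ∉ F := fun h => hpF p h le_rfl
  have herase : (insert p F ∪ atomsBelow ⊤).erase p = F ∪ atomsBelow ⊤ := by
    ext g
    rw [Finset.mem_erase, mem_union_atomsBelow, mem_union_atomsBelow, Finset.mem_insert]
    constructor
    · rintro ⟨h1, (h2 | h2) | h2⟩
      exacts [absurd h2 h1, Or.inl h2, Or.inr h2]
    · rintro (h | h)
      · exact ⟨by rintro rfl; exact hpF' h, Or.inl (Or.inr h)⟩
      · exact ⟨by rintro rfl; exact hpa h, Or.inr h⟩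
  have hmin : ∀ h ∈ insert p F ∪ atomsBelow ⊤, ¬ IsAtom h → h ≤ p → h = p := by
    intro h hh hha hle
    rcases mem_union_atomsBelow.1 hh with h1 | h1
    · exact (Finset.mem_insert.1 h1).resolve_right fun h2 => hpF h h2 hle
    · exact absurd h1 hha
  have hpcode : ∀ a, p ∉ (M.code a).1 := by
    intro a hmem
    have h1 := (M.exists_iff _ _).2 ⟨a, rfl⟩
    rcases mem_union_atomsBelow.1 (h1.subset hmem) with h2 | h2
    exacts [hpF' h2, hpa h2]
  have hbot : ∀ f ∈ insert p F, f ≠ ⊥ := by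
    rintro f hf rfl
    exact hH.bot_notMem hG (Finset.mem_union_left _ hf)
  { code := M.blowupCode p
    le_iff := by
      rintro (⟨a, ha⟩ | ⟨a, ha, ha'⟩) (⟨b, hb⟩ | ⟨b, hb, hb'⟩)
      · exact M.le_iff a b
      · refine (M.le_iff a b).trans (and_congr_left fun _ => ?_)
        exact ⟨fun h => h.trans (Finset.subset_insert _ _),
          fun h => (Finset.subset_insert_iff_of_notMem (hpcode a)).1 h⟩
      · refine ⟨fun h => h.elim, fun h => ?_⟩
        exact absurd (h.1 (Finset.mem_insert_self _ _)) (hpcode b)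
      · refine (M.le_iff a b).trans (and_congr_left fun _ => ?_)
        exact ⟨fun h => Finset.insert_subset_insert _ h, fun h =>
          (Finset.subset_insert_iff_of_notMem (hpcode a)).1
            ((Finset.subset_insert _ _).trans h)⟩
    exists_iff := by
      intro S x
      constructor
      · intro h
        have hpx : ¬ p ≤ x := h.not_le p hp hpa
        -- Forgetting `p` gives an element `a` of the previous stage. Whether `p ∈ S` decides
        -- between the exceptional copy and the surviving copy of `a`.
        have h1 := h.erase (p := p)
        rw [herase] at h1
        obtain ⟨a, ha⟩ := (M.exists_iff _ _).1 h1
        have hpa' : ¬ a₀ ≤ a := by rw [M.base_le_iff ha₀, ha]; exact hpx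
        by_cases hpS : p ∈ S
        · have h2 : JoinNested (insert p F ∪ atomsBelow ⊤) (insert p (pairSupp (S.erase p) x)) := by
            rw [← pairSupp_insert, Finset.insert_erase hpS]
            exact h.nested
          have h3 := isNestedPair_sup_of_joinNested hG hH hp hpa hmin
            (h.mono (Finset.erase_subset p S) le_rfl) (Finset.notMem_erase p S) h2
          rw [herase] at h3
          refine ⟨.exc a hpa' ((M.exists_isLUB_iff ha₀ a).2 (by rw [ha]; exact h3)), ?_⟩
          simp [blowupCode, ha, Finset.insert_erase hpS]
        · refine ⟨.old a hpa', ?_⟩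
          simp [blowupCode, ha, Finset.erase_eq_of_notMem hpS]
      · rintro ⟨⟨a, ha⟩ | ⟨a, ha, ha'⟩, he⟩
        · have hx := (M.exists_iff _ _).2 ⟨a, rfl⟩
          rw [M.base_le_iff ha₀] at ha
          obtain ⟨rfl, rfl⟩ := Prod.ext_iff.1 he
          have hle : F ∪ atomsBelow ⊤ ⊆ insert p F ∪ atomsBelow ⊤ :=
            Finset.union_subset_union_left (Finset.subset_insert _ _)
          refine ⟨hx.subset.trans hle, hx.not_isAtom, fun g hg hga => ?_, ?_⟩
          · by_cases hgp : g = p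
            · rwa [hgp]
            · refine hx.not_le g ?_ hga
              rw [← herase]
              exact Finset.mem_erase.2 ⟨hgp, hg⟩
          · by_contra hcon
            have hsub : pairSupp (M.code a).1 (M.code a).2 ⊆ ↑(insert p F ∪ atomsBelow ⊤) := by
              rintro v (hv | hv)
              exacts [hle (hx.subset hv), hH.atoms_mem v hv.1]
            rcases exists_atoms_or_not_joinNested_erase hG hH hpa hmin hsub hcon with
              ⟨E, hE, hEa, hEs⟩ | ⟨h1, -⟩
            · refine ha (hEs ▸ Finset.sup_le fun e he => ?_)
              rcases hE he with h1 | h1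
              · exact absurd (hEa e he).1 (hx.not_isAtom e h1)
              · exact h1.2
            · refine h1 (fun h => h.elim (hpcode a) fun h => hpa h.1) ?_
              rw [herase]
              exact hx.nested
        · rw [M.base_le_iff ha₀] at ha
          obtain ⟨rfl, rfl⟩ := Prod.ext_iff.1 he
          rw [M.exists_isLUB_iff ha₀, ← herase] at ha'
          exact isNestedPair_insert hG hH hp hpa hmin ha' ha
    elt_of_mem := by
      intro g hg
      have hb0 : ∀ b : X.carrier, (M.code b).2 = ⊥ → ¬ a₀ ≤ b := by
        intro b hb
        rw [M.base_le_iff ha₀, hb, le_bot_iff]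
        exact hbot p (Finset.mem_insert_self _ _)
      by_cases hgp : g = p
      · subst hgp
        obtain ⟨b, hb, hbc⟩ := M.elt_of_not_le ⊥ fun f hf h =>
          hbot f (Finset.mem_insert_of_mem hf) (le_bot_iff.1 h)
        have hlub : ∃ s, IsLUB {a₀, b} s := by
          rw [M.exists_isLUB_iff ha₀, hbc, sup_bot_eq]
          exact (M.exists_iff _ _).2 ⟨a₀, ha₀⟩
        have hnb := hb0 b (by rw [hbc])
        refine ⟨.exc b hnb hlub, ?_, by simp [blowupCode, hbc]⟩
        simp only [BlowupStage.blowupAtElt, if_true, hb, Option.bind_some, Blowup.exc?]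
        rw [dif_pos ⟨hnb, hlub⟩]
      · obtain ⟨b, hb, hbc⟩ := M.elt_of_mem g ((Finset.mem_insert.1 hg).resolve_left hgp)
        have hnb := hb0 b (by rw [hbc])
        refine ⟨.old b hnb, ?_, by simp [blowupCode, hbc]⟩
        simp only [BlowupStage.blowupAtElt, if_neg hgp, hb, Option.bind_some, Blowup.old?]
        rw [dif_pos hnb]
    elt_of_not_le := by
      intro g hg
      obtain ⟨b, hb, hbc⟩ := M.elt_of_not_le g fun f hf => hg f (Finset.mem_insert_of_mem hf)
      have hpg := hg p (Finset.mem_insert_self _ _)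
      have hgp : g ≠ p := by rintro rfl; exact hpg le_rfl
      have hnb : ¬ a₀ ≤ b := by rw [M.base_le_iff ha₀, hbc]; exact hpg
      refine ⟨.old b hnb, ?_, by simp [blowupCode, hbc]⟩
      simp only [BlowupStage.blowupAtElt, if_neg hgp, hb, Option.bind_some, Blowup.old?]
      rw [dif_pos hnb]
    proj_eq := by
      rintro (⟨a, ha⟩ | ⟨a, ha, ha'⟩)
      · exact M.proj_eq a
      · show X.proj ha'.choose = _
        rw [M.proj_eq, M.code_of_isLUB ha₀ ha'.choose_spec]
        simp only [blowupCode, Finset.sup_insert, id]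
        rw [← sup_assoc, sup_comm _ p] }

end Step

/-- `F` is the set blown up so far. As larger elements come first, `F` with the atoms is a partial
building set at every stage, and the next `p` is a minimal non-atom once inserted. -/
lemma exists_stageModel_foldl [IsAtomistic L] {G H : Finset L} (hG : IsBuildingSet G)
    (hH : IsPartialBuildingSet G H) (l : List L) (F : Finset L) (X : BlowupStage L)
    (M : StageModel X F) (hl : ∀ x, x ∈ F ∨ x ∈ l ↔ x ∈ H ∧ ¬ IsAtom x)
    (hF : ∀ f ∈ F, ∀ q ∈ l, ¬ f ≤ q) (hlp : l.Pairwise fun p q => ¬ p ≤ q) :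
    Nonempty (StageModel (l.foldl BlowupStage.blowupAt X) (H.filter fun h => ¬ IsAtom h)) := by
  induction l generalizing F X with
  | nil =>
    have : F = H.filter fun h => ¬ IsAtom h := by
      ext x
      rw [Finset.mem_filter, ← hl]
      simp
    subst this
    exact ⟨M⟩
  | cons p l ih =>
    rw [List.pairwise_cons] at hlp
    obtain ⟨hpH, hpa⟩ := (hl p).1 (Or.inr List.mem_cons_self)
    have hpF : ∀ f ∈ F, ¬ f ≤ p := fun f hf => hF f hf p List.mem_cons_self
    obtain ⟨a₀, ha₀, hc₀⟩ := M.elt_of_not_le p hpF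
    have hl' : ∀ x, x ∈ insert p F ∨ x ∈ l ↔ x ∈ H ∧ ¬ IsAtom x := by
      intro x
      rw [← hl, Finset.mem_insert, List.mem_cons]
      tauto
    have hF' : ∀ f ∈ insert p F, ∀ q ∈ l, ¬ f ≤ q := by
      intro f hf q hq
      rcases Finset.mem_insert.1 hf with rfl | hf
      · exact hlp.1 q hq
      · exact hF f hf q (List.mem_cons_of_mem _ hq)
    have hH' : IsPartialBuildingSet G (insert p F ∪ atomsBelow ⊤) := by
      refine ⟨fun g hg => ?_, fun a ha => mem_union_atomsBelow.2 (Or.inr ha), fun q hq hqa g hg hqg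
        => ?_⟩
      · rcases mem_union_atomsBelow.1 hg with h | h
        · exact hH.subset ((hl' g).1 (Or.inl h)).1
        · exact hH.subset (hH.atoms_mem g h)
      · have hq' := (mem_union_atomsBelow.1 hq).resolve_right hqa
        have hgH := hH.filter q ((hl' q).1 (Or.inl hq')).1 hqa g hg hqg
        refine ⟨mem_union_atomsBelow.2 (Or.inl ?_), hgH.2⟩
        exact ((hl' g).2 hgH).resolve_right fun h => hF' q hq' g h hqg
    rw [List.foldl_cons, BlowupStage.blowupAt_eq ha₀]
    exact ih (insert p F) _ (M.blowup hc₀ hG hH' hpa hpF) hl' hF' hlp.2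

lemma exists_stageModel [IsAtomistic L] {G H : Finset L} (hG : IsBuildingSet G)
    (hH : IsPartialBuildingSet G H) {l : List L} (hl : IsBlowupOrder H l) :
    Nonempty (StageModel (iteratedBlowup l) (H.filter fun h => ¬ IsAtom h)) :=
  exists_stageModel_foldl hG hH l ∅ _ StageModel.init (by simpa using hl.1) (by simp) hl.2

/-! ### Support, factors, lower joins and rank in terms of pairs -/

section Final

variable [IsAtomistic L] {G H : Finset L} (hG : IsBuildingSet G) (hH : IsPartialBuildingSet G H)
  {X : BlowupStage L} (M : StageModel X (H.filter fun h => ¬ IsAtom h)) (y : X.carrier)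

omit [IsAtomistic L] in
include hH in
lemma StageModel.isNestedPair (M : StageModel X (H.filter fun h => ¬ IsAtom h)) (y : X.carrier) :
    IsNestedPair H (M.code y).1 (M.code y).2 := by
  have h := (M.exists_iff _ _).2 ⟨y, rfl⟩
  have : (H.filter fun h => ¬ IsAtom h) ∪ atomsBelow ⊤ = H := by
    ext g
    rw [mem_union_atomsBelow, Finset.mem_filter]
    constructor
    · rintro (h | h)
      exacts [h.1, hH.atoms_mem g h]
    · intro h
      by_cases hg : IsAtom g
      exacts [Or.inr hg, Or.inl ⟨h, hg⟩]
  rwa [this] at h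

omit [IsAtomistic L] in
lemma StageModel.isLocalPair (hH : IsPartialBuildingSet G H) (hy : X.proj y ≠ ⊤) :
    IsLocalPair H (M.code y).1 (M.code y).2 := by
  rw [M.proj_eq] at hy
  refine ⟨M.isNestedPair hH y, fun h => hy ?_, fun h => hy ?_⟩
  · exact top_le_iff.1 ((Finset.le_sup (f := id) h).trans le_sup_left)
  · rw [h, sup_top_eq]

include hH

omit [IsAtomistic L] in
/-- The code of an element of `G`. -/
lemma StageModel.elt_of_mem_building {g : L} (hg : g ∈ G) :
    ∃ a, X.elt g = some a ∧ ((g ∈ H ∧ ¬ IsAtom g) ∧ M.code a = ({g}, ⊥) ∨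
      ¬ (g ∈ H ∧ ¬ IsAtom g) ∧ M.code a = (∅, g)) := by
  by_cases h : g ∈ H ∧ ¬ IsAtom g
  · obtain ⟨a, ha, hc⟩ := M.elt_of_mem g (Finset.mem_filter.2 h)
    exact ⟨a, ha, Or.inl ⟨h, hc⟩⟩
  · obtain ⟨a, ha, hc⟩ := M.elt_of_not_le g fun f hf hfg => by
      obtain ⟨h1, h2⟩ := Finset.mem_filter.1 hf
      exact h (hH.filter f h1 h2 g hg hfg)
    exact ⟨a, ha, Or.inr ⟨h, hc⟩⟩

omit [IsAtomistic L] in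
lemma StageModel.coe_supp : (X.supp H y : Set L) = pairSupp (M.code y).1 (M.code y).2 := by
  have hN := M.isNestedPair hH y
  ext g
  rw [Finset.mem_coe, BlowupStage.supp, Finset.mem_filter]
  change _ ↔ g ∈ (M.code y).1 ∨ IsAtom g ∧ g ≤ (M.code y).2
  constructor
  · rintro ⟨hg, a, ha, hle⟩
    obtain ⟨b, hb, hc⟩ := M.elt_of_mem_building hH (hH.subset hg)
    obtain rfl : a = b := Option.some_injective _ (ha.symm.trans hb)
    rw [M.le_iff] at hle
    rcases hc with ⟨-, hc⟩ | ⟨h1, hc⟩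
    · rw [hc] at hle
      exact Or.inl (hle.1 (Finset.mem_singleton_self g))
    · rw [hc] at hle
      exact Or.inr ⟨by_contra fun h => h1 ⟨hg, h⟩, hle.2⟩
  · rintro (h | ⟨ha, hx⟩)
    · have hgH := hN.subset h
      obtain ⟨b, hb, hc⟩ := M.elt_of_mem_building hH (hH.subset hgH)
      refine ⟨hgH, b, hb, ?_⟩
      rcases hc with ⟨-, hc⟩ | ⟨h1, hc⟩
      · rw [M.le_iff, hc]
        exact ⟨Finset.singleton_subset_iff.2 h, bot_le⟩
      · exact absurd ⟨hgH, hN.not_isAtom g h⟩ h1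
    · have hgH := hH.atoms_mem g ha
      obtain ⟨b, hb, hc⟩ := M.elt_of_mem_building hH (hH.subset hgH)
      refine ⟨hgH, b, hb, ?_⟩
      rcases hc with ⟨h1, -⟩ | ⟨-, hc⟩
      · exact absurd ha h1.2
      · rw [M.le_iff, hc]
        exact ⟨Finset.empty_subset _, hx⟩

omit [IsAtomistic L] in
include hG in
-- A blown-up `g` has code `({g}, ⊥)` and any other element of `G` has code `(∅, g)`. The two kinds
-- are incomparable since `⊥ ∉ G`, so maximality is tested within each kind.
lemma StageModel.mem_factors {g : L} : g ∈ X.factors G y ↔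
    g ∈ (M.code y).1 ∨ g ∈ latticeFactors G (M.code y).2 := by
  have hN := M.isNestedPair hH y
  have hH' : ∀ g ∈ G, g ≤ (M.code y).2 → ¬ (g ∈ H ∧ ¬ IsAtom g) := fun g _ hle h =>
    hN.not_le g h.1 h.2 hle
  simp only [BlowupStage.factors, Finset.mem_filter, mem_latticeFactors]
  constructor
  · rintro ⟨hg, a, ha, hle, hmax⟩
    obtain ⟨b, hb, hc⟩ := M.elt_of_mem_building hH hg
    obtain rfl : a = b := Option.some_injective _ (ha.symm.trans hb)
    rw [M.le_iff] at hle
    rcases hc with ⟨-, hc⟩ | ⟨h1, hc⟩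
    · rw [hc] at hle
      exact Or.inl (hle.1 (Finset.mem_singleton_self g))
    · rw [hc] at hle
      refine Or.inr ⟨hg, hle.2, fun g' hg' hle' hgg' => ?_⟩
      obtain ⟨b, hb, hc'⟩ := M.elt_of_mem_building hH hg'
      rcases hc' with ⟨h2, -⟩ | ⟨-, hc'⟩
      · exact absurd h2 (hH' g' hg' hle')
      · have := hmax g' hg' b hb (by rw [M.le_iff, hc']; exact ⟨Finset.empty_subset _, hle'⟩)
          (by rw [M.le_iff, hc', hc]; exact ⟨le_rfl, hgg'⟩)
        rw [this, hc] at hc'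
        exact (Prod.ext_iff.1 hc').2.symm
  · rintro (h | ⟨hg, hle, hmax⟩)
    · have hgH := hN.subset h
      have hg := hH.subset hgH
      obtain ⟨b, hb, hc⟩ := M.elt_of_mem_building hH hg
      have hc := (hc.resolve_right fun h1 => h1.1 ⟨hgH, hN.not_isAtom g h⟩).2
      refine ⟨hg, b, hb, ?_, fun g' hg' a' ha' hle' hba' => ?_⟩
      · rw [M.le_iff, hc]
        exact ⟨Finset.singleton_subset_iff.2 h, bot_le⟩
      · obtain ⟨b', hb', hc'⟩ := M.elt_of_mem_building hH hg'
        obtain rfl : a' = b' := Option.some_injective _ (ha'.symm.trans hb')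
        rw [M.le_iff, hc] at hba'
        rcases hc' with ⟨-, hc'⟩ | ⟨-, hc'⟩
        · rw [hc'] at hba'
          have := Finset.mem_singleton.1 (Finset.singleton_subset_iff.1 hba'.1)
          exact M.code_injective (by rw [hc, hc', this])
        · rw [hc'] at hba'
          exact absurd (Finset.singleton_subset_iff.1 hba'.1) (Finset.notMem_empty g)
    · obtain ⟨b, hb, hc⟩ := M.elt_of_mem_building hH hg
      have hc := (hc.resolve_left fun h1 => hH' g hg hle h1.1).2
      refine ⟨hg, b, hb, ?_, fun g' hg' a' ha' hle' hba' => ?_⟩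
      · rw [M.le_iff, hc]
        exact ⟨Finset.empty_subset _, hle⟩
      · obtain ⟨b', hb', hc'⟩ := M.elt_of_mem_building hH hg'
        obtain rfl : a' = b' := Option.some_injective _ (ha'.symm.trans hb')
        rw [M.le_iff, hc] at hba'
        rw [M.le_iff] at hle'
        rcases hc' with ⟨-, hc'⟩ | ⟨-, hc'⟩
        · rw [hc'] at hba'
          exact absurd (le_bot_iff.1 hba'.2 ▸ hg) hG.1
        · rw [hc'] at hba' hle'
          exact M.code_injective (by rw [hc, hc', hmax g' hg' hle'.2 hba'.2])

include hG in
-- An atom below `(M.code y).2 ⊓ g` lies below some factor `f` of `(M.code y).2`. As `f` and `g`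
-- share it, nestedness gives `f < g`, so such factors account for the whole meet.
lemma StageModel.zElt_eq (hy : X.proj y ≠ ⊤) {g : L} (hg : g ∈ insert ⊤ (M.code y).1) :
    X.zElt G y g = lowerJoin (M.code y).1 (M.code y).2 g := by
  have hN := M.isLocalPair y hH hy
  have hmem : ∀ f, f ∈ X.factorsPlus G y ↔
      f = ⊤ ∨ f ∈ (M.code y).1 ∨ f ∈ latticeFactors G (M.code y).2 := fun f => by
    rw [BlowupStage.factorsPlus, Finset.mem_insert, M.mem_factors hG hH]
  unfold BlowupStage.zElt lowerJoin
  apply le_antisymm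
  · refine Finset.sup_le fun f hf => ?_
    obtain ⟨h1, h2⟩ := Finset.mem_filter.1 hf
    rcases (hmem f).1 h1 with rfl | h1 | h1
    · exact absurd h2 not_top_lt
    · exact (Finset.le_sup (f := id) (Finset.mem_filter.2 ⟨h1, h2⟩)).trans le_sup_left
    · exact (le_inf (mem_latticeFactors.1 h1).2.1 h2.le).trans le_sup_right
  · refine sup_le (Finset.sup_mono fun f hf => ?_) ?_
    · obtain ⟨h1, h2⟩ := Finset.mem_filter.1 hf
      exact Finset.mem_filter.2 ⟨(hmem f).2 (Or.inr (Or.inl h1)), h2⟩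
    · rw [← sup_atomsBelow ((M.code y).2 ⊓ g)]
      refine Finset.sup_le fun a ha => ?_
      obtain ⟨ha, hle⟩ := mem_atomsBelow.1 ha
      obtain ⟨f, hf, haf⟩ := exists_latticeFactors_ge (hH.subset (hH.atoms_mem a ha))
        (hle.trans inf_le_left)
      have hf' := mem_latticeFactors.1 hf
      have hfg : f < g := by
        rcases Finset.mem_insert.1 hg with rfl | hgS
        · exact lt_of_le_of_lt hf'.2.1 (lt_top_iff_ne_top.2 hN.ne_top)
        · have hgH := hN.subset hgS
          have hga := hN.not_isAtom g hgS
          have hfgH : f ⊔ g ∈ H := hH.sup_mem hG hf'.1 hgH hga ha haf (hle.trans inf_le_right)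
          have hs : (insert g (atomsBelow f)).sup id = f ⊔ g := by
            rw [Finset.sup_insert, sup_atomsBelow, sup_comm, id]
          have := hN.nested (insert g (atomsBelow f)) ?_ (hs.symm ▸ hfgH)
          · rw [hs] at this
            rcases Finset.mem_insert.1 this with h | h
            · refine lt_of_le_of_ne (sup_eq_right.1 h) ?_
              rintro rfl
              exact hN.not_le f hgH hga hf'.2.1
            · exact absurd (mem_atomsBelow.1 h).1
                (hH.filter g hgH hga _ (hH.subset hfgH) le_sup_right).2
          · intro e he
            rcases Finset.mem_insert.1 he with rfl | he
            · exact Or.inl hgS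
            · have := mem_atomsBelow.1 he
              exact Or.inr ⟨this.1, this.2.trans hf'.2.1⟩
      exact haf.trans (Finset.le_sup (f := id)
        (Finset.mem_filter.2 ⟨(hmem f).2 (Or.inr (Or.inr hf)), hfg⟩))

omit [IsAtomistic L] hH in
-- Downward closure of nested pairs allows descent in unit steps: remove an element of the nested
-- set, or, when it is empty, pass to an element covered by the second component.
lemma StageModel.rank_eq [IsUpperModularLattice L] :
    X.rank y = (M.code y).1.card + latticeRank (M.code y).2 := by
  have h : Order.height y = ((M.code y).1.card + latticeRank (M.code y).2 : ℕ) := by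
    refine height_eq_of_strictMono_of_exists
      (fun a => (M.code a).1.card + latticeRank (M.code a).2) (fun a b hab => ?_) (fun a ha => ?_) y
    · have h1 := (M.le_iff a b).1 hab.le
      have h2 := Finset.card_le_card h1.1
      have h3 := latticeRank_mono h1.2
      by_contra hcon
      change ¬ (_ + _ < _ + _) at hcon
      have h4 := Finset.eq_of_subset_of_card_le h1.1 (by omega)
      have h5 := eq_of_le_of_latticeRank_le h1.2 (by omega)
      exact hab.ne (M.code_injective (Prod.ext h4 h5))
    · have hN := (M.exists_iff _ _).2 ⟨a, rfl⟩
      by_cases hS : (M.code a).1.Nonempty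
      · obtain ⟨s, hs⟩ := hS
        obtain ⟨b, hb⟩ := (M.exists_iff _ _).1
          (hN.mono (Finset.erase_subset s _) (le_refl (M.code a).2))
        refine ⟨b, lt_of_le_of_ne ((M.le_iff b a).2 (by
          rw [hb]; exact ⟨Finset.erase_subset s _, le_rfl⟩)) ?_, ?_⟩
        · rintro rfl
          have h1 : (M.code b).1 = (M.code b).1.erase s := (Prod.ext_iff.1 hb).1
          exact (Finset.notMem_erase s (M.code b).1 : s ∉ (M.code b).1.erase s) (by
            rwa [← h1])
        · have := Finset.card_pos.2 ⟨s, hs⟩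
          simp only [hb, Finset.card_erase_of_mem hs]
          omega
      · rw [Finset.not_nonempty_iff_eq_empty] at hS
        have hne : (M.code a).2 ≠ ⊥ := by
          intro h
          simp only [hS, h, Finset.card_empty, latticeRank_bot] at ha
          exact ha rfl
        obtain ⟨c, -, hc⟩ := exists_le_covBy_of_lt (bot_lt_iff_ne_bot.2 hne)
        obtain ⟨b, hb⟩ := (M.exists_iff _ _).1 (hN.mono (le_refl (M.code a).1) hc.le)
        refine ⟨b, lt_of_le_of_ne ((M.le_iff b a).2 (by rw [hb]; exact ⟨le_rfl, hc.le⟩)) ?_, ?_⟩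
        · rintro rfl
          exact hc.ne (Prod.ext_iff.1 hb).2.symm
        · simp only [hb, latticeRank_covBy hc]
          omega
  rw [BlowupStage.rank, h]
  exact ENat.toNat_natCast _

end Final

end Stage

/-! ## Perfect pairings on graded quotients -/

section Perfect

open MvPolynomial

variable {L : Type u} [Lattice L] [BoundedOrder L] {H S : Finset L}

lemma weight_two {ι : Type*} (m : ι →₀ ℕ) :
    Finsupp.weight (fun _ : ι => (2 : ℤ)) m = 2 * (m.degree : ℤ) := by
  rw [Finsupp.weight_apply, Finsupp.sum, Finsupp.degree_apply, Nat.cast_sum, Finset.mul_sum]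
  exact Finset.sum_congr rfl fun i _ => by rw [nsmul_eq_mul, mul_comm]

lemma mk_mem_dpPart {f : MvPolynomial H ℚ} {d : ℕ} (hf : f.IsHomogeneous d) :
    Ideal.Quotient.mk (dpIdeal H S) f ∈ dpPart H S (2 * (d : ℤ)) := by
  refine Submodule.mem_map.2 ⟨f, ?_, rfl⟩
  rw [mem_weightedHomogeneousSubmodule]
  intro m hm
  have : m.degree = d := by
    rw [Finsupp.degree_eq_weight_one]
    exact hf hm
  rw [weight_two, this]

lemma exists_of_mem_dpPart {j : ℤ} {w : DPAlg H S} (hw : w ∈ dpPart H S j) :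
    ∃ f : MvPolynomial H ℚ, Ideal.Quotient.mk (dpIdeal H S) f = w ∧
      ((∃ d : ℕ, j = 2 * (d : ℤ) ∧ f.IsHomogeneous d) ∨ f = 0) := by
  obtain ⟨f, hf, rfl⟩ := Submodule.mem_map.1 hw
  refine ⟨f, rfl, ?_⟩
  rw [mem_weightedHomogeneousSubmodule] at hf
  by_cases h0 : f = 0
  · exact Or.inr h0
  · obtain ⟨m, hm⟩ := exists_coeff_ne_zero h0
    refine Or.inl ⟨m.degree, ?_, fun m' hm' => ?_⟩
    · rw [← hf hm, weight_two]
    · have := (hf hm').trans (hf hm).symm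
      rw [weight_two, weight_two] at this
      have h1 : Finsupp.weight 1 m' = m'.degree := by rw [Finsupp.degree_eq_weight_one]; rfl
      exact h1.trans (by omega)

lemma dpPart_mul {i j : ℤ} {u v : DPAlg H S} (hu : u ∈ dpPart H S i) (hv : v ∈ dpPart H S j) :
    u * v ∈ dpPart H S (i + j) := by
  obtain ⟨f, rfl, ⟨d, rfl, hf⟩ | rfl⟩ := exists_of_mem_dpPart hu
  · obtain ⟨g, rfl, ⟨e, rfl, hg⟩ | rfl⟩ := exists_of_mem_dpPart hv
    · have := mk_mem_dpPart (S := S) (hf.mul hg)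
      rwa [map_mul, Nat.cast_add, mul_add] at this
    · rw [map_zero, mul_zero]
      exact Submodule.zero_mem _
  · rw [map_zero, zero_mul]
    exact Submodule.zero_mem _

lemma exists_sum_dpPart (w : DPAlg H S) : ∃ (N : ℕ) (c : ℕ → DPAlg H S),
    (∀ d : ℕ, c d ∈ dpPart H S (2 * (d : ℤ))) ∧ w = ∑ d ∈ Finset.range N, c d := by
  obtain ⟨f, rfl⟩ := Ideal.Quotient.mk_surjective w
  refine ⟨f.totalDegree + 1, fun d => Ideal.Quotient.mk _ (homogeneousComponent d f),
    fun d => mk_mem_dpPart (homogeneousComponent_isHomogeneous d f), ?_⟩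
  rw [← map_sum, sum_homogeneousComponent]

variable {n : ℕ} {φ : MvPolynomial H ℚ →ₗ[ℚ] ℚ}

lemma exists_quotient_functional (hann : annIdeal φ = dpIdeal H S) :
    ∃ ψ : DPAlg H S →ₗ[ℚ] ℚ, ∀ f, ψ (Ideal.Quotient.mk (dpIdeal H S) f) = φ f := by
  obtain ⟨σ, hσ⟩ := (Ideal.Quotient.mkₐ ℚ (dpIdeal H S)).toLinearMap.exists_rightInverse_of_surjective
    (LinearMap.range_eq_top.2 Ideal.Quotient.mk_surjective)
  refine ⟨φ.comp σ, fun f => ?_⟩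
  have h1 : Ideal.Quotient.mk (dpIdeal H S) (σ (Ideal.Quotient.mk _ f)) = Ideal.Quotient.mk _ f :=
    LinearMap.congr_fun hσ (Ideal.Quotient.mk _ f)
  have h2 := apply_eq_zero_of_mem_annIdeal (hann.symm.le (Ideal.Quotient.eq.1 h1))
  rw [map_sub, sub_eq_zero] at h2
  exact h2

/-- Powers of a variable beyond degree `n` are relations, so the variables are nilpotent and the
algebra is integral and finitely generated over `ℚ`. -/
lemma finite_dpAlg (hann : annIdeal φ = dpIdeal H S) (hφ : IsHomogeneousFunctional φ n) :
    Module.Finite ℚ (DPAlg H S) := by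
  have : Algebra.IsIntegral ℚ (DPAlg H S) := by
    refine ⟨fun w => ?_⟩
    obtain ⟨f, rfl⟩ := Ideal.Quotient.mk_surjective w
    induction f using MvPolynomial.induction_on with
    | C q => exact isIntegral_algebraMap (R := ℚ) (A := DPAlg H S) (x := q)
    | add f g hf hg => rw [map_add]; exact hf.add hg
    | mul_X f i hf =>
      rw [map_mul]
      refine hf.mul (IsIntegral.of_pow n.succ_pos ?_)
      rw [← map_pow, Ideal.Quotient.eq_zero_iff_mem.2]
      · exact isIntegral_zero
      · rw [← hann]
        exact hφ.mem_annIdeal_of_lt (isHomogeneous_X_pow i _) n.lt_succ_self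
  exact Algebra.IsIntegral.finite

/-- `ψ` is homogeneous of degree `2 * n` and induces a perfect pairing on `DPAlg H S`. -/
structure IsPerfectFunctional (n : ℕ) (ψ : DPAlg H S →ₗ[ℚ] ℚ) : Prop where
  apply_eq_zero : ∀ j : ℤ, j ≠ 2 * n → ∀ w ∈ dpPart H S j, ψ w = 0
  eq_zero : ∀ u, (∀ v, ψ (u * v) = 0) → u = 0
  eq_zero_of_mem : ∀ w ∈ dpPart H S (2 * n), ψ w = 0 → w = 0

lemma isPerfectFunctional (hann : annIdeal φ = dpIdeal H S) (hφ : IsHomogeneousFunctional φ n)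
    {ψ : DPAlg H S →ₗ[ℚ] ℚ} (hψ : ∀ f, ψ (Ideal.Quotient.mk (dpIdeal H S) f) = φ f) :
    IsPerfectFunctional n ψ where
  apply_eq_zero j hj w hw := by
    obtain ⟨f, rfl, ⟨d, rfl, hf⟩ | rfl⟩ := exists_of_mem_dpPart hw
    · rw [hψ]
      exact hφ.apply_eq_zero hf fun h => hj (by rw [h])
    · rw [map_zero, map_zero]
  eq_zero u hu := by
    obtain ⟨f, rfl⟩ := Ideal.Quotient.mk_surjective u
    rw [Ideal.Quotient.eq_zero_iff_mem, ← hann]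
    intro g
    rw [← hψ, map_mul]
    exact hu _
  eq_zero_of_mem w hw h0 := by
    obtain ⟨f, rfl, ⟨d, hd, hf⟩ | rfl⟩ := exists_of_mem_dpPart hw
    · obtain rfl : n = d := by omega
      rw [Ideal.Quotient.eq_zero_iff_mem, ← hann]
      exact hφ.mem_annIdeal hf (by rw [← hψ, h0])
    · exact map_zero _

variable {ψ : DPAlg H S →ₗ[ℚ] ℚ}

/-- `ψ` sees only the component of degree `2 * n` and is injective there, so its kernel is the sum
of the other homogeneous parts. -/
lemma IsPerfectFunctional.sub_smul_mem_iff (h : IsPerfectFunctional n ψ) {μ : DPAlg H S}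
    (hμ : μ ∈ dpPart H S (2 * n)) (w : DPAlg H S) (c : ℚ) :
    w - c • μ ∈ (⨆ j : {j : ℤ // j ≠ 2 * (n : ℤ)}, dpPart H S j) ↔ ψ w = c * ψ μ := by
  constructor
  · intro hw
    have hle : (⨆ j : {j : ℤ // j ≠ 2 * (n : ℤ)}, dpPart H S j) ≤ LinearMap.ker ψ :=
      iSup_le fun j u hu => h.apply_eq_zero j j.2 u hu
    have := hle hw
    rwa [LinearMap.mem_ker, map_sub, map_smul, smul_eq_mul, sub_eq_zero] at this
  · intro hw
    have h0 : ψ (w - c • μ) = 0 := by rw [map_sub, map_smul, smul_eq_mul, hw, sub_self]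
    obtain ⟨N, u, hu, hsum⟩ := exists_sum_dpPart (w - c • μ)
    have hn : n ∈ Finset.range N → u n = 0 := by
      intro hn
      refine h.eq_zero_of_mem _ (hu n) ?_
      rw [← h0, hsum, map_sum, Finset.sum_eq_single_of_mem n hn]
      exact fun d _ hd => h.apply_eq_zero _ (by omega) _ (hu d)
    rw [hsum]
    refine Submodule.sum_mem _ fun d hd => ?_
    by_cases hdn : d = n
    · subst hdn
      rw [hn hd]
      exact Submodule.zero_mem _
    · exact Submodule.mem_iSup_of_mem ⟨2 * (d : ℤ), by omega⟩ (hu d)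

/-- A component of `v` in a degree other than `i + 2 * n` pairs to zero with its complementary
degree by hypothesis, and with all other degrees by homogeneity, so it vanishes by nondegeneracy. -/
lemma IsPerfectFunctional.mem_dpPart_iff (h : IsPerfectFunctional n ψ) (i : ℤ) (v : DPAlg H S) :
    (∀ j : ℤ, j ≠ -i → ∀ w ∈ dpPart H S j, ψ (w * v) = 0) ↔ v ∈ dpPart H S (i + 2 * n) := by
  constructor
  · intro hv
    obtain ⟨N, c, hc, hsum⟩ := exists_sum_dpPart v
    rw [hsum]
    refine Submodule.sum_mem _ fun d hd => ?_
    by_cases hdi : 2 * (d : ℤ) = i + 2 * n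
    · exact hdi ▸ hc d
    · suffices c d = 0 by rw [this]; exact Submodule.zero_mem _
      refine h.eq_zero _ fun w => ?_
      obtain ⟨K, b, hb, rfl⟩ := exists_sum_dpPart w
      rw [Finset.mul_sum, map_sum]
      refine Finset.sum_eq_zero fun e _ => ?_
      by_cases hde : 2 * (d : ℤ) + 2 * e = 2 * n
      · rw [← hv (2 * e) (by omega) _ (hb e), hsum, Finset.mul_sum, map_sum,
          Finset.sum_eq_single_of_mem d hd, mul_comm]
        intro d' _ hd'
        exact h.apply_eq_zero _ (by omega) _ (dpPart_mul (hb e) (hc d'))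
      · exact h.apply_eq_zero _ hde _ (dpPart_mul (hc d) (hb e))
  · intro hv j hj w hw
    exact h.apply_eq_zero _ (by omega) _ (dpPart_mul hw hv)

/-- The map to the dual that is induced by a functional, as a linear map over `A`. -/
noncomputable def mulFunctional {A B : Type u} [CommRing A] [CommRing B] [Algebra ℚ B]
    (f : A →+* B) (ψ : B →ₗ[ℚ] ℚ) :
    letI := Module.compHom B f
    letI := dualModule f
    B →ₗ[A] Module.Dual ℚ B :=
  letI := Module.compHom B f
  letI := dualModule f
  { toFun := fun v => ψ.comp (LinearMap.mulRight ℚ v)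
    map_add' := fun u v => by
      ext1 w
      change ψ (w * (u + v)) = ψ (w * u) + ψ (w * v)
      rw [mul_add, map_add]
    map_smul' := fun a v => by
      ext1 w
      change ψ (w * (f a * v)) = ψ (f a * w * v)
      rw [mul_left_comm, mul_assoc] }

lemma bijective_mulRight {B : Type u} [CommRing B] [Algebra ℚ B] [Module.Finite ℚ B]
    (ψ : B →ₗ[ℚ] ℚ) (h : ∀ u, (∀ v, ψ (u * v) = 0) → u = 0) :
    Function.Bijective fun v => ψ.comp (LinearMap.mulRight ℚ v) := by
  let Ψ : B →ₗ[ℚ] Module.Dual ℚ B :=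
    { toFun := fun v => ψ.comp (LinearMap.mulRight ℚ v)
      map_add' := fun u v => by
        ext1 w
        change ψ (w * (u + v)) = ψ (w * u) + ψ (w * v)
        rw [mul_add, map_add]
      map_smul' := fun c v => by
        ext1 w
        change ψ (w * (c • v)) = c * ψ (w * v)
        rw [mul_smul_comm, map_smul, smul_eq_mul] }
  have hinj : Function.Injective Ψ := by
    rw [injective_iff_map_eq_zero]
    intro v hv
    refine h v fun u => ?_
    rw [mul_comm]
    exact LinearMap.congr_fun hv u
  exact ⟨hinj, (LinearMap.injective_iff_surjective_of_finrank_eq_finrank (f := Ψ)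
    Subspace.dual_finrank_eq.symm).1 hinj⟩

/-- The map to the dual that is induced by a functional. -/
noncomputable def pairingMap (ψ : DPAlg H S →ₗ[ℚ] ℚ) : DPAlg H S →ₗ[DPAlg H ∅] DPDual H S :=
  mulFunctional (dpRestrict H S) ψ

lemma IsPerfectFunctional.bijective_pairingMap [Module.Finite ℚ (DPAlg H S)]
    (h : IsPerfectFunctional n ψ) : Function.Bijective (pairingMap ψ) :=
  bijective_mulRight ψ h.eq_zero

end Perfect

/-! ## Restriction to the variables of a partial building set -/

section Transfer

open MvPolynomial
open scoped Classical

variable {L : Type u} {H : Finset L}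

/-- The homomorphism that sends the variables outside `H` to zero. -/
noncomputable def restrictVars (H : Finset L) : MvPolynomial L ℚ →ₐ[ℚ] MvPolynomial H ℚ :=
  aeval fun g => if h : g ∈ H then X ⟨g, h⟩ else 0

lemma restrictVars_X_of_mem {g : L} (h : g ∈ H) : restrictVars H (X g) = X ⟨g, h⟩ := by
  rw [restrictVars, aeval_X, dif_pos h]

lemma restrictVars_X_of_notMem {g : L} (h : g ∉ H) : restrictVars H (X g) = 0 := by
  rw [restrictVars, aeval_X, dif_neg h]

lemma restrictVars_rename (f : MvPolynomial H ℚ) :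
    restrictVars H (rename Subtype.val f) = f := by
  have : (restrictVars H).comp (rename Subtype.val) = AlgHom.id ℚ (MvPolynomial H ℚ) := by
    ext i : 1
    rw [AlgHom.comp_apply, rename_X, restrictVars_X_of_mem i.2]
    rfl
  exact AlgHom.congr_fun this f

lemma rename_restrictVars_sub_mem {I : Ideal (MvPolynomial L ℚ)} (hI : ∀ g, g ∉ H → X g ∈ I)
    (f : MvPolynomial L ℚ) : rename Subtype.val (restrictVars H f) - f ∈ I := by
  induction f using MvPolynomial.induction_on with
  | C q =>
    rw [← algebraMap_eq, AlgHom.commutes, AlgHom.commutes, sub_self]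
    exact I.zero_mem
  | add f g hf hg =>
    rw [map_add, map_add, add_sub_add_comm]
    exact I.add_mem hf hg
  | mul_X f g hf =>
    by_cases hg : g ∈ H
    · rw [map_mul, map_mul, restrictVars_X_of_mem hg, rename_X, ← sub_mul]
      exact I.mul_mem_right _ hf
    · rw [map_mul, restrictVars_X_of_notMem hg, mul_zero, map_zero, zero_sub]
      exact I.neg_mem (I.mul_mem_left _ (hI g hg))

lemma rename_cElt [Lattice L] (a : L) :
    rename Subtype.val (cElt H a) = (∑ h ∈ H with a ≤ h, X h : MvPolynomial L ℚ) := by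
  rw [cElt, map_sum, Finset.sum_filter,
    ← Finset.sum_coe_sort H (fun h => if a ≤ h then (X h : MvPolynomial L ℚ) else 0)]
  refine Finset.sum_congr rfl fun h _ => ?_
  split_ifs
  · rw [rename_X]
  · rw [map_zero]

lemma annIdeal_comp_rename [Lattice L] [BoundedOrder L] (hbot : ⊥ ∉ H) {S : Finset L} (hS : S ⊆ H)
    {φ : MvPolynomial L ℚ →ₗ[ℚ] ℚ} (hφ : annIdeal φ = nestedIdeal H S) :
    annIdeal (φ.comp (rename (Subtype.val : H → L)).toLinearMap) = dpIdeal H S := by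
  have hmap : ∀ T : Finset H, (T.map (Function.Embedding.subtype _) : Finset L) ⊆ H := by
    intro T t ht
    obtain ⟨u, -, rfl⟩ := Finset.mem_map.1 ht
    exact u.2
  refine annIdeal_comp (rename Subtype.val) (restrictVars H : MvPolynomial L ℚ →+* _) φ _ ?_ ?_
    (fun f => ?_) fun g => ?_
  · rw [hφ]
    refine Ideal.span_le.2 ?_
    rintro f (⟨T, hT, rfl⟩ | ⟨a, ha, rfl⟩)
    · rw [SetLike.mem_coe, Ideal.mem_comap, map_prod]
      have : ∏ t ∈ T, rename Subtype.val (X t : MvPolynomial H ℚ) =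
          ∏ t ∈ T.map (Function.Embedding.subtype _), (X t : MvPolynomial L ℚ) := by
        rw [Finset.prod_map]
        exact Finset.prod_congr rfl fun t _ => rename_X _ _
      rw [this]
      refine prod_mem_nestedIdeal (hmap T) fun h => hT ((isNested_iff hbot).2
        ⟨Finset.union_subset hS (hmap T), ?_⟩)
      rwa [Finset.coe_union]
    · rw [SetLike.mem_coe, Ideal.mem_comap, rename_cElt]
      exact sum_mem_nestedIdeal ha
  · rw [hφ]
    refine nestedIdeal_le (fun g hg => ?_) (fun T hT hn => ?_) fun a ha => ?_
    · rw [Ideal.mem_comap, RingHom.coe_coe, restrictVars_X_of_notMem hg]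
      exact Ideal.zero_mem _
    · have hT' : (T.subtype (· ∈ H)).map (Function.Embedding.subtype _) = T :=
        Finset.subtype_map_of_mem fun t ht => hT ht
      rw [Ideal.mem_comap, RingHom.coe_coe]
      refine Ideal.subset_span (Or.inl ⟨T.subtype (· ∈ H), fun h => hn ?_, ?_⟩)
      · have := ((isNested_iff hbot).1 h).2
        rwa [hT', Finset.coe_union] at this
      · conv_lhs => rw [← hT', Finset.prod_map, map_prod]
        exact Finset.prod_congr rfl fun t _ => restrictVars_X_of_mem t.2
    · rw [Ideal.mem_comap, RingHom.coe_coe, ← rename_cElt, restrictVars_rename]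
      exact Ideal.subset_span (Or.inr ⟨a, ha, rfl⟩)
  · rw [RingHom.coe_coe, restrictVars_rename, sub_self]
    exact Ideal.zero_mem _
  · exact rename_restrictVars_sub_mem (fun g hg => hφ ▸ X_mem_nestedIdeal hg) g

lemma IsHomogeneousFunctional.comp_rename {φ : MvPolynomial L ℚ →ₗ[ℚ] ℚ} {n : ℕ}
    (h : IsHomogeneousFunctional φ n) :
    IsHomogeneousFunctional (φ.comp (rename (Subtype.val : H → L)).toLinearMap) n := by
  intro f
  have : (rename (Subtype.val : H → L)).comp (doubleHom H) =
      (doubleHom L).comp (rename (Subtype.val : H → L)) := by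
    ext i : 1
    rw [AlgHom.comp_apply, AlgHom.comp_apply, rename_X, doubleHom_X, doubleHom_X, map_mul,
      rename_X, map_ofNat]
  have h1 := AlgHom.congr_fun this f
  simp only [AlgHom.comp_apply] at h1
  rw [LinearMap.comp_apply, LinearMap.comp_apply, AlgHom.toLinearMap_apply,
    AlgHom.toLinearMap_apply, h1, h]

end Transfer

/-! ### The monomial `μ_y`, the normalised pairing and the theorem -/

section Main

open MvPolynomial
open scoped Classical

variable {L : Type u} [Lattice L] [BoundedOrder L] [Finite L] [IsAtomistic L] {G H : Finset L}

/-- The monomial that represents `muElt`. -/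
noncomputable def muPoly (X : BlowupStage L) (G H : Finset L) (y : X.carrier) :
    MvPolynomial H ℚ :=
  ∏ g : H, if (g : L) ∈ X.factorsPlus G y then
    (-MvPolynomial.X g) ^ (intervalRank (X.zElt G y g) g - 1) else 1

omit [Finite L] [IsAtomistic L] in
lemma exists_isHomogeneous_muPoly (X : BlowupStage L) (G H : Finset L) (y : X.carrier) :
    ∃ d, (muPoly X G H y).IsHomogeneous d := by
  have : ∀ g : H, ∃ d, (if (g : L) ∈ X.factorsPlus G y then
      (-MvPolynomial.X g) ^ (intervalRank (X.zElt G y g) g - 1) else 1 :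
        MvPolynomial H ℚ).IsHomogeneous d := by
    intro g
    split_ifs
    · exact ⟨_, ((isHomogeneous_X ℚ g).neg).pow _⟩
    · exact ⟨0, isHomogeneous_one _ _⟩
  choose d hd using this
  exact ⟨_, IsHomogeneous.prod _ _ d fun g _ => hd g⟩

lemma StageModel.rename_muPoly [IsUpperModularLattice L] (hG : IsBuildingSet G) (hH : IsPartialBuildingSet G H)
    (htop : ⊤ ∈ H) {X : BlowupStage L} (M : StageModel X (H.filter fun h => ¬ IsAtom h))
    {y : X.carrier} (hy : X.proj y ≠ ⊤) :
    rename Subtype.val (muPoly X G H y) = topMonomial (M.code y).1 (M.code y).2 := by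
  have hN := M.isLocalPair y hH hy
  have hsub : insert ⊤ (M.code y).1 ⊆ H := Finset.insert_subset htop hN.subset
  have hmem : ∀ f, f ∈ X.factorsPlus G y ↔
      f = ⊤ ∨ f ∈ (M.code y).1 ∨ f ∈ latticeFactors G (M.code y).2 := fun f => by
    rw [BlowupStage.factorsPlus, Finset.mem_insert, M.mem_factors hG hH]
  have h1 : rename Subtype.val (muPoly X G H y) = ∏ g ∈ H, if g ∈ X.factorsPlus G y then
      (-MvPolynomial.X g : MvPolynomial L ℚ) ^ (intervalRank (X.zElt G y g) g - 1) else 1 := by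
    rw [← Finset.prod_coe_sort H, muPoly, map_prod]
    refine Finset.prod_congr rfl fun g _ => ?_
    split_ifs
    · rw [map_pow, map_neg, rename_X]
    · rw [map_one]
  rw [h1, topMonomial, ← Finset.prod_subset hsub]
  · refine Finset.prod_congr rfl fun g hg => ?_
    rw [if_pos ((hmem g).2 ((Finset.mem_insert.1 hg).imp_right Or.inl)),
      M.zElt_eq hG hH y hy hg]
  · intro g hgH hg
    split_ifs with hgF
    · have hgx : g ∈ latticeFactors G (M.code y).2 := by
        rcases (hmem g).1 hgF with h | h | h
        · exact absurd (Finset.mem_insert.2 (Or.inl h)) hg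
        · exact absurd (Finset.mem_insert_of_mem h) hg
        · exact h
      have hga : IsAtom g := by
        by_contra h
        exact hN.not_le g hgH h (mem_latticeFactors.1 hgx).2.1
      -- Members of `H` among the factors of the second component are atoms, so their exponent is
      -- `0`, with truncated subtraction covering every value of the lower join.
      have : intervalRank (X.zElt G y g) g - 1 = 0 := by
        rw [intervalRank, latticeRank_atom hga]
        omega
      rw [this, pow_zero]
    · rfl

omit [Finite L] [IsAtomistic L] in
lemma muElt_eq (X : BlowupStage L) (G H : Finset L) (y : X.carrier) :
    muElt X G H y = Ideal.Quotient.mk _ (muPoly X G H y) := rfl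

end Main

section Pairing

variable {L : Type u} [Lattice L] [BoundedOrder L] {X : BlowupStage L} {G H : Finset L}
  {y : X.carrier} {n : ℕ} {ψ : DPAlg H (X.supp H y) →ₗ[ℚ] ℚ}

lemma IsPerfectFunctional.isMuCoeff_iff (h : IsPerfectFunctional n ψ)
    (hμ : muElt X G H y ∈ dpPart H (X.supp H y) (2 * n)) (w : DPAlg H (X.supp H y)) (c : ℚ) :
    IsMuCoeff X G H y (2 * n) w c ↔ ψ w = c * ψ (muElt X G H y) :=
  h.sub_smul_mem_iff hμ w c

lemma IsPerfectFunctional.existsUnique_isMuCoeff (h : IsPerfectFunctional n ψ)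
    (hμ : muElt X G H y ∈ dpPart H (X.supp H y) (2 * n)) (h0 : ψ (muElt X G H y) ≠ 0)
    (w : DPAlg H (X.supp H y)) : ∃! c : ℚ, IsMuCoeff X G H y (2 * n) w c := by
  refine ⟨ψ w / ψ (muElt X G H y), (h.isMuCoeff_iff hμ _ _).2 (div_mul_cancel₀ _ h0).symm,
    fun c hc => ?_⟩
  rw [eq_div_iff h0, ← (h.isMuCoeff_iff hμ _ _).1 hc]

lemma IsPerfectFunctional.smul (h : IsPerfectFunctional n ψ) {k : ℚ} (hk : k ≠ 0) :
    IsPerfectFunctional n (k • ψ) where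
  apply_eq_zero j hj w hw := by rw [LinearMap.smul_apply, h.apply_eq_zero j hj w hw, smul_zero]
  eq_zero u hu := h.eq_zero u fun v => (smul_eq_zero.1 (hu v)).resolve_left hk
  eq_zero_of_mem w hw h0 := h.eq_zero_of_mem w hw ((smul_eq_zero.1 h0).resolve_left hk)

lemma IsPerfectFunctional.muPairing_eq (h : IsPerfectFunctional n ψ)
    (hμ : muElt X G H y ∈ dpPart H (X.supp H y) (2 * n)) (h1 : ψ (muElt X G H y) = 1)
    (u v : DPAlg H (X.supp H y)) : muPairing X G H y (2 * n) u v = ψ (u * v) := by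
  have hex := (h.existsUnique_isMuCoeff hμ (h1.trans_ne one_ne_zero) (u * v)).exists
  rw [muPairing, dif_pos hex, (h.isMuCoeff_iff hμ _ _).1 hex.choose_spec, h1, mul_one]

lemma IsPerfectFunctional.exists_linearEquiv [Module.Finite ℚ (DPAlg H (X.supp H y))]
    (h : IsPerfectFunctional n ψ) (hμ : muElt X G H y ∈ dpPart H (X.supp H y) (2 * n))
    (h1 : ψ (muElt X G H y) = 1) :
    ∃ Φ : DPDual H (X.supp H y) ≃ₗ[DPAlg H ∅] DPAlg H (X.supp H y),
      (∀ u v, Φ.symm v u = muPairing X G H y (2 * n) u v) ∧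
      ∀ (i : ℤ) (φ : DPDual H (X.supp H y)), φ ∈ dpDualPart H (X.supp H y) i ↔
        Φ φ ∈ shiftGrading (dpPart H (X.supp H y)) (2 * n) i := by
  let Ψ := LinearEquiv.ofBijective (pairingMap ψ) h.bijective_pairingMap
  refine ⟨Ψ.symm, fun u v => (h.muPairing_eq hμ h1 u v).symm, fun i φ => ?_⟩
  obtain ⟨v, rfl⟩ := Ψ.surjective φ
  rw [Ψ.symm_apply_apply]
  exact h.mem_dpPart_iff i v

end Pairing

theorem mainTheorem12 {L : Type u} [Lattice L] [BoundedOrder L] [Finite L] [IsAtomistic L]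
    [IsUpperModularLattice L] (r : ℕ) (hr : Order.height (⊤ : L) = r + 1)
    (G H : Finset L) (hG : IsBuildingSet G) (hGtop : ⊤ ∈ G)
    (hH : IsPartialBuildingSet G H) (hHtop : ⊤ ∈ H)
    (l : List L) (hl : IsBlowupOrder H l)
    (y : (iteratedBlowup l).carrier) (hy : (iteratedBlowup l).proj y ≠ ⊤)
    (s : ℤ) (hs : s = 2 * (r : ℤ) - 2 * ((iteratedBlowup l).rank y : ℤ)) :
    muElt (iteratedBlowup l) G H y ∈ dpPart H ((iteratedBlowup l).supp H y) s ∧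
    (∀ w, ∃! c : ℚ, IsMuCoeff (iteratedBlowup l) G H y s w c) ∧
    ∃ Φ : DPDual H ((iteratedBlowup l).supp H y) ≃ₗ[DPAlg H ∅]
        DPAlg H ((iteratedBlowup l).supp H y),
      (∀ u v, Φ.symm v u = muPairing (iteratedBlowup l) G H y s u v) ∧
      ∀ (i : ℤ) (φ : DPDual H ((iteratedBlowup l).supp H y)),
        φ ∈ dpDualPart H ((iteratedBlowup l).supp H y) i ↔
          Φ φ ∈ shiftGrading (dpPart H ((iteratedBlowup l).supp H y)) s i := by
  obtain ⟨M⟩ := exists_stageModel hG hH hl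
  have hloc := M.isLocalPair y hH hy
  have hr' : latticeRank (⊤ : L) = r + 1 := by
    rw [latticeRank, hr]
    exact ENat.toNat_natCast (r + 1)
  obtain ⟨n, φ, hn, hφ⟩ := exists_isDualizing hG hGtop hr' hH hHtop hloc
  have hann := annIdeal_comp_rename (S := (iteratedBlowup l).supp H y) (hH.bot_notMem hG)
    (fun _ h => by classical exact (Finset.mem_filter.1 h).1)
    (hφ.annIdeal_eq.trans (by rw [← M.coe_supp hH y]))
  have hhom : IsHomogeneousFunctional _ n := hφ.homogeneous.comp_rename (H := H)
  obtain ⟨ψ, hψ⟩ := exists_quotient_functional hann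
  have hperf := isPerfectFunctional hann hhom hψ
  have := finite_dpAlg hann hhom
  obtain rfl : s = 2 * n := by
    rw [hs, M.rank_eq y]
    omega
  have hne : φ (MvPolynomial.rename Subtype.val (muPoly (iteratedBlowup l) G H y)) ≠ 0 := by
    rw [M.rename_muPoly hG hH hHtop hy]
    exact hφ.topMonomial_ne_zero
  have hne' : ψ (muElt (iteratedBlowup l) G H y) ≠ 0 := by
    rw [muElt_eq, hψ]
    exact hne
  have hμ : muElt (iteratedBlowup l) G H y ∈
      dpPart H ((iteratedBlowup l).supp H y) (2 * n) := by
    obtain ⟨d, hd⟩ := exists_isHomogeneous_muPoly (iteratedBlowup l) G H y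
    -- The degree of `μ_y` is not computed: it must be `n`, as the functional is homogeneous of
    -- degree `n` and nonzero on it.
    have hdn : d = n := by
      by_contra h
      exact hne (hhom.apply_eq_zero hd h)
    exact hdn ▸ mk_mem_dpPart hd
  -- Dividing `ψ` by its value at `μ_y` makes `ψ (u v)` the coefficient of `μ_y` in `u v`.
  refine ⟨hμ, hperf.existsUnique_isMuCoeff hμ hne',
    (hperf.smul (inv_ne_zero hne')).exists_linearEquiv hμ (inv_mul_cancel₀ hne')⟩
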